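/- **Words.** Let $W=W[0]W[1]W[2]\dots$ be a right-infinite word over a finite alphabet. A finite word is a *subword* of $W$ if it occurs in $W$ as a block of consecutive letters. $W$ is *recurrent* if every subword occurs in $W$ infinitely often, and *periodic* if for some $k\ge 1$ one has $W[i+k]=W[i]$ for all $i$. For finite words write $u\sqsubseteq_k t$ if $u$ has at least $k$ occurrences in $t$, and $u\sqsubseteq t$ for $u\sqsubseteq_1 t$. **Graphs with words.** A *graph with words* is a finite connected directed graph (loops and parallel edges are allowed) in which every edge $e$ carries two finite words, a front word $F(e)$ and a back word $B(e)$, and in which every vertex is either *distributing* (in-degree $1$, out-degree $>1$) or *collecting* (in-degree $>1$, out-degree $1$). A path is a nonempty sequence of consecutive edges. It is *symmetric* if its first edge starts in a collecting vertex and its last edge ends in a distributing vertex. For a path $p=e_1\dots e_n$, $F(p)$ is the concatenation, in order, of the front words of $e_1$ and of those $e_i$, $i\ge2$, that leave distributing vertices; $B(p)$ is the concatenation, in order, of the back words of those $e_i$, $i<n$, that enter collecting vertices and of $e_n$. For paths, $\sqsubseteq_k$ refers to their sequences of edges as words. **Rauzy schemes.** A graph with words $S$ is a *Rauzy scheme*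 for $W$ if: 1. $S$ is strongly connected and has more than one edge. 2. The edges leaving any one distributing vertex have front words with pairwise distinct first letters (in particular, nonempty), and the edges entering any one collecting vertex have back words with pairwise distinct last letters (in particular, nonempty). 3. $F(p)=B(p)$ for every symmetric path $p$. 4. If $p,q$ are symmetric paths, $k$ is a natural number and $F(p)\sqsubseteq_k F(q)$, then $p\sqsubseteq_k q$. 5. All front and back words of edges are subwords of $W$. 6. For every subword $u$ of $W$ there is a symmetric path $p$ with $u\sqsubseteq F(p)$. 7. For every edge $e$ there is a subword $u_e$ of $W$ such that every symmetric path $p$ with $u_e\sqsubseteq F(p)$ passes through $e$. **Elementary evolution.** Let $S$ be a Rauzy scheme for $W$ and let $v$ be a *support edge*, i.e. an edge from a collecting vertex to a distributing vertex. Let $\{x_i\}$ be the edges entering the beginning of $v$ and $\{y_j\}$ the edges leaving the end of $v$ (an edge may belong to both sets), and put $V=F(v)$, $X_i=B(x_i)$, $Y_j=F(y_j)$. The graph $S'$ is obtained from $S$ by deleting $v$, replacing its beginning by vertices $A_i$, one for each $x_i$, so that $x_i$ now ends in $A_i$, replacing its end by vertices $B_j$, one for each $y_j$, so that $y_j$ now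 starts in $B_j$, and adding an edge $v_{ij}$ from $A_i$ to $B_j$ for all $i,j$. In $S'$ the front word of $y_j$ is $VY_j$, the front word of $v_{ij}$ is $Y_j$, the back word of $x_i$ is $X_iV$, the back word of $v_{ij}$ is $X_i$, and all other front and back words are those in $S$. The edge $v_{ij}$ is *bad* if $X_iVY_j$ is not a subword of $W$; all other edges of $S'$ are *good*. A vertex of $S'$ is *non-vanishing* if more than one good edge leaves it or more than one good edge enters it. The vertices of the graph $S''$ are the non-vanishing vertices of $S'$; its edges are the paths in $S'$ along good edges that start and end in non-vanishing vertices and have no non-vanishing intermediate vertices. The natural extension of an edge $e$ of $S''$ to the right (left) is the shortest path in $S''$ that begins with $e$ and ends in a distributing vertex of $S''$ (that ends with $e$ and starts in a collecting vertex of $S''$). The front (back) word of $e$ in $S''$ is the front (back) word in $S'$ of the path of $S'$ that corresponds to the natural extension of $e$ to the right (left). The graph with words $S''$ is the *elementary evolution* $(W,S,v)$. **Theorem.** Let $W$ be a recurrent non-periodic right-infinite word over a finite alphabet, $S$ a Rauzy scheme for $W$ and $v$ a support edge of $S$. Then every edge of $S''$ has a unique natural extension to the right and a unique natural extension to the left (so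 the elementary evolution is well defined), and the elementary evolution $(W,S,v)$ is a graph with words and a Rauzy scheme for $W$, that is, it has properties 1–7. -/

import Mathlib

universe u w

namespace RauzyEvolution

/-! ### Finite words and one-sided infinite words -/

/-- The word `u` occurs in the infinite word `W` at position `i`. -/
def OccursAt {α : Type w} (u : List α) (W : ℕ → α) (i : ℕ) : Prop :=
  ∀ (j : ℕ) (h : j < u.length), u[j] = W (i + j)

/-- The finite word `u` is a subword of the infinite word `W`. -/
def IsSubword {α : Type w} (u : List α) (W : ℕ → α) : Prop :=
  ∃ i, OccursAt u W i

/-- Every subword of `W` occurs in `W` infinitely many times. -/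
def IsRecurrent {α : Type w} (W : ℕ → α) : Prop :=
  ∀ u : List α, IsSubword u W → {i | OccursAt u W i}.Infinite

/-- `W` has a positive period. -/
def IsPeriodic {α : Type w} (W : ℕ → α) : Prop :=
  ∃ k, 0 < k ∧ ∀ i, W (i + k) = W i

/-- The finite word `u` occurs in the finite word `t` at least `k` times; an occurrence is a
factorization `t = p ++ u ++ q`. -/
def OccursAtLeast {β : Type w} (k : ℕ) (u t : List β) : Prop :=
  (k : ℕ∞) ≤ {d : List β × List β | d.1 ++ u ++ d.2 = t}.encard

/-! ### Directed multigraphs and paths -/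

/-- A directed graph; loops and parallel edges are allowed. -/
structure MultiDigraph where
  Vert : Type u
  Edge : Type u
  src : Edge → Vert
  tgt : Edge → Vert

namespace MultiDigraph

variable (G : MultiDigraph.{u})

/-- A distributing vertex: in-degree one, out-degree greater than one. -/
def IsDistributing (x : G.Vert) : Prop :=
  {e | G.tgt e = x}.encard = 1 ∧ 1 < {e | G.src e = x}.encard

/-- A collecting vertex: in-degree greater than one, out-degree one. -/
def IsCollecting (x : G.Vert) : Prop :=
  1 < {e | G.tgt e = x}.encard ∧ {e | G.src e = x}.encard = 1

/-- There is an edge from `x` to `y`. -/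
def Step (x y : G.Vert) : Prop := ∃ e, G.src e = x ∧ G.tgt e = y

/-- Connected (disregarding the orientation), and nonempty. -/
def IsConnected : Prop :=
  Nonempty G.Vert ∧ ∀ x y, Relation.EqvGen G.Step x y

/-- Every vertex can be reached from every vertex along directed edges. -/
def IsStronglyConnected : Prop :=
  ∀ x y, Relation.ReflTransGen G.Step x y

/-- A path, given by its (nonempty) sequence of consecutive edges. -/
def IsPath (p : List G.Edge) : Prop :=
  p ≠ [] ∧ p.IsChain (fun e f => G.tgt e = G.src f)

/-- The first edge of `p` starts in a collecting vertex. -/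
def StartsCollecting (p : List G.Edge) : Prop :=
  ∃ e ∈ p.head?, G.IsCollecting (G.src e)

/-- The last edge of `p` ends in a distributing vertex. -/
def EndsDistributing (p : List G.Edge) : Prop :=
  ∃ e ∈ p.getLast?, G.IsDistributing (G.tgt e)

/-- A symmetric path starts in a collecting vertex and ends in a distributing one. -/
def IsSymmetricPath (p : List G.Edge) : Prop :=
  G.IsPath p ∧ G.StartsCollecting p ∧ G.EndsDistributing p

/-- `p` is the natural extension of the path `s` to the right: a minimal path that begins with
`s` and ends in a distributing vertex. -/
def IsRightExtension (s p : List G.Edge) : Prop :=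
  (G.IsPath p ∧ s <+: p ∧ G.EndsDistributing p) ∧
    ∀ q, G.IsPath q → s <+: q → G.EndsDistributing q → p.length ≤ q.length

/-- `p` is the natural extension of the path `s` to the left: a minimal path that ends with
`s` and starts in a collecting vertex. -/
def IsLeftExtension (s p : List G.Edge) : Prop :=
  (G.IsPath p ∧ s <:+ p ∧ G.StartsCollecting p) ∧
    ∀ q, G.IsPath q → s <:+ q → G.StartsCollecting q → p.length ≤ q.length

open Classical in
/-- The natural extension of an edge to the right (with a dummy value if there is none). -/
noncomputable def rightExtension (e : G.Edge) : List G.Edge :=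
  if h : ∃ p, G.IsRightExtension [e] p then h.choose else [e]

open Classical in
/-- The natural extension of an edge to the left (with a dummy value if there is none). -/
noncomputable def leftExtension (e : G.Edge) : List G.Edge :=
  if h : ∃ p, G.IsLeftExtension [e] p then h.choose else [e]

/-- A support edge goes from a collecting vertex to a distributing vertex. -/
def IsSupportEdge (v : G.Edge) : Prop :=
  G.IsCollecting (G.src v) ∧ G.IsDistributing (G.tgt v)

variable {G}

theorem IsSupportEdge.src_ne {v : G.Edge} (hv : G.IsSupportEdge v) {e : G.Edge} (he : e ≠ v) :
    G.src e ≠ G.src v := by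
  intro h
  obtain ⟨a, ha⟩ := Set.encard_eq_one.1 hv.1.2
  have h1 : e ∈ {f | G.src f = G.src v} := h
  have h2 : v ∈ {f | G.src f = G.src v} := rfl
  rw [ha, Set.mem_singleton_iff] at h1 h2
  exact he (h1.trans h2.symm)

theorem IsSupportEdge.tgt_ne {v : G.Edge} (hv : G.IsSupportEdge v) {e : G.Edge} (he : e ≠ v) :
    G.tgt e ≠ G.tgt v := by
  intro h
  obtain ⟨a, ha⟩ := Set.encard_eq_one.1 hv.2.1
  have h1 : e ∈ {f | G.tgt f = G.tgt v} := h
  have h2 : v ∈ {f | G.tgt f = G.tgt v} := rfl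
  rw [ha, Set.mem_singleton_iff] at h1 h2
  exact he (h1.trans h2.symm)

end MultiDigraph

/-! ### Graphs with words and Rauzy schemes -/

/-- A directed graph with two words on every edge, a front word and a back word. -/
structure WordGraph (α : Type w) extends MultiDigraph.{u} where
  front : Edge → List α
  back : Edge → List α

namespace WordGraph

variable {α : Type w} (S : WordGraph.{u, w} α)

open Classical in
/-- The front word `F(p)` of a path: the front words of its first edge and of all its later edges
that leave distributing vertices, concatenated in order. -/
noncomputable def frontWord : List S.Edge → List α
  | [] => []
  | e :: p => S.front e ++
      (p.filter (fun f => S.IsDistributing (S.src f))).flatMap S.front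

open Classical in
/-- The back word `B(p)` of a path: the back words of all its edges before the last one that enter
collecting vertices, and of its last edge, concatenated in order. -/
noncomputable def backWord (p : List S.Edge) : List α :=
  match p.getLast? with
  | none => []
  | some e =>
      (p.dropLast.filter (fun f => S.IsCollecting (S.tgt f))).flatMap S.back ++ S.back e

/-- A graph with words: a finite connected directed graph, with a front and a back word on
every edge, all of whose vertices are distributing or collecting. -/
structure IsGraphWithWords : Prop where
  finite_vert : Finite S.Vert
  finite_edge : Finite S.Edge
  connected : S.IsConnected
  vert_type : ∀ x, S.IsDistributing x ∨ S.IsCollecting x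

/-- The graph with words `S` is a Rauzy scheme for the infinite word `W`. -/
structure IsRauzyScheme (W : ℕ → α) : Prop extends S.IsGraphWithWords where
  /-- Property 1. -/
  strongly_connected : S.IsStronglyConnected
  more_than_one_edge : Nontrivial S.Edge
  /-- Property 2: the edges leaving a distributing vertex have front words with pairwise distinct
  first letters (in particular these words are nonempty). -/
  front_ne_nil : ∀ e, S.IsDistributing (S.src e) → S.front e ≠ []
  front_head_inj : ∀ e f, S.IsDistributing (S.src e) → S.src e = S.src f →
    (S.front e).head? = (S.front f).head? → e = f
  /-- Property 2: the edges entering a collecting vertex have back words with pairwise distinct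
  last letters (in particular these words are nonempty). -/
  back_ne_nil : ∀ e, S.IsCollecting (S.tgt e) → S.back e ≠ []
  back_last_inj : ∀ e f, S.IsCollecting (S.tgt e) → S.tgt e = S.tgt f →
    (S.back e).getLast? = (S.back f).getLast? → e = f
  /-- Property 3. -/
  front_eq_back : ∀ p, S.IsSymmetricPath p → S.frontWord p = S.backWord p
  /-- Property 4. -/
  path_occurs : ∀ p q, S.IsSymmetricPath p → S.IsSymmetricPath q → ∀ k : ℕ,
    OccursAtLeast k (S.frontWord p) (S.frontWord q) → OccursAtLeast k p q
  /-- Property 5. -/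
  front_subword : ∀ e, IsSubword (S.front e) W
  back_subword : ∀ e, IsSubword (S.back e) W
  /-- Property 6. -/
  subword_covered : ∀ u, IsSubword u W → ∃ p, S.IsSymmetricPath p ∧ u <:+: S.frontWord p
  /-- Property 7. -/
  edge_forced : ∀ e, ∃ u, IsSubword u W ∧
    ∀ p, S.IsSymmetricPath p → u <:+: S.frontWord p → e ∈ p

/-! ### The elementary evolution -/

/-- The edges `x_i` entering the beginning of `v`. -/
abbrev InEdge (v : S.Edge) : Type u := {e : S.Edge // S.tgt e = S.src v}

/-- The edges `y_j` leaving the end of `v`. -/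
abbrev OutEdge (v : S.Edge) : Type u := {e : S.Edge // S.src e = S.tgt v}

open Classical in
/-- The graph with words `S'`: the support edge `v` is replaced by a complete bipartite graph.
The vertices are the vertices of `S` other than the ends of `v`, a vertex `A_i` for every edge
`x_i` and a vertex `B_j` for every edge `y_j`. The edges are the edges of `S` other than `v` (where
`x_i` now ends in `A_i` and `y_j` now starts in `B_j`) and an edge `v_{ij}` from `A_i` to `B_j` for
all `i`, `j`. -/
noncomputable def split (v : S.Edge) (hv : S.IsSupportEdge v) : WordGraph.{u, w} α where
  Vert := {x : S.Vert // x ≠ S.src v ∧ x ≠ S.tgt v} ⊕ (S.InEdge v ⊕ S.OutEdge v)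
  Edge := {e : S.Edge // e ≠ v} ⊕ (S.InEdge v × S.OutEdge v)
  src
    | .inl e =>
        if h : S.src e.1 = S.tgt v then .inr (.inr ⟨e.1, h⟩)
        else .inl ⟨S.src e.1, hv.src_ne e.2, h⟩
    | .inr (x, _) => .inr (.inl x)
  tgt
    | .inl e =>
        if h : S.tgt e.1 = S.src v then .inr (.inl ⟨e.1, h⟩)
        else .inl ⟨S.tgt e.1, h, hv.tgt_ne e.2⟩
    | .inr (_, y) => .inr (.inr y)
  front
    | .inl e => if S.src e.1 = S.tgt v then S.front v ++ S.front e.1 else S.front e.1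
    | .inr (_, y) => S.front y.1
  back
    | .inl e => if S.tgt e.1 = S.src v then S.back e.1 ++ S.front v else S.back e.1
    | .inr (x, _) => S.back x.1

/-- An edge of `S'` is bad if it is an edge `v_{ij}` such that `X_i V Y_j` is not a subword of `W`,
where `X_i` is the back word of `x_i`, `V` the word of `v` and `Y_j` the front word of `y_j`;
all other edges are good. -/
def IsGood (W : ℕ → α) (v : S.Edge) (hv : S.IsSupportEdge v) : (S.split v hv).Edge → Prop
  | .inl _ => True
  | .inr (x, y) => IsSubword (S.back x.1 ++ S.front v ++ S.front y.1) W

end WordGraph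

namespace MultiDigraph

variable (H : MultiDigraph.{u}) (good : H.Edge → Prop)

/-- A vertex is non-vanishing if more than one good edge leaves it or more than one good edge
enters it. -/
def IsNonvanishing (x : H.Vert) : Prop :=
  1 < {e | good e ∧ H.src e = x}.encard ∨ 1 < {e | good e ∧ H.tgt e = x}.encard

/-- The paths along good edges that start and end in non-vanishing vertices and have no
non-vanishing intermediate vertices. -/
structure GoodChain where
  path : List H.Edge
  isPath : H.IsPath path
  good_of_mem : ∀ e ∈ path, good e
  start_nonvanishing : H.IsNonvanishing good (H.src (path.head isPath.1))
  end_nonvanishing : H.IsNonvanishing good (H.tgt (path.getLast isPath.1))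
  inner_vanishing : ∀ e ∈ path.dropLast, ¬ H.IsNonvanishing good (H.tgt e)

/-- The graph whose vertices are the non-vanishing vertices and whose edges are the above
paths. -/
def contract : MultiDigraph.{u} where
  Vert := {x : H.Vert // H.IsNonvanishing good x}
  Edge := H.GoodChain good
  src c := ⟨_, c.start_nonvanishing⟩
  tgt c := ⟨_, c.end_nonvanishing⟩

end MultiDigraph

namespace WordGraph

variable {α : Type w} (S : WordGraph.{u, w} α)

/-- The directed graph underlying the elementary evolution. -/
noncomputable def evolutionGraph (W : ℕ → α) (v : S.Edge) (hv : S.IsSupportEdge v) :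
    MultiDigraph.{u} :=
  (S.split v hv).contract (S.IsGood W v hv)

/-- The path of `S'` that corresponds to a path of the elementary evolution. -/
def expand {W : ℕ → α} {v : S.Edge} {hv : S.IsSupportEdge v}
    (p : List (S.evolutionGraph W v hv).Edge) : List (S.split v hv).Edge :=
  p.flatMap MultiDigraph.GoodChain.path

/-- The elementary evolution `(W, S, v)`. The front (back) word of an edge is the front (back)
word of the path of `S'` that corresponds to the natural extension of the edge to the right
(left). -/
noncomputable def evolution (W : ℕ → α) (v : S.Edge) (hv : S.IsSupportEdge v) :
    WordGraph.{u, w} α where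
  toMultiDigraph := S.evolutionGraph W v hv
  front e := (S.split v hv).frontWord (S.expand ((S.evolutionGraph W v hv).rightExtension e))
  back e := (S.split v hv).backWord (S.expand ((S.evolutionGraph W v hv).leftExtension e))

end WordGraph

end RauzyEvolution

/-! Property 4 only counts occurrences. Together with property 3 it gives more: every occurrence of
F(p) in F(q) is produced by an occurrence of p in q at the matching position
(`isSynchronized_of_path_occurs`). Distinct occurrences of p give distinct positions of F(p), and
property 4 makes this injection of finite sets a bijection. Conversely, synchronization implies
property 4, and it is the form in which the property is carried through the construction. Its main
use is `exists_path_of_occursAt`: a block of W framed by words of symmetric paths is itself the word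
of a symmetric path containing both.

Passing from S to S' does not change the symmetric paths in substance. Sending each v_ij to v, and
restoring v at an end that lies in some B_j or A_i, turns a symmetric path of S' into one of S with
the same words (`split.frontWord_hat`, `split.backWord_hat`). The path uses v_ij exactly where its
image runs through x_i v y_j. So property 3 and synchronization lift to S', a path whose word occurs
in W uses only good edges, and each good edge is forced by some subword of W, namely X_i V Y_j for
v_ij (`split.edge_forced`). By recurrence any two good edges and any subword of W can be met in a
prescribed order by one symmetric path whose word occurs in W (`exists_path_through`).

If no vertex were non-vanishing, good paths would continue in only one way and W would be periodic
(`isPeriodic_of_unique_good`). Counting good edges by their beginnings and by their ends then yields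
non-vanishing vertices of both types (`IsPruned.exists_distributing`, `IsPruned.exists_collecting`).
Hence natural extensions exist; they are unique because a collecting vertex has a single exit.

Contracting good chains preserves vertex types. A chain is determined by its first edge, so paths of
S'' are good paths of S' between non-vanishing vertices, cut in a unique way. The words of natural
extensions fit together so that a symmetric path of S'' has the words of its expansion
(`IsWordContraction.frontWord_eq`, `IsWordContraction.backWord_eq`), which transfers properties 3,
4, 6 and 7. For property 5, the expansion of a natural extension is forced after its first edge, so
every sufficiently long good path through that edge contains it (`IsWordContraction.front_mem`).
Statements about back words and collecting vertices in the contraction follow by reversing all edges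
and words. -/

namespace RauzyEvolution

/-! ### Paths in directed multigraphs, and reversal of the edges. -/

namespace MultiDigraph

variable {G : MultiDigraph.{u}}

/-- Consecutive edges of the list are linked. -/
abbrev Linked (G : MultiDigraph.{u}) (p : List G.Edge) : Prop :=
  p.IsChain (fun e f => G.tgt e = G.src f)

theorem Linked.left {a b : List G.Edge} (h : G.Linked (a ++ b)) : G.Linked a :=
  (List.isChain_append.1 h).1

theorem Linked.right {a b : List G.Edge} (h : G.Linked (a ++ b)) : G.Linked b :=
  (List.isChain_append.1 h).2.1

theorem Linked.tail {e : G.Edge} {b : List G.Edge} (h : G.Linked (e :: b)) : G.Linked b :=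
  (List.isChain_cons.1 h).2

theorem Linked.tgt_eq_src {a b : List G.Edge} {e f : G.Edge}
    (h : G.Linked (a ++ e :: f :: b)) : G.tgt e = G.src f := by
  have := h.right
  exact (List.isChain_cons_cons.1 this).1

@[simp] theorem startsCollecting_cons {e : G.Edge} {p : List G.Edge} :
    G.StartsCollecting (e :: p) ↔ G.IsCollecting (G.src e) := by
  simp [StartsCollecting]

@[simp] theorem endsDistributing_concat {e : G.Edge} {p : List G.Edge} :
    G.EndsDistributing (p ++ [e]) ↔ G.IsDistributing (G.tgt e) := by
  simp [EndsDistributing]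

@[simp] theorem endsDistributing_singleton {e : G.Edge} :
    G.EndsDistributing [e] ↔ G.IsDistributing (G.tgt e) := by
  simp [EndsDistributing]

@[simp] theorem not_startsCollecting_nil : ¬ G.StartsCollecting [] := by
  simp [StartsCollecting]

@[simp] theorem not_endsDistributing_nil : ¬ G.EndsDistributing [] := by
  simp [EndsDistributing]

@[simp] theorem endsDistributing_cons_cons {e f : G.Edge} {p : List G.Edge} :
    G.EndsDistributing (e :: f :: p) ↔ G.EndsDistributing (f :: p) := by
  simp [EndsDistributing]

theorem startsCollecting_append {a b : List G.Edge} (ha : a ≠ []) :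
    G.StartsCollecting (a ++ b) ↔ G.StartsCollecting a := by
  obtain ⟨e, a, rfl⟩ := List.exists_cons_of_ne_nil ha
  simp

theorem endsDistributing_append {a b : List G.Edge} (hb : b ≠ []) :
    G.EndsDistributing (a ++ b) ↔ G.EndsDistributing b := by
  simp [EndsDistributing, List.getLast?_append_of_ne_nil _ hb]

theorem StartsCollecting.ne_nil {p : List G.Edge} (h : G.StartsCollecting p) : p ≠ [] := by
  rintro rfl; simp at h

theorem EndsDistributing.ne_nil {p : List G.Edge} (h : G.EndsDistributing p) : p ≠ [] := by
  rintro rfl; simp at h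

theorem isSymmetricPath_iff {p : List G.Edge} :
    G.IsSymmetricPath p ↔ G.Linked p ∧ G.StartsCollecting p ∧ G.EndsDistributing p :=
  ⟨fun h => ⟨h.1.2, h.2⟩, fun h => ⟨⟨h.2.1.ne_nil, h.1⟩, h.2⟩⟩

theorem IsSymmetricPath.ne_nil {p : List G.Edge} (h : G.IsSymmetricPath p) : p ≠ [] := h.1.1

theorem IsSymmetricPath.linked {p : List G.Edge} (h : G.IsSymmetricPath p) : G.Linked p := h.1.2

/-- A part of a path that starts with the start of a symmetric path and ends with the end of a
symmetric path is symmetric. -/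
theorem isSymmetricPath_of_append {p q r : List G.Edge} (h : G.Linked (p ++ q ++ r))
    (hp : G.StartsCollecting p) (hr : G.EndsDistributing r) : G.IsSymmetricPath (p ++ q ++ r) := by
  rw [isSymmetricPath_iff]
  refine ⟨h, ?_, (endsDistributing_append hr.ne_nil).2 hr⟩
  rw [List.append_assoc]
  exact (startsCollecting_append hp.ne_nil).2 hp

theorem IsDistributing.not_isCollecting {x : G.Vert} (h : G.IsDistributing x) :
    ¬ G.IsCollecting x := fun h' => by
  have := h'.1
  rw [h.1] at this
  exact lt_irrefl _ this

theorem IsCollecting.not_isDistributing {x : G.Vert} (h : G.IsCollecting x) :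
    ¬ G.IsDistributing x := fun h' => h'.not_isCollecting h

theorem IsCollecting.eq_of_src {e f : G.Edge} (h : G.IsCollecting (G.src e))
    (hf : G.src f = G.src e) : f = e := by
  obtain ⟨a, ha⟩ := Set.encard_eq_one.1 h.2
  have h1 : e ∈ {f | G.src f = G.src e} := rfl
  have h2 : f ∈ {f | G.src f = G.src e} := hf
  rw [ha, Set.mem_singleton_iff] at h1 h2
  exact h2.trans h1.symm

/-- Paths along good edges with the same first edge are comparable, if the later edges of the
shorter one are determined by their sources. -/
theorem Linked.prefix_of_length_le {good : G.Edge → Prop} {p q : List G.Edge} {e : G.Edge}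
    (hp : G.Linked (e :: p)) (hq : G.Linked (e :: q))
    (hdet : ∀ f ∈ p, ∀ g, good g → G.src g = G.src f → g = f) (hgood : ∀ g ∈ q, good g)
    (hlen : p.length ≤ q.length) : p <+: q := by
  induction p generalizing q e with
  | nil => exact List.nil_prefix
  | cons f p ih =>
    cases q with
    | nil => simp at hlen
    | cons g q =>
      obtain ⟨hf, hp⟩ := List.isChain_cons_cons.1 hp
      obtain ⟨hg, hq⟩ := List.isChain_cons_cons.1 hq
      obtain rfl := hdet f (by simp) g (hgood g (by simp)) (hg.symm.trans hf)
      rw [List.prefix_cons_inj]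
      exact ih hp hq (fun f' hf' => hdet f' (by simp [hf']))
        (fun g' hg' => hgood g' (by simp [hg'])) (by simpa using hlen)

/-- The graph with all edges reversed. -/
abbrev reverse (G : MultiDigraph.{u}) : MultiDigraph.{u} where
  Vert := G.Vert
  Edge := G.Edge
  src := G.tgt
  tgt := G.src

theorem isDistributing_reverse {x : G.Vert} : G.reverse.IsDistributing x ↔ G.IsCollecting x :=
  and_comm

theorem isCollecting_reverse {x : G.Vert} : G.reverse.IsCollecting x ↔ G.IsDistributing x :=
  and_comm

theorem linked_reverse {p : List G.Edge} : G.reverse.Linked p.reverse ↔ G.Linked p := by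
  rw [Linked, List.isChain_reverse]
  exact ⟨fun h => h.imp fun _ _ h => h.symm, fun h => h.imp fun _ _ h => h.symm⟩

theorem isPath_reverse {p : List G.Edge} : G.reverse.IsPath p.reverse ↔ G.IsPath p := by
  simp only [IsPath]
  exact and_congr (by simp) linked_reverse

theorem startsCollecting_reverse {p : List G.Edge} :
    G.reverse.StartsCollecting p.reverse ↔ G.EndsDistributing p := by
  simp only [StartsCollecting, EndsDistributing, List.head?_reverse, isCollecting_reverse]

theorem endsDistributing_reverse {p : List G.Edge} :
    G.reverse.EndsDistributing p.reverse ↔ G.StartsCollecting p := by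
  simp only [StartsCollecting, EndsDistributing, List.getLast?_reverse, isDistributing_reverse]

theorem isSymmetricPath_reverse {p : List G.Edge} :
    G.reverse.IsSymmetricPath p.reverse ↔ G.IsSymmetricPath p := by
  simp only [IsSymmetricPath, isPath_reverse, startsCollecting_reverse, endsDistributing_reverse]
  tauto

theorem isRightExtension_reverse {s p : List G.Edge} :
    G.reverse.IsRightExtension s.reverse p.reverse ↔ G.IsLeftExtension s p := by
  simp only [IsRightExtension, IsLeftExtension, isPath_reverse, endsDistributing_reverse,
    List.reverse_prefix, List.length_reverse]
  refine and_congr_right fun _ => ⟨fun h q h1 h2 h3 => ?_, fun h q h1 h2 h3 => ?_⟩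
  · have := h q.reverse (isPath_reverse.2 h1) (List.reverse_prefix.2 h2)
      (endsDistributing_reverse.2 h3)
    simpa using this
  · obtain ⟨q, rfl⟩ : ∃ q', q = List.reverse q' := ⟨q.reverse, by simp⟩
    have := h q (isPath_reverse.1 h1) (List.reverse_prefix.1 h2) (endsDistributing_reverse.1 h3)
    simpa using this

end MultiDigraph

/-! ### Front and back words of concatenated and reversed paths. -/

namespace WordGraph

open MultiDigraph

variable {α : Type w} {S : WordGraph.{u, w} α}

open Classical in
/-- The contribution of the later edges of a path to its front word. -/
noncomputable def innerFront (S : WordGraph.{u, w} α) (p : List S.Edge) : List α :=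
  (p.filter (fun f => S.IsDistributing (S.src f))).flatMap S.front

open Classical in
/-- The contribution of the earlier edges of a path to its back word. -/
noncomputable def innerBack (S : WordGraph.{u, w} α) (p : List S.Edge) : List α :=
  (p.filter (fun f => S.IsCollecting (S.tgt f))).flatMap S.back

theorem frontWord_cons (e : S.Edge) (p : List S.Edge) :
    S.frontWord (e :: p) = S.front e ++ S.innerFront p := rfl

theorem backWord_concat (p : List S.Edge) (e : S.Edge) :
    S.backWord (p ++ [e]) = S.innerBack p ++ S.back e := by
  simp [backWord, innerBack]

@[simp] theorem innerFront_nil : S.innerFront [] = [] := rfl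

@[simp] theorem innerBack_nil : S.innerBack [] = [] := rfl

@[simp] theorem innerFront_append (p q : List S.Edge) :
    S.innerFront (p ++ q) = S.innerFront p ++ S.innerFront q := by
  simp [innerFront]

@[simp] theorem innerBack_append (p q : List S.Edge) :
    S.innerBack (p ++ q) = S.innerBack p ++ S.innerBack q := by
  simp [innerBack]

theorem innerFront_cons_of_isDistributing {e : S.Edge} (h : S.IsDistributing (S.src e))
    (p : List S.Edge) : S.innerFront (e :: p) = S.front e ++ S.innerFront p := by
  simp [innerFront, h]

theorem innerFront_cons_of_not {e : S.Edge} (h : ¬ S.IsDistributing (S.src e))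
    (p : List S.Edge) : S.innerFront (e :: p) = S.innerFront p := by
  simp [innerFront, h]

theorem innerBack_concat_of_isCollecting {e : S.Edge} (h : S.IsCollecting (S.tgt e))
    (p : List S.Edge) : S.innerBack (p ++ [e]) = S.innerBack p ++ S.back e := by
  simp [innerBack, h]

theorem innerBack_concat_of_not {e : S.Edge} (h : ¬ S.IsCollecting (S.tgt e))
    (p : List S.Edge) : S.innerBack (p ++ [e]) = S.innerBack p := by
  simp [innerBack, h]

theorem innerBack_singleton_of_not {e : S.Edge} (h : ¬ S.IsCollecting (S.tgt e)) :
    S.innerBack [e] = [] := by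
  simp [innerBack, h]

theorem innerFront_singleton_of_not {e : S.Edge} (h : ¬ S.IsDistributing (S.src e)) :
    S.innerFront [e] = [] := by
  simp [innerFront, h]

theorem frontWord_append {p : List S.Edge} (hp : p ≠ []) (q : List S.Edge) :
    S.frontWord (p ++ q) = S.frontWord p ++ S.innerFront q := by
  obtain ⟨e, p, rfl⟩ := List.exists_cons_of_ne_nil hp
  simp [frontWord_cons]

theorem backWord_append (p : List S.Edge) {q : List S.Edge} (hq : q ≠ []) :
    S.backWord (p ++ q) = S.innerBack p ++ S.backWord q := by
  rcases List.eq_nil_or_concat' q with rfl | ⟨q, e, rfl⟩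
  · exact absurd rfl hq
  · rw [← List.append_assoc, backWord_concat, backWord_concat, innerBack_append, List.append_assoc]

theorem frontWord_eq_innerFront {e : S.Edge} (h : S.IsDistributing (S.src e)) (p : List S.Edge) :
    S.frontWord (e :: p) = S.innerFront (e :: p) := by
  rw [frontWord_cons, innerFront_cons_of_isDistributing h]

theorem backWord_eq_innerBack {e : S.Edge} (h : S.IsCollecting (S.tgt e)) (p : List S.Edge) :
    S.backWord (p ++ [e]) = S.innerBack (p ++ [e]) := by
  rw [backWord_concat, innerBack_concat_of_isCollecting h]

/-- The front word of a symmetric path in terms of that of a symmetric part. -/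
theorem frontWord_append_append
    (hword : ∀ p, S.IsSymmetricPath p → S.frontWord p = S.backWord p) {a p b : List S.Edge}
    (hP : S.IsSymmetricPath (a ++ p ++ b)) (hp : S.IsSymmetricPath p) :
    S.frontWord (a ++ p ++ b) = S.innerBack a ++ S.frontWord p ++ S.innerFront b := by
  have hap : S.IsSymmetricPath (a ++ p) := by
    rw [isSymmetricPath_iff]
    refine ⟨hP.linked.left, ?_, (endsDistributing_append hp.ne_nil).2 hp.2.2⟩
    have := hP.2.1
    rwa [startsCollecting_append (by simp [hp.ne_nil])] at this
  -- Front words split off a right part and back words a left part; property 3 for `a ++ p` and for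
  -- `p` allows switching between the two.
  rw [frontWord_append hap.ne_nil, hword _ hap, backWord_append _ hp.ne_nil, hword _ hp]

/-- The graph with all edges and all words reversed. -/
abbrev reverse (S : WordGraph.{u, w} α) : WordGraph.{u, w} α where
  toMultiDigraph := S.toMultiDigraph.reverse
  front e := (S.back e).reverse
  back e := (S.front e).reverse

theorem innerFront_reverse (p : List S.Edge) :
    S.reverse.innerFront p.reverse = (S.innerBack p).reverse := by
  induction p using List.reverseRecOn with
  | nil => rfl
  | append_singleton p e ih =>
    rw [List.reverse_append, List.reverse_singleton, List.singleton_append]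
    by_cases h : S.IsCollecting (S.tgt e)
    · rw [innerBack_concat_of_isCollecting h, List.reverse_append, ← ih]
      exact innerFront_cons_of_isDistributing (S := S.reverse) (isDistributing_reverse.2 h) _
    · rw [innerBack_concat_of_not h, ← ih]
      exact innerFront_cons_of_not (S := S.reverse) (fun h' => h (isDistributing_reverse.1 h')) _

theorem frontWord_reverse (p : List S.Edge) :
    S.reverse.frontWord p.reverse = (S.backWord p).reverse := by
  rcases List.eq_nil_or_concat' p with rfl | ⟨q, e, rfl⟩
  · rfl
  · rw [backWord_concat, List.reverse_append, List.reverse_append, List.reverse_singleton,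
      List.singleton_append, ← innerFront_reverse]
    rfl

theorem backWord_reverse (p : List S.Edge) :
    S.reverse.backWord p.reverse = (S.frontWord p).reverse := by
  have h := frontWord_reverse (S := S.reverse) p.reverse
  have h₁ : S.reverse.reverse = S := by simp [reverse, MultiDigraph.reverse]
  have h₂ : S.reverse.reverse.frontWord p = S.frontWord p := by
    congr 1
  rw [List.reverse_reverse] at h
  rw [← List.reverse_reverse (S.reverse.backWord p.reverse), ← h, h₂]

end WordGraph

end RauzyEvolution

/-! ### Subwords of a one-sided infinite word. -/

namespace RauzyEvolution

section Words

variable {α : Type w} {W : ℕ → α}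

/-- The block of `n` letters of `W` that starts at position `i`. -/
def block (W : ℕ → α) (i n : ℕ) : List α := (List.range n).map fun j => W (i + j)

@[simp] theorem length_block (i n : ℕ) : (block W i n).length = n := by simp [block]

theorem getElem_block {i n j : ℕ} (h : j < (block W i n).length) :
    (block W i n)[j] = W (i + j) := by simp [block]

theorem occursAt_iff {u : List α} {i : ℕ} : OccursAt u W i ↔ u = block W i u.length := by
  constructor
  · intro h
    refine List.ext_getElem (by simp) fun j h1 h2 => ?_
    rw [h j h1, getElem_block]
  · intro h j hj
    have : ∀ (v : List α) (hv : u = v), u[j] = v[j]'(hv ▸ hj) := by rintro v rfl; rfl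
    rw [this _ h, getElem_block]

theorem occursAt_block (i n : ℕ) : OccursAt (block W i n) W i := by
  simp [occursAt_iff]

theorem isSubword_block (i n : ℕ) : IsSubword (block W i n) W := ⟨i, occursAt_block i n⟩

theorem block_add (i m n : ℕ) : block W i (m + n) = block W i m ++ block W (i + m) n := by
  simp [block, List.range_add, Function.comp_def, add_assoc]

theorem OccursAt.of_append {a u b : List α} {i : ℕ} (h : OccursAt (a ++ u ++ b) W i) :
    OccursAt u W (i + a.length) := by
  rw [occursAt_iff] at h ⊢
  rw [List.length_append, List.length_append, block_add, block_add] at h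
  have h1 := List.append_inj h (by simp)
  exact (List.append_inj h1.1 (by simp)).2

theorem IsSubword.of_infix {u t : List α} (h : IsSubword t W) (hu : u <:+: t) :
    IsSubword u W := by
  obtain ⟨a, b, rfl⟩ := hu
  obtain ⟨i, hi⟩ := h
  exact ⟨_, hi.of_append⟩

theorem IsRecurrent.exists_occursAt (hW : IsRecurrent W) {u : List α} (hu : IsSubword u W)
    (n : ℕ) : ∃ i, n < i ∧ OccursAt u W i := by
  obtain ⟨i, hi, hn⟩ := (hW u hu).exists_gt n
  exact ⟨i, hn, hi⟩

/-- A recurrent word that is eventually periodic is periodic. -/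
theorem IsRecurrent.isPeriodic (hW : IsRecurrent W) {N d : ℕ} (hd : 0 < d)
    (h : ∀ n, W (N + n) = W (N + n + d)) : IsPeriodic W := by
  refine ⟨d, hd, fun n => ?_⟩
  -- The prefix of length n + d + 1 contains both positions n and n + d, and it occurs again beyond
  -- N, where the period is known.
  obtain ⟨k, hk, hocc⟩ := hW.exists_occursAt (isSubword_block (W := W) 0 (n + d + 1)) N
  have h1 := hocc n (by simp)
  have h2 := hocc (n + d) (by simp)
  rw [getElem_block, zero_add] at h1 h2
  obtain ⟨c, rfl⟩ := Nat.exists_eq_add_of_lt hk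
  rw [h1, h2]
  have := h (c + 1 + n)
  rw [show N + c + 1 + n = N + (c + 1 + n) by ring, this,
    show N + (c + 1 + n) + d = N + c + 1 + (n + d) by ring]

theorem finite_occurrences {β : Type*} (u t : List β) :
    {d : List β × List β | d.1 ++ u ++ d.2 = t}.Finite := by
  refine ((List.finite_toSet t.inits).prod (List.finite_toSet t.tails)).subset ?_
  rintro ⟨a, b⟩ rfl
  simp only [Set.mem_prod, Set.mem_ofPred_eq, List.mem_inits, List.mem_tails]
  exact ⟨⟨u ++ b, by simp⟩, List.suffix_append _ _⟩

end Words

/-! ### Synchronization of word occurrences with path occurrences. -/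

namespace WordGraph

open MultiDigraph

variable {α : Type w} {S : WordGraph.{u, w} α}

/-- The last edge of `a` enters the collecting vertex where `p` starts, so its nonempty back word is
counted. Hence moving a symmetric path along a longer path strictly increases its position in the
word. -/
theorem innerBack_ne_nil (hback : ∀ e, S.IsCollecting (S.tgt e) → S.back e ≠ [])
    {a p : List S.Edge} (h : S.Linked (a ++ p)) (hp : S.StartsCollecting p) (ha : a ≠ []) :
    S.innerBack a ≠ [] := by
  rcases List.eq_nil_or_concat' a with rfl | ⟨a, e, rfl⟩
  · exact absurd rfl ha
  · obtain ⟨f, p, rfl⟩ := List.exists_cons_of_ne_nil hp.ne_nil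
    have h1 : S.tgt e = S.src f := Linked.tgt_eq_src (a := a) (b := p) (by simpa using h)
    have h2 : S.IsCollecting (S.tgt e) := by rw [h1]; simpa using hp
    rw [innerBack_concat_of_isCollecting h2]
    simp [hback e h2]

/-- The synchronization property: every occurrence of the front word of a symmetric path in that
of another one comes from an occurrence of the path. -/
def IsSynchronized (S : WordGraph.{u, w} α) : Prop :=
  ∀ p q, S.IsSymmetricPath p → S.IsSymmetricPath q → ∀ s t,
    S.frontWord q = s ++ S.frontWord p ++ t → ∃ a b, q = a ++ p ++ b ∧ S.innerBack a = s

/-- An occurrence (a, b) of p in q yields the occurrence of F(p) in F(q) with left part `S.innerBack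
a`. This map is injective because the left part grows strictly with a. By property 4 there are at
least as many path occurrences as word occurrences, and the latter are finitely many, so the map is
onto. -/
theorem isSynchronized_of_path_occurs
    (hback : ∀ e, S.IsCollecting (S.tgt e) → S.back e ≠ [])
    (hword : ∀ p, S.IsSymmetricPath p → S.frontWord p = S.backWord p)
    (hocc : ∀ p q, S.IsSymmetricPath p → S.IsSymmetricPath q → ∀ k : ℕ,
      OccursAtLeast k (S.frontWord p) (S.frontWord q) → OccursAtLeast k p q) :
    S.IsSynchronized := by
  intro p q hp hq s t hst
  set A := {d : List S.Edge × List S.Edge | d.1 ++ p ++ d.2 = q}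
  set B := {d : List α × List α | d.1 ++ S.frontWord p ++ d.2 = S.frontWord q}
  have hB : B.Finite := finite_occurrences _ _
  let φ : List S.Edge × List S.Edge → List α × List α :=
    fun d => (S.innerBack d.1, S.innerFront d.2)
  -- Property 4 is applied with k equal to the exact number of word occurrences.
  have hle : B.encard ≤ A.encard := by
    rw [← hB.cast_ncard_eq]
    refine hocc p q hp hq B.ncard ?_
    rw [OccursAtLeast, hB.cast_ncard_eq]
  have hmaps : φ '' A ⊆ B := by
    rintro _ ⟨⟨a, b⟩, hab, rfl⟩
    change a ++ p ++ b = q at hab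
    change S.innerBack a ++ S.frontWord p ++ S.innerFront b = S.frontWord q
    rw [← frontWord_append_append hword (hab ▸ hq) hp, hab]
  have key : ∀ a b a' b', a ++ p ++ b = q → a' ++ p ++ b' = q → S.innerBack a = S.innerBack a' →
      a.length ≤ a'.length → a = a' := by
    intro a b a' b' h h' haa hlen
    have hpre : a <+: a' := List.prefix_of_prefix_length_le (l₃ := q)
      ⟨p ++ b, by rw [← h]; simp⟩ ⟨p ++ b', by rw [← h']; simp⟩ hlen
    obtain ⟨c, rfl⟩ := hpre
    rw [innerBack_append, List.self_eq_append_right] at haa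
    by_contra hc
    refine innerBack_ne_nil hback (a := c) (p := p) ?_ hp.2.1 (fun h0 => hc (by simp [h0])) haa
    have := hq.linked
    rw [← h'] at this
    have := this.left
    rw [List.append_assoc] at this
    exact this.right
  have hinj : Set.InjOn φ A := by
    rintro ⟨a, b⟩ hab ⟨a', b'⟩ hab' heq
    have h1 : S.innerBack a = S.innerBack a' := congrArg Prod.fst heq
    have haa : a = a' := by
      rcases le_total a.length a'.length with h | h
      · exact key a b a' b' hab hab' h1 h
      · exact (key a' b' a b hab' hab h1.symm h).symm
    subst haa
    have : a ++ p ++ b = a ++ p ++ b' := Eq.trans hab (Eq.symm hab')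
    rw [List.append_cancel_left this]
  have himg : φ '' A = B :=
    (hB.subset hmaps).eq_of_subset_of_encard_le hmaps (by rwa [hinj.encard_image])
  have hmem : (s, t) ∈ B := hst.symm
  rw [← himg] at hmem
  obtain ⟨⟨a, b⟩, hab, heq⟩ := hmem
  exact ⟨a, b, Eq.symm hab, congrArg Prod.fst heq⟩

theorem IsSynchronized.path_occurs (hS : S.IsSynchronized)
    {p q : List S.Edge} (hp : S.IsSymmetricPath p) (hq : S.IsSymmetricPath q) (k : ℕ)
    (h : OccursAtLeast k (S.frontWord p) (S.frontWord q)) : OccursAtLeast k p q := by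
  refine le_trans h ?_
  set A := {d : List S.Edge × List S.Edge | d.1 ++ p ++ d.2 = q}
  set B := {d : List α × List α | d.1 ++ S.frontWord p ++ d.2 = S.frontWord q}
  -- The right part of a word occurrence is determined by the length of the left one; recovering it
  -- with `drop` avoids property 3.
  let φ : List S.Edge × List S.Edge → List α × List α :=
    fun d => (S.innerBack d.1,
      (S.frontWord q).drop ((S.innerBack d.1).length + (S.frontWord p).length))
  refine le_trans (Set.encard_le_encard ?_) (Set.encard_image_le φ A)
  rintro ⟨s, t⟩ hst
  change s ++ S.frontWord p ++ t = S.frontWord q at hst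
  obtain ⟨a, b, hab, rfl⟩ := hS p q hp hq s t hst.symm
  refine ⟨(a, b), hab.symm, ?_⟩
  simp only [φ, ← hst, Prod.mk.injEq, true_and]
  rw [← List.length_append, List.drop_left]

theorem length_innerBack_le (p : List S.Edge) :
    (S.innerBack p).length ≤ (S.backWord p).length := by
  rcases List.eq_nil_or_concat' p with rfl | ⟨p, e, rfl⟩
  · simp
  · by_cases h : S.IsCollecting (S.tgt e)
    · rw [backWord_eq_innerBack h]
    · rw [innerBack_concat_of_not h, backWord_concat]
      simp

/-- A block of `W` that starts with the front word of a symmetric path and ends with that of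
another one is the front word of a symmetric path. -/
theorem exists_path_of_occursAt {W : ℕ → α} (hsync : S.IsSynchronized)
    (hword : ∀ p, S.IsSymmetricPath p → S.frontWord p = S.backWord p)
    (hcov : ∀ u, IsSubword u W → ∃ p, S.IsSymmetricPath p ∧ u <:+: S.frontWord p)
    {q₁ q₂ : List S.Edge} (h₁ : S.IsSymmetricPath q₁) (h₂ : S.IsSymmetricPath q₂) {i j : ℕ}
    (hi : OccursAt (S.frontWord q₁) W i) (hj : OccursAt (S.frontWord q₂) W j)
    (hij : i + (S.frontWord q₁).length < j) :
    ∃ r, S.IsSymmetricPath (q₁ ++ r ++ q₂) ∧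
      S.frontWord (q₁ ++ r ++ q₂) = block W i (j + (S.frontWord q₂).length - i) := by
  set n₁ := (S.frontWord q₁).length
  set n₂ := (S.frontWord q₂).length
  obtain ⟨d, rfl⟩ := Nat.exists_eq_add_of_lt hij
  have hU : block W i (i + n₁ + d + 1 + n₂ - i) =
      S.frontWord q₁ ++ block W (i + n₁) (d + 1) ++ S.frontWord q₂ := by
    rw [show i + n₁ + d + 1 + n₂ - i = n₁ + (d + 1) + n₂ by omega, block_add, block_add,
      ← occursAt_iff.1 hi, show i + (n₁ + (d + 1)) = i + n₁ + d + 1 by ring,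
      ← occursAt_iff.1 hj]
  obtain ⟨P, hP, s, t, hst⟩ := hcov _ (isSubword_block i (i + n₁ + d + 1 + n₂ - i))
  rw [hU] at hst
  obtain ⟨a₁, b₁, hab₁, ha₁⟩ := hsync q₁ P h₁ hP s
    (block W (i + n₁) (d + 1) ++ S.frontWord q₂ ++ t) (by rw [← hst]; simp)
  obtain ⟨a₂, b₂, hab₂, ha₂⟩ := hsync q₂ P h₂ hP
    (s ++ S.frontWord q₁ ++ block W (i + n₁) (d + 1)) t (by rw [← hst]; simp)
  -- The inner back word of `q₁` is no longer than its front word, so the gap between the two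
  -- occurrences in `W` forces `q₁` to end before `q₂` begins.
  have hlen : (S.innerBack (a₁ ++ q₁)).length < (S.innerBack a₂).length := by
    have := length_innerBack_le q₁
    rw [← hword _ h₁] at this
    rw [innerBack_append, ha₁, ha₂]
    simp only [List.length_append, length_block]
    omega
  have hpre : a₁ ++ q₁ <+: a₂ := by
    rcases List.prefix_or_prefix_of_prefix (l₁ := a₁ ++ q₁) (l₂ := a₂) (l₃ := P)
      ⟨b₁, by rw [hab₁]⟩ ⟨q₂ ++ b₂, by rw [hab₂]; simp⟩ with h | ⟨c, hc⟩
    · exact h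
    · rw [← hc, innerBack_append, List.length_append] at hlen
      omega
  obtain ⟨r, rfl⟩ := hpre
  have hPeq : P = a₁ ++ (q₁ ++ r ++ q₂) ++ b₂ := by rw [hab₂]; simp
  have hsym : S.IsSymmetricPath (q₁ ++ r ++ q₂) := by
    refine isSymmetricPath_of_append ?_ h₁.2.1 h₂.2.2
    have := hP.linked
    rw [hPeq] at this
    exact this.left.right
  refine ⟨r, hsym, ?_⟩
  have h1 := frontWord_append_append hword (hPeq ▸ hP) hsym
  have h2 := frontWord_append_append hword (hab₂ ▸ hP) h₂
  rw [← hab₂, ha₂, ← hst] at h2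
  have ht : S.innerFront b₂ = t := by
    simpa using h2.symm
  rw [← hPeq, ← hst, ha₁, ht] at h1
  rw [hU]
  exact (List.append_cancel_left (List.append_cancel_right h1)).symm

end WordGraph

end RauzyEvolution

/-! ### The graph S': vertex types and property 2. -/

namespace RauzyEvolution

namespace WordGraph

open MultiDigraph

variable {α : Type w} {S : WordGraph.{u, w} α} {v : S.Edge} {hv : S.IsSupportEdge v}

namespace split

/-- The edge of `S'` given by an edge of `S` other than `v`. -/
def old (hv : S.IsSupportEdge v) (e : S.Edge) (he : e ≠ v) : (S.split v hv).Edge := .inl ⟨e, he⟩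

/-- The edge `v_{ij}` of `S'`. -/
def new (hv : S.IsSupportEdge v) (x : S.InEdge v) (y : S.OutEdge v) : (S.split v hv).Edge :=
  .inr (x, y)

/-- A vertex of `S'` that comes from `S`. -/
def oldVert (hv : S.IsSupportEdge v) (x : S.Vert) (hx : x ≠ S.src v ∧ x ≠ S.tgt v) :
    (S.split v hv).Vert := .inl ⟨x, hx⟩

/-- The vertex `A_i` of `S'`. -/
def inVert (hv : S.IsSupportEdge v) (x : S.InEdge v) : (S.split v hv).Vert := .inr (.inl x)

/-- The vertex `B_j` of `S'`. -/
def outVert (hv : S.IsSupportEdge v) (y : S.OutEdge v) : (S.split v hv).Vert := .inr (.inr y)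

theorem edge_cases {motive : (S.split v hv).Edge → Prop}
    (h_old : ∀ e he, motive (old hv e he)) (h_new : ∀ x y, motive (new hv x y)) (e) : motive e := by
  rcases e with ⟨e, he⟩ | ⟨x, y⟩
  · exact h_old e he
  · exact h_new x y

theorem vert_cases {motive : (S.split v hv).Vert → Prop}
    (h_old : ∀ x hx, motive (oldVert hv x hx)) (h_in : ∀ x, motive (inVert hv x))
    (h_out : ∀ y, motive (outVert hv y)) (x) : motive x := by
  rcases x with ⟨x, hx⟩ | x | y
  · exact h_old x hx
  · exact h_in x
  · exact h_out y

theorem src_ne_tgt (hv : S.IsSupportEdge v) : S.src v ≠ S.tgt v := fun h =>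
  hv.1.not_isDistributing (h ▸ hv.2)

theorem inEdge_ne (hv : S.IsSupportEdge v) (x : S.InEdge v) : x.1 ≠ v := fun h =>
  src_ne_tgt hv (by rw [← x.2, h])

theorem outEdge_ne (hv : S.IsSupportEdge v) (y : S.OutEdge v) : y.1 ≠ v := fun h =>
  src_ne_tgt hv (by rw [← y.2, h])

theorem src_old_of_eq {e : S.Edge} {he : e ≠ v} (h : S.src e = S.tgt v) :
    (S.split v hv).src (old hv e he) = outVert hv ⟨e, h⟩ := dif_pos h

theorem src_old_of_ne {e : S.Edge} {he : e ≠ v} (h : S.src e ≠ S.tgt v) :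
    (S.split v hv).src (old hv e he) = oldVert hv (S.src e) ⟨hv.src_ne he, h⟩ := dif_neg h

theorem tgt_old_of_eq {e : S.Edge} {he : e ≠ v} (h : S.tgt e = S.src v) :
    (S.split v hv).tgt (old hv e he) = inVert hv ⟨e, h⟩ := dif_pos h

theorem tgt_old_of_ne {e : S.Edge} {he : e ≠ v} (h : S.tgt e ≠ S.src v) :
    (S.split v hv).tgt (old hv e he) = oldVert hv (S.tgt e) ⟨h, hv.tgt_ne he⟩ := dif_neg h

@[simp] theorem src_new (x : S.InEdge v) (y : S.OutEdge v) :
    (S.split v hv).src (new hv x y) = inVert hv x := rfl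

@[simp] theorem tgt_new (x : S.InEdge v) (y : S.OutEdge v) :
    (S.split v hv).tgt (new hv x y) = outVert hv y := rfl

theorem front_old_of_eq {e : S.Edge} {he : e ≠ v} (h : S.src e = S.tgt v) :
    (S.split v hv).front (old hv e he) = S.front v ++ S.front e := if_pos h

theorem front_old_of_ne {e : S.Edge} {he : e ≠ v} (h : S.src e ≠ S.tgt v) :
    (S.split v hv).front (old hv e he) = S.front e := if_neg h

theorem back_old_of_eq {e : S.Edge} {he : e ≠ v} (h : S.tgt e = S.src v) :
    (S.split v hv).back (old hv e he) = S.back e ++ S.front v := if_pos h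

theorem back_old_of_ne {e : S.Edge} {he : e ≠ v} (h : S.tgt e ≠ S.src v) :
    (S.split v hv).back (old hv e he) = S.back e := if_neg h

@[simp] theorem front_new (x : S.InEdge v) (y : S.OutEdge v) :
    (S.split v hv).front (new hv x y) = S.front y.1 := rfl

@[simp] theorem back_new (x : S.InEdge v) (y : S.OutEdge v) :
    (S.split v hv).back (new hv x y) = S.back x.1 := rfl

@[simp] theorem isGood_old {W : ℕ → α} {e : S.Edge} {he : e ≠ v} :
    S.IsGood W v hv (old hv e he) := trivial

theorem isGood_new {W : ℕ → α} {x : S.InEdge v} {y : S.OutEdge v} :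
    S.IsGood W v hv (new hv x y) ↔
      IsSubword (S.back x.1 ++ S.front v ++ S.front y.1) W := Iff.rfl

theorem oldVert_inj {x y : S.Vert} {hx hy} : oldVert hv x hx = oldVert hv y hy ↔ x = y :=
  ⟨fun h => congrArg Subtype.val (Sum.inl.inj h), by rintro rfl; rfl⟩

theorem inVert_inj {x y : S.InEdge v} : inVert hv x = inVert hv y ↔ x = y :=
  ⟨fun h => Sum.inl.inj (Sum.inr.inj h), by rintro rfl; rfl⟩

theorem outVert_inj {x y : S.OutEdge v} : outVert hv x = outVert hv y ↔ x = y :=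
  ⟨fun h => Sum.inr.inj (Sum.inr.inj h), by rintro rfl; rfl⟩

theorem new_inj {x x' : S.InEdge v} {y y' : S.OutEdge v} :
    new hv x y = new hv x' y' ↔ x = x' ∧ y = y' :=
  ⟨fun h => Prod.mk.inj (Sum.inr.inj h), by rintro ⟨rfl, rfl⟩; rfl⟩

@[simp] theorem oldVert_ne_inVert {x hx} {y} : oldVert hv x hx ≠ inVert hv y := by rintro ⟨⟩

@[simp] theorem inVert_ne_oldVert {x hx} {y} : inVert hv y ≠ oldVert hv x hx := by rintro ⟨⟩

@[simp] theorem oldVert_ne_outVert {x hx} {y} : oldVert hv x hx ≠ outVert hv y := by rintro ⟨⟩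

@[simp] theorem outVert_ne_oldVert {x hx} {y} : outVert hv y ≠ oldVert hv x hx := by rintro ⟨⟩

@[simp] theorem inVert_ne_outVert {x} {y} : inVert hv x ≠ outVert hv y := by rintro ⟨⟩

@[simp] theorem outVert_ne_inVert {x} {y} : outVert hv y ≠ inVert hv x := by rintro ⟨⟩

/-- The edge of `S` below an edge of `S'`. -/
def base : (S.split v hv).Edge → S.Edge
  | .inl e => e.1
  | .inr _ => v

@[simp] theorem base_old {e : S.Edge} {he : e ≠ v} : base (old hv e he) = e := rfl

@[simp] theorem base_new (x : S.InEdge v) (y : S.OutEdge v) : base (new hv x y) = v := rfl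

theorem tgt_old_eq_src_old {e f : S.Edge} {he : e ≠ v} {hf : f ≠ v} :
    (S.split v hv).tgt (old hv e he) = (S.split v hv).src (old hv f hf) ↔ S.tgt e = S.src f := by
  by_cases h1 : S.tgt e = S.src v
  · rw [tgt_old_of_eq h1, h1]
    have := (hv.src_ne hf).symm
    by_cases h2 : S.src f = S.tgt v
    · simp [src_old_of_eq h2, this]
    · simp [src_old_of_ne h2, this]
  · rw [tgt_old_of_ne h1]
    by_cases h2 : S.src f = S.tgt v
    · simp [src_old_of_eq h2, h2, hv.tgt_ne he]
    · simp [src_old_of_ne h2, oldVert_inj]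

theorem tgt_old_eq_src_new {e : S.Edge} {he : e ≠ v} {x : S.InEdge v} {y : S.OutEdge v} :
    (S.split v hv).tgt (old hv e he) = (S.split v hv).src (new hv x y) ↔ e = x.1 := by
  by_cases h1 : S.tgt e = S.src v
  · rw [tgt_old_of_eq h1, src_new, inVert_inj, Subtype.ext_iff]
  · rw [tgt_old_of_ne h1, src_new]
    simp only [oldVert_ne_inVert, false_iff]
    rintro rfl
    exact h1 x.2

theorem tgt_new_eq_src_old {e : S.Edge} {he : e ≠ v} {x : S.InEdge v} {y : S.OutEdge v} :
    (S.split v hv).tgt (new hv x y) = (S.split v hv).src (old hv e he) ↔ e = y.1 := by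
  by_cases h1 : S.src e = S.tgt v
  · rw [src_old_of_eq h1, tgt_new, outVert_inj, Subtype.ext_iff]
    exact eq_comm
  · rw [src_old_of_ne h1, tgt_new]
    simp only [outVert_ne_oldVert, false_iff]
    rintro rfl
    exact h1 y.2

theorem tgt_new_ne_src_new {x x' : S.InEdge v} {y y' : S.OutEdge v} :
    (S.split v hv).tgt (new hv x y) ≠ (S.split v hv).src (new hv x' y') := by
  simp

theorem tgt_base_eq_src_base {e f : (S.split v hv).Edge}
    (h : (S.split v hv).tgt e = (S.split v hv).src f) : S.tgt (base e) = S.src (base f) := by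
  induction e using edge_cases <;> induction f using edge_cases
  · exact tgt_old_eq_src_old.1 h
  · rename_i x y
    rw [tgt_old_eq_src_new] at h
    simp [h, x.2]
  · rename_i x y _ _
    rw [tgt_new_eq_src_old] at h
    simp [h, y.2]
  · exact absurd h tgt_new_ne_src_new

theorem linked_map_base {p : List (S.split v hv).Edge} (h : (S.split v hv).Linked p) :
    S.Linked (p.map base) := by
  rw [Linked, List.isChain_map]
  exact h.imp fun _ _ => tgt_base_eq_src_base

/-- Splitting exchanges the types: the beginning of v is collecting, but A_i is entered by x_i
alone, and it is left by one edge v_ij for each of the several y_j. -/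
theorem isDistributing_inVert (x : S.InEdge v) : (S.split v hv).IsDistributing (inVert hv x) := by
  constructor
  · rw [Set.encard_eq_one]
    refine ⟨old hv x.1 (inEdge_ne hv x), ?_⟩
    ext e
    simp only [Set.mem_ofPred_eq, Set.mem_singleton_iff]
    constructor
    · intro h
      induction e using edge_cases with
      | h_old e he =>
        by_cases h1 : S.tgt e = S.src v
        · rw [tgt_old_of_eq h1, inVert_inj] at h
          subst h
          rfl
        · simp [tgt_old_of_ne h1] at h
      | h_new x' y => simp at h
    · rintro rfl
      exact tgt_old_of_eq x.2
  · obtain ⟨y, z, hy, hz, hne⟩ := Set.one_lt_encard_iff.1 hv.2.2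
    refine Set.one_lt_encard_iff.2 ⟨new hv x ⟨y, hy⟩, new hv x ⟨z, hz⟩, rfl, rfl, ?_⟩
    simpa [new_inj] using hne

theorem isCollecting_outVert (y : S.OutEdge v) : (S.split v hv).IsCollecting (outVert hv y) := by
  refine And.symm ⟨?_, ?_⟩
  · rw [Set.encard_eq_one]
    refine ⟨old hv y.1 (outEdge_ne hv y), ?_⟩
    ext e
    simp only [Set.mem_ofPred_eq, Set.mem_singleton_iff]
    constructor
    · intro h
      induction e using edge_cases with
      | h_old e he =>
        by_cases h1 : S.src e = S.tgt v
        · rw [src_old_of_eq h1, outVert_inj] at h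
          subst h
          rfl
        · simp [src_old_of_ne h1] at h
      | h_new x' y => simp at h
    · rintro rfl
      exact src_old_of_eq y.2
  · obtain ⟨x, z, hx, hz, hne⟩ := Set.one_lt_encard_iff.1 hv.1.1
    refine Set.one_lt_encard_iff.2 ⟨new hv ⟨x, hx⟩ y, new hv ⟨z, hz⟩ y, rfl, rfl, ?_⟩
    simpa [new_inj] using hne

/-- The edges v_ij start in the vertices A_i, so the edges leaving an old vertex are old and `base`
is injective on them. Degrees at old vertices, and with them the types, therefore do not change. -/
theorem encard_src_oldVert {x : S.Vert} {hx} :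
    {e | (S.split v hv).src e = oldVert hv x hx}.encard = {e | S.src e = x}.encard := by
  have hinj : Set.InjOn base {e | (S.split v hv).src e = oldVert hv x hx} := by
    intro e he f hf hef
    induction e using edge_cases <;> induction f using edge_cases
    · simp only [base_old] at hef
      subst hef
      rfl
    · simp at hf
    · simp at he
    · simp at he
  rw [← hinj.encard_image]
  congr 1
  ext e
  constructor
  · rintro ⟨e, he, rfl⟩
    induction e using edge_cases with
    | h_old e h =>
      simp only [Set.mem_ofPred_eq] at he
      by_cases h1 : S.src e = S.tgt v
      · simp [src_old_of_eq h1] at he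
      · rw [src_old_of_ne h1, oldVert_inj] at he
        exact he
    | h_new x' y => simp at he
  · rintro rfl
    have h1 : e ≠ v := by
      rintro rfl
      exact hx.1 rfl
    exact ⟨old hv e h1, src_old_of_ne hx.2, rfl⟩

theorem encard_tgt_oldVert {x : S.Vert} {hx} :
    {e | (S.split v hv).tgt e = oldVert hv x hx}.encard = {e | S.tgt e = x}.encard := by
  have hinj : Set.InjOn base {e | (S.split v hv).tgt e = oldVert hv x hx} := by
    intro e he f hf hef
    induction e using edge_cases <;> induction f using edge_cases
    · simp only [base_old] at hef
      subst hef
      rfl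
    · simp at hf
    · simp at he
    · simp at he
  rw [← hinj.encard_image]
  congr 1
  ext e
  constructor
  · rintro ⟨e, he, rfl⟩
    induction e using edge_cases with
    | h_old e h =>
      simp only [Set.mem_ofPred_eq] at he
      by_cases h1 : S.tgt e = S.src v
      · simp [tgt_old_of_eq h1] at he
      · rw [tgt_old_of_ne h1, oldVert_inj] at he
        exact he
    | h_new x' y => simp at he
  · rintro rfl
    have h1 : e ≠ v := by
      rintro rfl
      exact hx.2 rfl
    exact ⟨old hv e h1, tgt_old_of_ne hx.1, rfl⟩

theorem isDistributing_oldVert {x : S.Vert} {hx} :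
    (S.split v hv).IsDistributing (oldVert hv x hx) ↔ S.IsDistributing x := by
  rw [IsDistributing, IsDistributing, encard_src_oldVert, encard_tgt_oldVert]

theorem isCollecting_oldVert {x : S.Vert} {hx} :
    (S.split v hv).IsCollecting (oldVert hv x hx) ↔ S.IsCollecting x := by
  rw [IsCollecting, IsCollecting, encard_src_oldVert, encard_tgt_oldVert]

theorem vert_type (h : ∀ x, S.IsDistributing x ∨ S.IsCollecting x) (x : (S.split v hv).Vert) :
    (S.split v hv).IsDistributing x ∨ (S.split v hv).IsCollecting x := by
  induction x using vert_cases with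
  | h_old x hx =>
    rw [isDistributing_oldVert, isCollecting_oldVert]
    exact h x
  | h_in x => exact .inl (isDistributing_inVert x)
  | h_out y => exact .inr (isCollecting_outVert y)

theorem isDistributing_src_old {e : S.Edge} {he : e ≠ v} :
    (S.split v hv).IsDistributing ((S.split v hv).src (old hv e he)) ↔
      S.IsDistributing (S.src e) ∧ S.src e ≠ S.tgt v := by
  by_cases h : S.src e = S.tgt v
  · rw [src_old_of_eq h]
    simp [h, (isCollecting_outVert (hv := hv) ⟨e, h⟩).not_isDistributing]
  · rw [src_old_of_ne h, isDistributing_oldVert]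
    simp [h]

theorem isCollecting_tgt_old {e : S.Edge} {he : e ≠ v} :
    (S.split v hv).IsCollecting ((S.split v hv).tgt (old hv e he)) ↔
      S.IsCollecting (S.tgt e) ∧ S.tgt e ≠ S.src v := by
  by_cases h : S.tgt e = S.src v
  · rw [tgt_old_of_eq h]
    simp [h, (isDistributing_inVert (hv := hv) ⟨e, h⟩).not_isCollecting]
  · rw [tgt_old_of_ne h, isCollecting_oldVert]
    simp [h]

theorem isCollecting_src_old {e : S.Edge} {he : e ≠ v} :
    (S.split v hv).IsCollecting ((S.split v hv).src (old hv e he)) ↔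
      S.IsCollecting (S.src e) ∨ S.src e = S.tgt v := by
  by_cases h : S.src e = S.tgt v
  · rw [src_old_of_eq h]
    simp [h, isCollecting_outVert]
  · rw [src_old_of_ne h, isCollecting_oldVert]
    simp [h]

theorem isDistributing_tgt_old {e : S.Edge} {he : e ≠ v} :
    (S.split v hv).IsDistributing ((S.split v hv).tgt (old hv e he)) ↔
      S.IsDistributing (S.tgt e) ∨ S.tgt e = S.src v := by
  by_cases h : S.tgt e = S.src v
  · rw [tgt_old_of_eq h]
    simp [h, isDistributing_inVert]
  · rw [tgt_old_of_ne h, isDistributing_oldVert]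
    simp [h]

theorem front_ne_nil (h : ∀ e, S.IsDistributing (S.src e) → S.front e ≠ [])
    (e : (S.split v hv).Edge) (he : (S.split v hv).IsDistributing ((S.split v hv).src e)) :
    (S.split v hv).front e ≠ [] := by
  induction e using edge_cases with
  | h_old e hne =>
    rw [isDistributing_src_old] at he
    rw [front_old_of_ne he.2]
    exact h e he.1
  | h_new x y =>
    refine h y.1 ?_
    rw [y.2]
    exact hv.2

theorem back_ne_nil (h : ∀ e, S.IsCollecting (S.tgt e) → S.back e ≠ [])
    (e : (S.split v hv).Edge) (he : (S.split v hv).IsCollecting ((S.split v hv).tgt e)) :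
    (S.split v hv).back e ≠ [] := by
  induction e using edge_cases with
  | h_old e hne =>
    rw [isCollecting_tgt_old] at he
    rw [back_old_of_ne he.2]
    exact h e he.1
  | h_new x y =>
    refine h x.1 ?_
    rw [x.2]
    exact hv.1

/-- The edges leaving A_i carry the words Y_j, whose first letters already differ at the end of v in
S. The other distributing vertices and the words of their outgoing edges are as in S. -/
theorem front_head_inj (h : ∀ e f, S.IsDistributing (S.src e) → S.src e = S.src f →
      (S.front e).head? = (S.front f).head? → e = f)
    (e f : (S.split v hv).Edge) (he : (S.split v hv).IsDistributing ((S.split v hv).src e))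
    (hef : (S.split v hv).src e = (S.split v hv).src f)
    (hh : ((S.split v hv).front e).head? = ((S.split v hv).front f).head?) : e = f := by
  have hf : (S.split v hv).IsDistributing ((S.split v hv).src f) := by rwa [← hef]
  induction e using edge_cases with
  | h_old e he' =>
    rw [isDistributing_src_old] at he
    induction f using edge_cases with
    | h_old f hf' =>
      rw [isDistributing_src_old] at hf
      rw [src_old_of_ne he.2, src_old_of_ne hf.2, oldVert_inj] at hef
      rw [front_old_of_ne he.2, front_old_of_ne hf.2] at hh
      obtain rfl := h e f he.1 hef hh
      rfl
    | h_new x y => simp [src_old_of_ne he.2] at hef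
  | h_new x y =>
    induction f using edge_cases with
    | h_old f hf' =>
      rw [isDistributing_src_old] at hf
      simp [src_old_of_ne hf.2] at hef
    | h_new x' y' =>
      rw [src_new, src_new, inVert_inj] at hef
      subst hef
      rw [Subtype.ext (h y.1 y'.1 (by rw [y.2]; exact hv.2) (y.2.trans y'.2.symm) hh)]

theorem back_last_inj (h : ∀ e f, S.IsCollecting (S.tgt e) → S.tgt e = S.tgt f →
      (S.back e).getLast? = (S.back f).getLast? → e = f)
    (e f : (S.split v hv).Edge) (he : (S.split v hv).IsCollecting ((S.split v hv).tgt e))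
    (hef : (S.split v hv).tgt e = (S.split v hv).tgt f)
    (hh : ((S.split v hv).back e).getLast? = ((S.split v hv).back f).getLast?) : e = f := by
  have hf : (S.split v hv).IsCollecting ((S.split v hv).tgt f) := by rwa [← hef]
  induction e using edge_cases with
  | h_old e he' =>
    rw [isCollecting_tgt_old] at he
    induction f using edge_cases with
    | h_old f hf' =>
      rw [isCollecting_tgt_old] at hf
      rw [tgt_old_of_ne he.2, tgt_old_of_ne hf.2, oldVert_inj] at hef
      rw [back_old_of_ne he.2, back_old_of_ne hf.2] at hh
      obtain rfl := h e f he.1 hef hh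
      rfl
    | h_new x y => simp [tgt_old_of_ne he.2] at hef
  | h_new x y =>
    induction f using edge_cases with
    | h_old f hf' =>
      rw [isCollecting_tgt_old] at hf
      simp [tgt_old_of_ne hf.2] at hef
    | h_new x' y' =>
      rw [tgt_new, tgt_new, outVert_inj] at hef
      subst hef
      rw [Subtype.ext (h x.1 x'.1 (by rw [x.2]; exact hv.1) (x.2.trans x'.2.symm) hh)]

end split

end WordGraph

end RauzyEvolution

/-! ### Symmetric paths of S' and the corresponding symmetric paths of S. -/

namespace RauzyEvolution

namespace WordGraph

open MultiDigraph

variable {α : Type w} {S : WordGraph.{u, w} α} {v : S.Edge} {hv : S.IsSupportEdge v}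

namespace split

theorem innerFront_support (hv : S.IsSupportEdge v) : S.innerFront [v] = [] :=
  innerFront_singleton_of_not hv.1.not_isDistributing

theorem innerBack_support (hv : S.IsSupportEdge v) : S.innerBack [v] = [] :=
  innerBack_singleton_of_not hv.2.not_isCollecting

theorem frontWord_support : S.frontWord [v] = S.front v := by
  simp [frontWord_cons]

theorem isSymmetricPath_support (hv : S.IsSupportEdge v) : S.IsSymmetricPath [v] := by
  rw [isSymmetricPath_iff]
  exact ⟨by simp [Linked], by simpa using hv.1, by simpa using hv.2⟩

theorem base_ne_of_isCollecting_src {e : (S.split v hv).Edge}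
    (h : (S.split v hv).IsCollecting ((S.split v hv).src e)) : base e ≠ v := by
  induction e using edge_cases with
  | h_old e he => exact he
  | h_new x y => exact absurd h (isDistributing_inVert x).not_isCollecting

theorem base_ne_of_isDistributing_tgt {e : (S.split v hv).Edge}
    (h : (S.split v hv).IsDistributing ((S.split v hv).tgt e)) : base e ≠ v := by
  induction e using edge_cases with
  | h_old e he => exact he
  | h_new x y => exact absurd h (isCollecting_outVert y).not_isDistributing

theorem base_ne_of_startsCollecting {p : List (S.split v hv).Edge}
    (h : (S.split v hv).StartsCollecting p) : ∀ e ∈ p.head?, base e ≠ v := by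
  obtain ⟨e, p, rfl⟩ := List.exists_cons_of_ne_nil h.ne_nil
  simpa using base_ne_of_isCollecting_src (by simpa using h)

theorem base_ne_of_endsDistributing {p : List (S.split v hv).Edge}
    (h : (S.split v hv).EndsDistributing p) : ∀ e ∈ p.getLast?, base e ≠ v := by
  obtain ⟨e, he, h⟩ := h
  intro f hf
  obtain rfl := Option.mem_unique he hf
  exact base_ne_of_isDistributing_tgt h

-- Below, Y_j is read at y_j, which leaves a distributing vertex; in S' it is read one edge earlier,
-- at v_ij, since y_j now leaves the collecting vertex B_j. Along a path the two readings agree,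
-- except for a path that starts at B_j and so lacks v_ij: this is the correction term. A last edge
-- v_ij is excluded because its Y_j would not yet have been read below.
open Classical in
theorem innerFront_map_base {e : (S.split v hv).Edge} {r : List (S.split v hv).Edge}
    (h : (S.split v hv).Linked (e :: r)) (hl : ∀ f ∈ (e :: r).getLast?, base f ≠ v) :
    (if S.src (base e) = S.tgt v then S.front (base e) else []) ++
      (S.split v hv).innerFront (e :: r) = S.innerFront ((e :: r).map base) := by
  induction r generalizing e with
  | nil =>
    have hne : base e ≠ v := hl e (by simp)
    induction e using edge_cases with
    | h_new x y => exact absurd rfl hne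
    | h_old e he =>
      by_cases h1 : S.src e = S.tgt v
      · have h2 : S.IsDistributing (S.src e) := h1 ▸ hv.2
        have h3 : ¬ (S.split v hv).IsDistributing ((S.split v hv).src (old hv e he)) := by
          rw [isDistributing_src_old]
          tauto
        simp [innerFront_cons_of_not h3, h1, innerFront_cons_of_isDistributing h2]
      · by_cases h2 : S.IsDistributing (S.src e)
        · have h3 : (S.split v hv).IsDistributing ((S.split v hv).src (old hv e he)) := by
            rw [isDistributing_src_old]
            tauto
          simp [innerFront_cons_of_isDistributing h3, h1, innerFront_cons_of_isDistributing h2,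
            front_old_of_ne h1]
        · have h3 : ¬ (S.split v hv).IsDistributing ((S.split v hv).src (old hv e he)) := by
            rw [isDistributing_src_old]
            tauto
          simp [innerFront_cons_of_not h3, h1, innerFront_cons_of_not h2]
  | cons f r ih =>
    obtain ⟨hef, hr⟩ := List.isChain_cons_cons.1 h
    have ih := ih hr (by simpa using hl)
    induction e using edge_cases with
    | h_new x y =>
      have hf : S.src (base f) = S.tgt v := (tgt_base_eq_src_base hef).symm
      have hf' : base f = y.1 := by
        induction f using edge_cases with
        | h_old f hf => exact tgt_new_eq_src_old.1 hef
        | h_new x' y' => exact absurd hef tgt_new_ne_src_new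
      rw [if_pos hf, hf'] at ih
      rw [List.map_cons, base_new, innerFront_cons_of_not hv.1.not_isDistributing,
        ← ih, innerFront_cons_of_isDistributing (isDistributing_inVert x), front_new,
        if_neg (src_ne_tgt hv), List.nil_append]
    | h_old e he =>
      have hf : S.src (base f) ≠ S.tgt v := by
        rw [← tgt_base_eq_src_base hef]
        exact hv.tgt_ne he
      rw [if_neg hf, List.nil_append] at ih
      rw [List.map_cons, base_old]
      by_cases h1 : S.src e = S.tgt v
      · have h2 : S.IsDistributing (S.src e) := h1 ▸ hv.2
        have h3 : ¬ (S.split v hv).IsDistributing ((S.split v hv).src (old hv e he)) := by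
          rw [isDistributing_src_old]
          tauto
        rw [innerFront_cons_of_not h3, if_pos h1, innerFront_cons_of_isDistributing h2, ih]
      · by_cases h2 : S.IsDistributing (S.src e)
        · have h3 : (S.split v hv).IsDistributing ((S.split v hv).src (old hv e he)) := by
            rw [isDistributing_src_old]
            tauto
          rw [innerFront_cons_of_isDistributing h3, if_neg h1,
            innerFront_cons_of_isDistributing h2, front_old_of_ne h1, ih, List.nil_append]
        · have h3 : ¬ (S.split v hv).IsDistributing ((S.split v hv).src (old hv e he)) := by
            rw [isDistributing_src_old]
            tauto
          rw [innerFront_cons_of_not h3, if_neg h1, innerFront_cons_of_not h2, ih,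
            List.nil_append]

-- The mirror image of `innerFront_map_base`: X_i is read at x_i in S and one edge later, at v_ij,
-- in S'. The correction term now concerns a path that ends at A_i.
open Classical in
theorem innerBack_map_base {e : (S.split v hv).Edge} {r : List (S.split v hv).Edge}
    (h : (S.split v hv).Linked (r ++ [e])) (hl : ∀ f ∈ (r ++ [e]).head?, base f ≠ v) :
    (S.split v hv).innerBack (r ++ [e]) ++
      (if S.tgt (base e) = S.src v then S.back (base e) else []) =
        S.innerBack ((r ++ [e]).map base) := by
  have aux : ∀ (e : S.Edge) (he : e ≠ v) (r : List (S.split v hv).Edge),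
      (S.split v hv).innerBack r = S.innerBack (r.map base) →
      (S.split v hv).innerBack (r ++ [old hv e he]) ++
        (if S.tgt e = S.src v then S.back e else []) =
        S.innerBack (r.map base ++ [e]) := by
    intro e he r ih
    by_cases h1 : S.tgt e = S.src v
    · have h2 : S.IsCollecting (S.tgt e) := h1 ▸ hv.1
      have h3 : ¬ (S.split v hv).IsCollecting ((S.split v hv).tgt (old hv e he)) := by
        rw [isCollecting_tgt_old]
        tauto
      rw [innerBack_concat_of_not h3, if_pos h1, innerBack_concat_of_isCollecting h2, ih]
    · by_cases h2 : S.IsCollecting (S.tgt e)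
      · have h3 : (S.split v hv).IsCollecting ((S.split v hv).tgt (old hv e he)) := by
          rw [isCollecting_tgt_old]
          tauto
        rw [innerBack_concat_of_isCollecting h3, if_neg h1,
          innerBack_concat_of_isCollecting h2, back_old_of_ne h1, ih, List.append_nil]
      · have h3 : ¬ (S.split v hv).IsCollecting ((S.split v hv).tgt (old hv e he)) := by
          rw [isCollecting_tgt_old]
          tauto
        rw [innerBack_concat_of_not h3, if_neg h1, innerBack_concat_of_not h2, ih,
          List.append_nil]
  induction r using List.reverseRecOn generalizing e with
  | nil =>
    have hne : base e ≠ v := hl e (by simp)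
    induction e using edge_cases with
    | h_new x y => exact absurd rfl hne
    | h_old e he => exact aux e he [] rfl
  | append_singleton r f ih =>
    have hef : (S.split v hv).tgt f = (S.split v hv).src e :=
      Linked.tgt_eq_src (a := r) (b := []) (by simpa using h)
    have ih := ih h.left (by
      intro g hg
      refine hl g ?_
      rwa [List.head?_append_of_ne_nil _ (by simp)])
    rw [List.map_append]
    induction e using edge_cases with
    | h_new x y =>
      have hf : S.tgt (base f) = S.src v := tgt_base_eq_src_base hef
      have hf' : base f = x.1 := by
        induction f using edge_cases with
        | h_old f hf => exact tgt_old_eq_src_new.1 hef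
        | h_new x' y' => exact absurd hef tgt_new_ne_src_new
      rw [if_pos hf, hf'] at ih
      rw [List.map_singleton, base_new, innerBack_concat_of_not hv.2.not_isCollecting,
        ← ih, innerBack_concat_of_isCollecting (isCollecting_outVert y), back_new,
        if_neg (src_ne_tgt hv).symm, List.append_nil]
    | h_old e he =>
      have hf : S.tgt (base f) ≠ S.src v := by
        rw [tgt_base_eq_src_base hef]
        exact hv.src_ne he
      rw [if_neg hf, List.append_nil] at ih
      exact aux e he _ ih

open Classical in
/-- The edge `v` if the path starts in a vertex `B_j`. -/
noncomputable def lead (p : List (S.split v hv).Edge) : List S.Edge :=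
  if ∃ e ∈ p.head?, S.src (base e) = S.tgt v then [v] else []

open Classical in
/-- The edge `v` if the path ends in a vertex `A_i`. -/
noncomputable def trail (p : List (S.split v hv).Edge) : List S.Edge :=
  if ∃ e ∈ p.getLast?, S.tgt (base e) = S.src v then [v] else []

/-- The symmetric path of `S` that corresponds to a symmetric path of `S'`. -/
noncomputable def hat (p : List (S.split v hv).Edge) : List S.Edge :=
  lead p ++ p.map base ++ trail p

theorem lead_eq (p : List (S.split v hv).Edge) : lead p = [v] ∨ lead p = [] := by
  unfold lead
  split_ifs <;> simp

theorem trail_eq (p : List (S.split v hv).Edge) : trail p = [v] ∨ trail p = [] := by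
  unfold trail
  split_ifs <;> simp

theorem innerFront_trail (p : List (S.split v hv).Edge) : S.innerFront (trail p) = [] := by
  rcases trail_eq p with h | h <;> simp [h, innerFront_support hv]

theorem innerBack_lead (p : List (S.split v hv).Edge) : S.innerBack (lead p) = [] := by
  rcases lead_eq p with h | h <;> simp [h, innerBack_support hv]

/-- B_j is collecting and A_i is distributing in S', while below them lie the end and the beginning
of v, of the opposite types. Restoring v moves the start of the path back to a collecting vertex and
its end forward to a distributing one. -/
theorem isSymmetricPath_hat {p : List (S.split v hv).Edge} (hp : (S.split v hv).IsSymmetricPath p) :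
    S.IsSymmetricPath (hat p) := by
  have hlink := linked_map_base hp.linked
  have hfirst := base_ne_of_startsCollecting hp.2.1
  have hlast := base_ne_of_endsDistributing hp.2.2
  have h1 : S.Linked (lead p ++ p.map base) ∧ S.StartsCollecting (lead p ++ p.map base) := by
    obtain ⟨e, r, rfl⟩ := List.exists_cons_of_ne_nil hp.ne_nil
    have h2 := hp.2.1
    rw [startsCollecting_cons] at h2
    by_cases h : S.src (base e) = S.tgt v
    · have : lead (e :: r) = [v] := if_pos ⟨e, by simp, h⟩
      rw [this, List.map_cons]
      refine ⟨List.isChain_cons_cons.2 ⟨h.symm, hlink⟩, by simpa using hv.1⟩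
    · have : lead (e :: r) = [] := if_neg (by simpa using h)
      rw [this]
      refine ⟨hlink, ?_⟩
      rw [List.nil_append, List.map_cons, startsCollecting_cons]
      induction e using edge_cases with
      | h_new x y => exact absurd rfl (hfirst _ rfl)
      | h_old e he =>
        rw [isCollecting_src_old] at h2
        exact h2.resolve_right h
  have hne : p.map base ≠ [] := by simpa using hp.ne_nil
  rw [isSymmetricPath_iff, hat]
  refine ⟨?_, (startsCollecting_append (by simp [hp.ne_nil])).2 h1.2, ?_⟩
  · refine List.isChain_append.2 ⟨h1.1, ?_, ?_⟩
    · rcases trail_eq p with h | h <;> simp [h]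
    · intro f hf g hg
      rw [List.getLast?_append_of_ne_nil _ hne, List.getLast?_map] at hf
      obtain ⟨f, hf', rfl⟩ := Option.mem_map.1 hf
      unfold trail at hg
      split_ifs at hg with h
      · obtain ⟨f', h3, h4⟩ := h
        obtain rfl := Option.mem_unique h3 hf'
        obtain rfl : v = g := by simpa using hg
        exact h4
      · simp at hg
  · by_cases h : ∃ e ∈ p.getLast?, S.tgt (base e) = S.src v
    · have : trail p = [v] := if_pos h
      rw [this, endsDistributing_concat]
      exact hv.2
    · have : trail p = [] := if_neg h
      rw [this, List.append_nil, endsDistributing_append hne]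
      obtain ⟨e, he, h3⟩ := hp.2.2
      refine ⟨base e, by rw [List.getLast?_map]; exact Option.mem_map_of_mem _ he, ?_⟩
      have h4 := hlast e he
      induction e using edge_cases with
      | h_new x y => exact absurd rfl h4
      | h_old e he' =>
        rw [isDistributing_tgt_old] at h3
        exact h3.resolve_right fun h5 => h ⟨_, he, h5⟩

/-- If the path starts with y_j, the restored v contributes V, which is the extra prefix in the
front word V Y_j of y_j in S'. A restored v at the end leaves a collecting vertex and contributes
nothing. -/
theorem frontWord_hat {p : List (S.split v hv).Edge} (hp : (S.split v hv).IsSymmetricPath p) :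
    S.frontWord (hat p) = (S.split v hv).frontWord p := by
  have hfirst := base_ne_of_startsCollecting hp.2.1
  have hlast := base_ne_of_endsDistributing hp.2.2
  have hcoll := hp.2.1
  have hne : p.map base ≠ [] := by simpa using hp.ne_nil
  rw [hat, frontWord_append (by simp [hp.ne_nil]), innerFront_trail, List.append_nil]
  obtain ⟨e, r, rfl⟩ := List.exists_cons_of_ne_nil hp.ne_nil
  have key := innerFront_map_base hp.linked hlast
  rw [startsCollecting_cons] at hcoll
  rw [innerFront_cons_of_not hcoll.not_isDistributing] at key
  induction e using edge_cases with
  | h_new x y => exact absurd rfl (hfirst _ rfl)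
  | h_old e he =>
    by_cases h : S.src e = S.tgt v
    · have h1 : lead (old hv e he :: r) = [v] := if_pos ⟨_, rfl, h⟩
      rw [base_old, if_pos h] at key
      rw [h1, List.singleton_append, frontWord_cons, ← key, frontWord_cons, front_old_of_eq h,
        List.append_assoc]
    · have h1 : lead (old hv e he :: r) = [] := if_neg (by simpa using h)
      rw [isCollecting_src_old] at hcoll
      rw [base_old, if_neg h, List.map_cons, base_old,
        innerFront_cons_of_not (hcoll.resolve_right h).not_isDistributing, List.nil_append] at key
      rw [h1, List.nil_append, List.map_cons, frontWord_cons, frontWord_cons, ← key, base_old,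
        front_old_of_ne h]

theorem backWord_hat (hV : S.front v = S.back v) {p : List (S.split v hv).Edge}
    (hp : (S.split v hv).IsSymmetricPath p) :
    S.backWord (hat p) = (S.split v hv).backWord p := by
  have hfirst := base_ne_of_startsCollecting hp.2.1
  have hlast := base_ne_of_endsDistributing hp.2.2
  have hdist := hp.2.2
  rw [hat, List.append_assoc, backWord_append _ (by simp [hp.ne_nil]), innerBack_lead,
    List.nil_append]
  obtain ⟨r, e, rfl⟩ := (List.eq_nil_or_concat' p).resolve_left hp.ne_nil
  have key := innerBack_map_base hp.linked hfirst
  rw [endsDistributing_concat] at hdist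
  rw [innerBack_concat_of_not hdist.not_isCollecting] at key
  induction e using edge_cases with
  | h_new x y => exact absurd rfl (hlast (new hv x y) (by simp))
  | h_old e he =>
    by_cases h : S.tgt e = S.src v
    · have h1 : trail (r ++ [old hv e he]) = [v] := if_pos ⟨old hv e he, by simp, h⟩
      rw [base_old, if_pos h] at key
      rw [h1, backWord_concat, ← key, backWord_concat, back_old_of_eq h,
        List.append_assoc, hV]
    · have h1 : trail (r ++ [old hv e he]) = [] := if_neg (by simpa using h)
      rw [isDistributing_tgt_old] at hdist
      rw [base_old, if_neg h, List.map_append, List.map_singleton, base_old,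
        innerBack_concat_of_not (hdist.resolve_right h).not_isCollecting, List.append_nil] at key
      rw [h1, List.append_nil, List.map_append, List.map_singleton, backWord_concat,
        backWord_concat, ← key, base_old, back_old_of_ne h]

theorem innerBack_map_base_of_startsCollecting {a q : List (S.split v hv).Edge}
    (h : (S.split v hv).Linked (a ++ q)) (ha : ∀ f ∈ a.head?, base f ≠ v)
    (hq : (S.split v hv).StartsCollecting q) :
    (S.split v hv).innerBack a = S.innerBack (a.map base) := by
  rcases List.eq_nil_or_concat' a with rfl | ⟨a, e, rfl⟩
  · rfl
  · obtain ⟨f, q, rfl⟩ := List.exists_cons_of_ne_nil hq.ne_nil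
    have h1 : (S.split v hv).tgt e = (S.split v hv).src f :=
      Linked.tgt_eq_src (a := a) (b := q) (by simpa using h)
    rw [startsCollecting_cons, ← h1] at hq
    rw [← innerBack_map_base h.left ha, if_neg, List.append_nil]
    induction e using edge_cases with
    | h_new x y => exact (src_ne_tgt hv).symm
    | h_old e he =>
      rw [isCollecting_tgt_old] at hq
      exact hq.2

/-- A path of `S'` is determined by the path of `S` below it and its first edge, unless it ends with
an edge `v_{ij}`. -/
theorem eq_of_map_base_eq_of_cons {p q : List (S.split v hv).Edge} {c : (S.split v hv).Edge}
    (hp : (S.split v hv).Linked (c :: p)) (hq : (S.split v hv).Linked (c :: q))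
    (h : p.map base = q.map base) (hl : ∀ f ∈ p.getLast?, base f ≠ v) : p = q := by
  induction p generalizing q c with
  | nil => exact (List.map_eq_nil_iff.1 h.symm).symm
  | cons e p ih =>
    cases q with
    | nil => simp at h
    | cons f q =>
      obtain ⟨hce, hp⟩ := List.isChain_cons_cons.1 hp
      obtain ⟨hcf, hq⟩ := List.isChain_cons_cons.1 hq
      rw [List.map_cons, List.map_cons, List.cons.injEq] at h
      have hef : e = f := by
        induction e using edge_cases with
        | h_old e he =>
          induction f using edge_cases with
          | h_old f hf =>
            obtain rfl : e = f := h.1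
            rfl
          | h_new x y => exact absurd h.1 he
        | h_new x y =>
          induction f using edge_cases with
          | h_old f hf => exact absurd h.1.symm hf
          | h_new x' y' =>
            -- The index i of an edge v_ij is read off from the preceding edge, and j from the
            -- following one.
            have hx : x = x' := inVert_inj.1 (hce.symm.trans hcf)
            cases p with
            | nil => exact absurd rfl (hl (new hv x y) (by simp))
            | cons g p =>
              cases q with
              | nil => simp at h
              | cons g' q =>
                have h1 := (List.isChain_cons_cons.1 hp).1
                have h2 := (List.isChain_cons_cons.1 hq).1
                have h3 : base g = base g' := by simpa using (List.cons.inj h.2).1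
                have : y = y' := by
                  induction g using edge_cases with
                  | h_new => exact absurd h1 tgt_new_ne_src_new
                  | h_old g hg =>
                    induction g' using edge_cases with
                    | h_new => exact absurd h2 tgt_new_ne_src_new
                    | h_old g' hg' =>
                      rw [tgt_new_eq_src_old] at h1 h2
                      rw [Subtype.ext_iff, ← h1, ← h2]
                      exact h3
                rw [hx, this]
      subst hef
      rw [ih hp hq h.2]
      intro f hf
      refine hl f ?_
      cases p with
      | nil => simp at hf
      | cons g p => simpa using hf

theorem eq_of_map_base_eq {p q : List (S.split v hv).Edge}
    (hp : (S.split v hv).Linked p) (hq : (S.split v hv).Linked q)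
    (h : p.map base = q.map base) (hf : ∀ f ∈ p.head?, base f ≠ v)
    (hl : ∀ f ∈ p.getLast?, base f ≠ v) : p = q := by
  cases p with
  | nil => exact (List.map_eq_nil_iff.1 h.symm).symm
  | cons e p =>
    cases q with
    | nil => simp at h
    | cons f q =>
      rw [List.map_cons, List.map_cons, List.cons.injEq] at h
      have hef : e = f := by
        have he := hf e rfl
        induction e using edge_cases with
        | h_new x y => exact absurd rfl he
        | h_old e he =>
          induction f using edge_cases with
          | h_new x y => exact absurd h.1 he
          | h_old f hf =>
            obtain rfl : e = f := h.1
            rfl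
      subst hef
      rw [eq_of_map_base_eq_of_cons hp hq h.2]
      intro f hf
      refine hl f ?_
      cases p with
      | nil => simp at hf
      | cons g p => simpa using hf

/-- Paths of `S` that neither start nor end with `v` lift to `S'`. -/
theorem exists_map_base_eq (n : ℕ) {r : List S.Edge} (hn : r.length ≤ n) (hr : S.Linked r)
    (hf : ∀ f ∈ r.head?, f ≠ v) (hl : ∀ f ∈ r.getLast?, f ≠ v) :
    ∃ p : List (S.split v hv).Edge, (S.split v hv).Linked p ∧ p.map base = r := by
  induction n generalizing r with
  | zero =>
    obtain rfl : r = [] := List.eq_nil_of_length_eq_zero (by omega)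
    exact ⟨[], by simp, rfl⟩
  | succ n ih =>
    match r, hr, hf, hl with
    | [], _, _, _ => exact ⟨[], by simp, rfl⟩
    | [e], _, hf, _ => exact ⟨[old hv e (hf e rfl)], by simp, rfl⟩
    | e :: f :: r, hr, hf, hl =>
      obtain ⟨hef, hr'⟩ := List.isChain_cons_cons.1 hr
      have he : e ≠ v := hf e rfl
      by_cases hfv : f = v
      · subst hfv
        cases r with
        | nil => exact absurd rfl (hl f (by simp))
        | cons y r =>
          obtain ⟨hfy, hr''⟩ := List.isChain_cons_cons.1 hr'
          have hy : y ≠ f := by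
            rintro rfl
            exact src_ne_tgt hv hfy.symm
          obtain ⟨p, hp, hpr⟩ := ih (r := y :: r) (by simp at hn ⊢; omega) hr''
            (by simpa using hy) (by simpa using hl)
          cases p with
          | nil => simp at hpr
          | cons g p =>
            rw [List.map_cons, List.cons.injEq] at hpr
            -- An occurrence of v is lifted to the v_ij named by its two neighbours. Two edges are
            -- consumed at once, hence the induction on a bound for the length.
            refine ⟨old hv e he :: new hv ⟨e, hef⟩ ⟨y, hfy.symm⟩ :: g :: p, ?_, ?_⟩
            · refine List.isChain_cons_cons.2 ⟨tgt_old_eq_src_new.2 rfl,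
                List.isChain_cons_cons.2 ⟨?_, hp⟩⟩
              induction g using edge_cases with
              | h_new => exact absurd hpr.1.symm hy
              | h_old g hg => exact tgt_new_eq_src_old.2 hpr.1
            · simp [hpr]
      · obtain ⟨p, hp, hpr⟩ := ih (r := f :: r) (by simp at hn ⊢; omega) hr'
          (by simpa using hfv) (by simpa using hl)
        cases p with
        | nil => simp at hpr
        | cons g p =>
          rw [List.map_cons, List.cons.injEq] at hpr
          refine ⟨old hv e he :: g :: p, List.isChain_cons_cons.2 ⟨?_, hp⟩, by simp [hpr]⟩
          induction g using edge_cases with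
          | h_new => exact absurd hpr.1.symm hfv
          | h_old g hg =>
            rw [tgt_old_eq_src_old, hef, ← hpr.1]
            rfl

end split

end WordGraph

end RauzyEvolution

/-! ### Synchronization, good edges, and coverage of subwords in S'. -/

namespace RauzyEvolution

namespace WordGraph

open MultiDigraph

variable {α : Type w} {S : WordGraph.{u, w} α} {v : S.Edge} {hv : S.IsSupportEdge v}

/-- A block that neither begins nor ends with v cannot reach the copies of v added at the two ends
of a path, so it lies in the projected path itself. -/
theorem exists_eq_append_of_append_eq {β : Type*} {v : β} {L M T X N Z : List β}
    (hL : L = [v] ∨ L = []) (hT : T = [v] ∨ T = []) (h : L ++ M ++ T = X ++ N ++ Z) (hN : N ≠ [])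
    (hf : ∀ e ∈ N.head?, e ≠ v) (hl : ∀ e ∈ N.getLast?, e ≠ v) :
    ∃ X' Z', X = L ++ X' ∧ Z = Z' ++ T ∧ M = X' ++ N ++ Z' := by
  obtain ⟨X', rfl⟩ : ∃ X', X = L ++ X' := by
    rcases hL with rfl | rfl
    · cases X with
      | nil =>
        obtain ⟨e, N, rfl⟩ := List.exists_cons_of_ne_nil hN
        simp only [List.cons_append, List.nil_append, List.cons.injEq] at h
        exact absurd h.1.symm (hf e rfl)
      | cons x X =>
        simp only [List.cons_append, List.nil_append, List.cons.injEq] at h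
        exact ⟨X, by simp [h.1]⟩
    · exact ⟨X, rfl⟩
  obtain ⟨Z', rfl⟩ : ∃ Z', Z = Z' ++ T := by
    rcases hT with rfl | rfl
    · rcases List.eq_nil_or_concat' Z with rfl | ⟨Z, z, rfl⟩
      · obtain ⟨N, e, rfl⟩ := (List.eq_nil_or_concat' N).resolve_left hN
        rw [List.append_nil, ← List.append_assoc] at h
        have h1 := (List.append_inj' h rfl).2
        exact absurd (by simpa using h1.symm) (hl e (by simp))
      · rw [← List.append_assoc] at h
        have h1 := (List.append_inj' h rfl).2
        exact ⟨Z, by rw [h1]⟩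
    · exact ⟨Z, by simp⟩
  refine ⟨X', Z', rfl, rfl, ?_⟩
  rw [← List.append_assoc] at h
  have h1 := List.append_cancel_right h
  simp only [List.append_assoc] at h1 ⊢
  exact List.append_cancel_left h1

namespace split

theorem isCollecting_tgt_inEdge (hv : S.IsSupportEdge v) (x : S.InEdge v) :
    S.IsCollecting (S.tgt x.1) := by
  rw [x.2]
  exact hv.1

theorem isDistributing_src_outEdge (hv : S.IsSupportEdge v) (y : S.OutEdge v) :
    S.IsDistributing (S.src y.1) := by
  rw [y.2]
  exact hv.2

theorem frontWord_eq_backWord (hword : ∀ p, S.IsSymmetricPath p → S.frontWord p = S.backWord p)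
    (p : List (S.split v hv).Edge) (hp : (S.split v hv).IsSymmetricPath p) :
    (S.split v hv).frontWord p = (S.split v hv).backWord p := by
  have hV : S.front v = S.back v := by
    have := hword [v] (isSymmetricPath_support hv)
    simpa [frontWord_cons, backWord] using this
  rw [← frontWord_hat hp, ← backWord_hat hV hp, hword _ (isSymmetricPath_hat hp)]

/-- Synchronization in S locates `hat p` in `hat q`. Its part below `p` lies below a part of `q`,
and lifts are unique, so that part is `p`. The positions agree because a leading v adds nothing to
the inner back word. -/
theorem isSynchronized (hsync : S.IsSynchronized) : (S.split v hv).IsSynchronized := by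
  intro p q hp hq s t hst
  rw [← frontWord_hat hp, ← frontWord_hat hq] at hst
  obtain ⟨a, b, hab, ha⟩ := hsync _ _ (isSymmetricPath_hat hp) (isSymmetricPath_hat hq) s t hst
  have hfirst := base_ne_of_startsCollecting hp.2.1
  have hlast := base_ne_of_endsDistributing hp.2.2
  obtain ⟨X, Z, hX, hZ, hM⟩ := exists_eq_append_of_append_eq (N := p.map base)
    (X := a ++ lead p) (Z := trail p ++ b) (lead_eq q) (trail_eq q)
    (by
      change hat q = _
      rw [hab, hat]
      simp)
    (by simpa using hp.ne_nil)
    (by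
      intro f hf
      rw [List.head?_map] at hf
      obtain ⟨f, hf', rfl⟩ := Option.mem_map.1 hf
      exact hfirst f hf')
    (by
      intro f hf
      rw [List.getLast?_map] at hf
      obtain ⟨f, hf', rfl⟩ := Option.mem_map.1 hf
      exact hlast f hf')
  obtain ⟨c, d, hq', hc, rfl⟩ := List.map_eq_append_iff.1 hM
  obtain ⟨a', m, rfl, rfl, hm⟩ := List.map_eq_append_iff.1 hc
  subst hq'
  obtain rfl : p = m := eq_of_map_base_eq hp.linked hq.linked.left.right hm.symm hfirst hlast
  refine ⟨a', d, rfl, ?_⟩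
  rw [innerBack_map_base_of_startsCollecting hq.linked.left _ hp.2.1, ← ha]
  · have := congrArg S.innerBack hX
    rw [innerBack_append, innerBack_append, innerBack_lead, innerBack_lead, List.append_nil,
      List.nil_append] at this
    exact this.symm
  · intro f hf
    refine base_ne_of_startsCollecting hq.2.1 f ?_
    rw [List.append_assoc, List.head?_append]
    simp [Option.mem_def.1 hf]

/-- A symmetric path cannot start or end with v_ij, because A_i is distributing and B_j is
collecting. So v_ij has both neighbours, and these must be x_i and y_j. -/
theorem exists_eq_of_mem_new {p : List (S.split v hv).Edge}
    (hp : (S.split v hv).IsSymmetricPath p) {x : S.InEdge v} {y : S.OutEdge v}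
    (h : new hv x y ∈ p) : ∃ a b, hat p = a ++ [x.1, v, y.1] ++ b := by
  obtain ⟨c, d, rfl⟩ := List.append_of_mem h
  have hl := hp.linked
  rcases List.eq_nil_or_concat' c with rfl | ⟨c, e, rfl⟩
  · exact absurd rfl (base_ne_of_startsCollecting hp.2.1 (new hv x y) (by simp))
  rcases d with _ | ⟨f, d⟩
  · exact absurd rfl (base_ne_of_endsDistributing hp.2.2 (new hv x y) (by simp))
  have h1 := Linked.tgt_eq_src (G := (S.split v hv).toMultiDigraph) (a := c) (e := e)
    (f := new hv x y) (b := f :: d) (by simpa using hl)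
  have h2 := Linked.tgt_eq_src (G := (S.split v hv).toMultiDigraph) (a := c ++ [e])
    (e := new hv x y) (f := f) (b := d) (by simpa using hl)
  have h3 : base e = x.1 := by
    induction e using edge_cases with
    | h_old e he => exact tgt_old_eq_src_new.1 h1
    | h_new => exact absurd h1 tgt_new_ne_src_new
  have h4 : base f = y.1 := by
    induction f using edge_cases with
    | h_old e he => exact tgt_new_eq_src_old.1 h2
    | h_new => exact absurd h2 tgt_new_ne_src_new
  refine ⟨lead (c ++ [e] ++ new hv x y :: f :: d) ++ c.map base,
    d.map base ++ trail (c ++ [e] ++ new hv x y :: f :: d), ?_⟩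
  simp [hat, h3, h4]

theorem mem_new_of_eq {p : List (S.split v hv).Edge}
    (hp : (S.split v hv).IsSymmetricPath p) {x : S.InEdge v} {y : S.OutEdge v} {a b : List S.Edge}
    (h : hat p = a ++ [x.1, v, y.1] ++ b) : new hv x y ∈ p := by
  obtain ⟨X, Z, hX, hZ, hM⟩ := exists_eq_append_of_append_eq (N := [x.1, v, y.1]) (lead_eq p)
    (trail_eq p) h (by simp) (by simpa using inEdge_ne hv x) (by simpa using outEdge_ne hv y)
  obtain ⟨c, d, rfl, hc, rfl⟩ := List.map_eq_append_iff.1 hM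
  obtain ⟨a', m, rfl, rfl, hm⟩ := List.map_eq_append_iff.1 hc
  have hl := hp.linked.left.right
  obtain ⟨e, m, rfl, he, hm⟩ := List.map_eq_cons_iff.1 hm
  obtain ⟨f, m, rfl, hf, hm⟩ := List.map_eq_cons_iff.1 hm
  obtain ⟨g, m, rfl, hg, hm⟩ := List.map_eq_cons_iff.1 hm
  obtain ⟨h1, h2⟩ := List.isChain_cons_cons.1 hl
  have h2 := (List.isChain_cons_cons.1 h2).1
  induction f using edge_cases with
  | h_old f hf' => exact absurd hf hf'
  | h_new x' y' =>
    have hx : x' = x := by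
      induction e using edge_cases with
      | h_old e he' =>
        rw [tgt_old_eq_src_new] at h1
        exact Subtype.ext (h1.symm.trans he)
      | h_new => exact absurd h1 tgt_new_ne_src_new
    have hy : y' = y := by
      induction g using edge_cases with
      | h_old e he' =>
        rw [tgt_new_eq_src_old] at h2
        exact Subtype.ext (h2.symm.trans hg)
      | h_new => exact absurd h2 tgt_new_ne_src_new
    subst hx hy
    simp

variable {W : ℕ → α}

/-- A symmetric path using v_ij lies over x_i v y_j, so X_i V Y_j is a factor of its word. -/
theorem isGood_of_isSubword (hS : S.IsRauzyScheme W) {p : List (S.split v hv).Edge}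
    (hp : (S.split v hv).IsSymmetricPath p) (hsub : IsSubword ((S.split v hv).frontWord p) W) :
    ∀ e ∈ p, S.IsGood W v hv e := by
  intro e he
  induction e using edge_cases with
  | h_old e he => exact isGood_old
  | h_new x y =>
    rw [isGood_new]
    refine hsub.of_infix ?_
    obtain ⟨a, b, hab⟩ := exists_eq_of_mem_new hp he
    have hab' : hat p = (a ++ [x.1]) ++ [v] ++ ([y.1] ++ b) := by simp [hab]
    have hh := isSymmetricPath_hat hp
    rw [hab'] at hh
    rw [← frontWord_hat hp, hab',
      frontWord_append_append hS.front_eq_back hh (isSymmetricPath_support hv),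
      innerBack_concat_of_isCollecting (isCollecting_tgt_inEdge hv x), List.singleton_append,
      innerFront_cons_of_isDistributing (isDistributing_src_outEdge hv y), frontWord_support]
    exact ⟨S.innerBack a, S.innerFront b, by simp⟩

/-- For an old edge, the forcing word in S still works. For a good v_ij, take X_i V Y_j:
synchronization for the one-edge path v turns its middle part into a passage through v. The edge
before then shares its last letter with X_i and the edge after shares its first letter with Y_j, so
property 2 identifies them as x_i and y_j. -/
theorem edge_forced (hS : S.IsRauzyScheme W) (hsync : S.IsSynchronized)
    {e : (S.split v hv).Edge} (he : S.IsGood W v hv e) :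
    ∃ u, IsSubword u W ∧ ∀ p, (S.split v hv).IsSymmetricPath p →
      u <:+: (S.split v hv).frontWord p → e ∈ p := by
  induction e using edge_cases with
  | h_old e hne =>
    obtain ⟨u, hu, hforce⟩ := hS.edge_forced e
    refine ⟨u, hu, fun p hp hup => ?_⟩
    rw [← frontWord_hat hp] at hup
    have hmem := hforce _ (isSymmetricPath_hat hp) hup
    rw [hat, List.mem_append, List.mem_append] at hmem
    have hmem : e ∈ p.map base := by
      rcases hmem with (h | h) | h
      · rcases lead_eq p with h' | h' <;> simp [h', hne] at h
      · exact h
      · rcases trail_eq p with h' | h' <;> simp [h', hne] at h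
    obtain ⟨f, hf, hfe⟩ := List.mem_map.1 hmem
    induction f using edge_cases with
    | h_old f hf' =>
      obtain rfl : f = e := hfe
      exact hf
    | h_new => exact absurd hfe.symm hne
  | h_new x y =>
    refine ⟨_, isGood_new.1 he, fun p hp hup => ?_⟩
    rw [← frontWord_hat hp] at hup
    obtain ⟨s, t, hst⟩ := hup
    have hh := isSymmetricPath_hat hp
    have hx : S.IsCollecting (S.tgt x.1) := isCollecting_tgt_inEdge hv x
    have hy : S.IsDistributing (S.src y.1) := isDistributing_src_outEdge hv y
    obtain ⟨a, b, hab, ha⟩ := hsync [v] (hat p) (isSymmetricPath_support hv) hh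
      (s ++ S.back x.1) (S.front y.1 ++ t) (by rw [← hst, frontWord_support]; simp)
    have hb : S.innerFront b = S.front y.1 ++ t := by
      have h1 := frontWord_append_append hS.front_eq_back (hab ▸ hh) (isSymmetricPath_support hv)
      rw [← hab, ← hst, ha, frontWord_support] at h1
      simpa using h1.symm
    rw [hab] at hh
    have hl := hh.linked
    rcases List.eq_nil_or_concat' a with rfl | ⟨a, e, rfl⟩
    · have := hS.back_ne_nil _ hx
      simp [this] at ha
    rcases b with _ | ⟨f, b⟩
    · have := hS.front_ne_nil _ hy
      simp [this] at hb
    have h1 : S.tgt e = S.src v := Linked.tgt_eq_src (a := a) (b := f :: b) (by simpa using hl)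
    have h2 : S.tgt v = S.src f :=
      Linked.tgt_eq_src (a := a ++ [e]) (b := b) (by simpa using hl)
    have he' : S.IsCollecting (S.tgt e) := h1 ▸ hv.1
    have hf' : S.IsDistributing (S.src f) := h2 ▸ hv.2
    have hex : e = x.1 := by
      refine hS.back_last_inj e x.1 he' (h1.trans x.2.symm) ?_
      rw [innerBack_concat_of_isCollecting he'] at ha
      have := congrArg List.getLast? ha
      rwa [List.getLast?_append_of_ne_nil _ (hS.back_ne_nil _ he'),
        List.getLast?_append_of_ne_nil _ (hS.back_ne_nil _ hx)] at this
    have hfy : f = y.1 := by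
      refine hS.front_head_inj f y.1 hf' (h2.symm.trans y.2.symm) ?_
      rw [innerFront_cons_of_isDistributing hf'] at hb
      have := congrArg List.head? hb
      rwa [List.head?_append_of_ne_nil _ (hS.front_ne_nil _ hf'),
        List.head?_append_of_ne_nil _ (hS.front_ne_nil _ hy)] at this
    refine mem_new_of_eq hp (a := a) (b := b) ?_
    rw [hab, hex, hfy]
    simp

/-- Between two passages of v the path starts with some y_j and ends with some x_i, so it lifts; the
lift runs from B_j to A_i, and exactly then `hat` restores both copies of v. -/
theorem exists_hat_eq {r : List S.Edge} (h : S.IsSymmetricPath ([v] ++ r ++ [v])) :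
    ∃ p, (S.split v hv).IsSymmetricPath p ∧ hat p = [v] ++ r ++ [v] := by
  have hl := h.linked
  have hr : r ≠ [] := by
    rintro rfl
    have : S.tgt v = S.src v := Linked.tgt_eq_src (a := []) (b := []) (by simpa using hl)
    exact src_ne_tgt hv this.symm
  have hfirst : ∀ f ∈ r.head?, S.src f = S.tgt v := by
    obtain ⟨f, r, rfl⟩ := List.exists_cons_of_ne_nil hr
    have : S.tgt v = S.src f := Linked.tgt_eq_src (a := []) (b := r ++ [v]) (by simpa using hl)
    simpa using this.symm
  have hlast : ∀ f ∈ r.getLast?, S.tgt f = S.src v := by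
    obtain ⟨r, f, rfl⟩ := (List.eq_nil_or_concat' r).resolve_left hr
    have : S.tgt f = S.src v := Linked.tgt_eq_src (a := v :: r) (b := []) (by simpa using hl)
    simpa using this
  obtain ⟨p, hp, rfl⟩ := exists_map_base_eq (hv := hv) r.length le_rfl hl.left.right
    (fun f hf => by
      rintro rfl
      exact src_ne_tgt hv (hfirst f hf))
    (fun f hf => by
      rintro rfl
      exact src_ne_tgt hv (hlast f hf).symm)
  have hp' : p ≠ [] := by simpa using hr
  have h1 : ∃ e ∈ p.head?, S.src (base e) = S.tgt v := by
    obtain ⟨e, p, rfl⟩ := List.exists_cons_of_ne_nil hp'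
    exact ⟨e, rfl, hfirst _ rfl⟩
  have h2 : ∃ e ∈ p.getLast?, S.tgt (base e) = S.src v := by
    obtain ⟨p, e, rfl⟩ := (List.eq_nil_or_concat' p).resolve_left hp'
    exact ⟨e, by simp, hlast _ (by simp)⟩
  refine ⟨p, isSymmetricPath_iff.2 ⟨hp, ?_, ?_⟩, ?_⟩
  · obtain ⟨e, he, h⟩ := h1
    refine ⟨e, he, ?_⟩
    induction e using edge_cases with
    | h_old e he => exact isCollecting_src_old.2 (.inr h)
    | h_new x y => exact absurd h (src_ne_tgt hv)
  · obtain ⟨e, he, h⟩ := h2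
    refine ⟨e, he, ?_⟩
    induction e using edge_cases with
    | h_old e he => exact isDistributing_tgt_old.2 (.inr h)
    | h_new x y => exact absurd h.symm (src_ne_tgt hv)
  · rw [hat, show lead p = [v] from if_pos h1, show trail p = [v] from if_pos h2]

/-- Every subword of `W` is covered by a symmetric path of `S'` whose word is a subword of `W`. -/
theorem exists_path_of_isSubword (hrec : IsRecurrent W) (hS : S.IsRauzyScheme W)
    (hsync : S.IsSynchronized) {u : List α} (hu : IsSubword u W) :
    ∃ p, (S.split v hv).IsSymmetricPath p ∧ u <:+: (S.split v hv).frontWord p ∧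
      IsSubword ((S.split v hv).frontWord p) W := by
  have hV : IsSubword (S.frontWord [v]) W := by
    rw [frontWord_support]
    exact hS.front_subword v
  -- By recurrence V occurs before some occurrence of u and again after it. The block between is the
  -- word of a path from v to v, which lifts to S'.
  obtain ⟨i, hi⟩ := hV
  obtain ⟨k, hk, hocc⟩ := hrec.exists_occursAt hu i
  obtain ⟨j, hj, hj'⟩ := hrec.exists_occursAt ⟨i, hi⟩ (i + (S.frontWord [v]).length + k + u.length)
  obtain ⟨r, hr, hword⟩ := exists_path_of_occursAt hsync hS.front_eq_back hS.subword_covered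
    (isSymmetricPath_support hv) (isSymmetricPath_support hv) hi hj' (by omega)
  obtain ⟨p, hp, hpr⟩ := exists_hat_eq (hv := hv) hr
  refine ⟨p, hp, ?_⟩
  rw [← frontWord_hat hp, hpr, hword]
  refine ⟨?_, isSubword_block _ _⟩
  refine ⟨block W i (k - i),
    block W (k + u.length) (j + (S.frontWord [v]).length - k - u.length), ?_⟩
  conv_lhs => rw [occursAt_iff.1 hocc]
  rw [show j + (S.frontWord [v]).length - i =
    (k - i) + u.length + (j + (S.frontWord [v]).length - k - u.length) by omega, block_add,
    block_add,
    show i + (k - i) = k by omega, show i + (k - i + u.length) = k + u.length by omega, length_block]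

end split

/-! ### Joining paths by recurrence, and forced continuation implying periodicity. -/

/-- Good edges of `S'` and a subword of `W` are met in a prescribed order by a symmetric path whose
word is a subword of `W`. -/
theorem exists_path_through {H : WordGraph.{u, w} α} {W : ℕ → α} (hrec : IsRecurrent W)
    (hsync : H.IsSynchronized)
    (hword : ∀ p, H.IsSymmetricPath p → H.frontWord p = H.backWord p)
    (hcov : ∀ u, IsSubword u W → ∃ p, H.IsSymmetricPath p ∧ u <:+: H.frontWord p ∧
      IsSubword (H.frontWord p) W) {e f : H.Edge}
    (he : ∃ u, IsSubword u W ∧ ∀ p, H.IsSymmetricPath p → u <:+: H.frontWord p → e ∈ p)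
    (hf : ∃ u, IsSubword u W ∧ ∀ p, H.IsSymmetricPath p → u <:+: H.frontWord p → f ∈ p)
    {u : List α} (hu : IsSubword u W) :
    ∃ a m p n b, H.IsSymmetricPath (a ++ e :: m ++ p ++ n ++ f :: b) ∧
      IsSubword (H.frontWord (a ++ e :: m ++ p ++ n ++ f :: b)) W ∧
      H.IsSymmetricPath p ∧ u <:+: H.frontWord p := by
  have hcov' : ∀ u, IsSubword u W → ∃ p, H.IsSymmetricPath p ∧ u <:+: H.frontWord p := by
    intro u hu
    obtain ⟨p, h1, h2, -⟩ := hcov u hu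
    exact ⟨p, h1, h2⟩
  -- The second word recurs to the right of an occurrence of the first, and the block of `W`
  -- spanning both is the word of a joined path.
  have join : ∀ q₁ q₂, H.IsSymmetricPath q₁ → H.IsSymmetricPath q₂ →
      IsSubword (H.frontWord q₁) W → IsSubword (H.frontWord q₂) W →
      ∃ r, H.IsSymmetricPath (q₁ ++ r ++ q₂) ∧ IsSubword (H.frontWord (q₁ ++ r ++ q₂)) W := by
    rintro q₁ q₂ h₁ h₂ ⟨i, hi⟩ hw₂
    obtain ⟨j, hij, hj⟩ := hrec.exists_occursAt hw₂ (i + (H.frontWord q₁).length)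
    obtain ⟨r, hr, hrw⟩ := exists_path_of_occursAt hsync hword hcov' h₁ h₂ hi hj hij
    exact ⟨r, hr, hrw ▸ isSubword_block _ _⟩
  obtain ⟨ue, hue, hforce⟩ := he
  obtain ⟨uf, huf, hforce'⟩ := hf
  obtain ⟨p₁, hp₁, hu₁, hw₁⟩ := hcov ue hue
  obtain ⟨p₂, hp₂, hu₂, hw₂⟩ := hcov u hu
  obtain ⟨p₃, hp₃, hu₃, hw₃⟩ := hcov uf huf
  obtain ⟨r, hr, hrw⟩ := join p₁ p₂ hp₁ hp₂ hw₁ hw₂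
  obtain ⟨s, hs, hsw⟩ := join _ p₃ hr hp₃ hrw hw₃
  obtain ⟨a, m, rfl⟩ := List.append_of_mem (hforce _ hp₁ hu₁)
  obtain ⟨n, b, rfl⟩ := List.append_of_mem (hforce' _ hp₃ hu₃)
  refine ⟨a, m ++ r, p₂, s ++ n, b, ?_⟩
  simp only [List.append_assoc, List.cons_append] at hs hsw ⊢
  exact ⟨hs, hsw, hp₂, hu₂⟩

/-- If the good edge that continues a path is always unique, then the word is periodic. -/
theorem isPeriodic_of_unique_good {H : WordGraph.{u, w} α} {W : ℕ → α} (hrec : IsRecurrent W)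
    (hsync : H.IsSynchronized)
    (hword : ∀ p, H.IsSymmetricPath p → H.frontWord p = H.backWord p)
    (hcov : ∀ u, IsSubword u W → ∃ p, H.IsSymmetricPath p ∧ u <:+: H.frontWord p ∧
      IsSubword (H.frontWord p) W) {good : H.Edge → Prop}
    (hgood : ∀ p, H.IsSymmetricPath p → IsSubword (H.frontWord p) W → ∀ e ∈ p, good e)
    (huniq : ∀ e f, good e → good f → H.src e = H.src f → e = f) : IsPeriodic W := by
  have hcov' : ∀ u, IsSubword u W → ∃ p, H.IsSymmetricPath p ∧ u <:+: H.frontWord p := by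
    intro u hu
    obtain ⟨p, h1, h2, -⟩ := hcov u hu
    exact ⟨p, h1, h2⟩
  obtain ⟨q, hq, -, hqw⟩ := hcov [] ⟨0, by intro j h; simp at h⟩
  obtain ⟨i, hi⟩ := hqw
  set n := (H.frontWord q).length with hn
  obtain ⟨i', hii', hi'⟩ := hrec.exists_occursAt ⟨i, hi⟩ (i + n)
  obtain ⟨e, q', hqe⟩ := List.exists_cons_of_ne_nil hq.ne_nil
  -- The word of `q` occurs at i and at i'. For each t, a third occurrence far to the right closes
  -- both up to paths with the same first edge. Since continuations are forced, one path is a prefix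
  -- of the other, and comparing their letters at t gives W(i + t) = W(i' + t).
  refine hrec.isPeriodic (N := i) (d := i' - i) (by omega) fun t => ?_
  obtain ⟨j, hj, hocc⟩ := hrec.exists_occursAt ⟨i, hi⟩ (i' + n + t)
  obtain ⟨r, hr, hrw⟩ := exists_path_of_occursAt hsync hword hcov' hq hq hi hocc (by omega)
  obtain ⟨r', hr', hrw'⟩ := exists_path_of_occursAt hsync hword hcov' hq hq hi' hocc (by omega)
  have hg := hgood _ hr (hrw ▸ isSubword_block _ _)
  have hg' := hgood _ hr' (hrw' ▸ isSubword_block _ _)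
  rw [← hn] at hrw hrw'
  set p := q ++ r ++ q with hp
  set p' := q ++ r' ++ q with hp'
  have hpe : p = e :: (q' ++ r ++ q) := by rw [hp, hqe]; simp
  have hpe' : p' = e :: (q' ++ r' ++ q) := by rw [hp', hqe]; simp
  have hpre : ∀ p₁ p₂ : List H.Edge, H.Linked (e :: p₁) → H.Linked (e :: p₂) →
      (∀ f ∈ e :: p₁, good f) → (∀ f ∈ e :: p₂, good f) → p₁.length ≤ p₂.length →
      ∃ z, H.frontWord (e :: p₂) = H.frontWord (e :: p₁) ++ z := by
    intro p₁ p₂ h₁ h₂ hg₁ hg₂ hle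
    obtain ⟨c, rfl⟩ := h₁.prefix_of_length_le (good := good) h₂
      (fun f hf g hg hfg => huniq g f hg (hg₁ f (by simp [hf])) hfg)
      (fun g hg => hg₂ g (by simp [hg])) hle
    exact ⟨H.innerFront c, by rw [← List.cons_append, frontWord_append (by simp)]⟩
  -- The path starting at i' has the shorter word; were it the longer path, the longer word would be
  -- a prefix of the shorter one.
  have hlen : (q' ++ r' ++ q).length ≤ (q' ++ r ++ q).length := by
    by_contra hlt
    obtain ⟨z, hz⟩ := hpre _ _ (hpe ▸ hr.linked) (hpe' ▸ hr'.linked) (hpe ▸ hg) (hpe' ▸ hg')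
      (le_of_not_ge hlt)
    rw [← hpe, ← hpe', hrw, hrw'] at hz
    have := congrArg List.length hz
    simp only [List.length_append, length_block] at this
    omega
  obtain ⟨z, hz⟩ := hpre _ _ (hpe' ▸ hr'.linked) (hpe ▸ hr.linked) (hpe' ▸ hg') (hpe ▸ hg) hlen
  rw [← hpe, ← hpe', hrw, hrw'] at hz
  have ht : t < (block W i (j + n - i)).length := by rw [length_block]; omega
  have ht' : t < (block W i' (j + n - i')).length := by rw [length_block]; omega
  have h1 : (block W i (j + n - i))[t] = (block W i' (j + n - i'))[t] := by
    simp only [hz]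
    rw [List.getElem_append_left ht']
  rw [getElem_block, getElem_block] at h1
  rw [h1]
  congr 1
  omega

end WordGraph

end RauzyEvolution

/-! ### Contraction of a graph along good chains. -/

namespace RauzyEvolution

namespace MultiDigraph

variable {H : MultiDigraph.{u}} {good : H.Edge → Prop}

theorem eq_of_not_isNonvanishing {e f : H.Edge} (h : ¬ H.IsNonvanishing good (H.src e))
    (he : good e) (hf : good f) (hef : H.src f = H.src e) : f = e := by
  by_contra hne
  exact h (.inl (Set.one_lt_encard_iff.2 ⟨f, e, ⟨hf, hef⟩, ⟨he, rfl⟩, hne⟩))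

theorem isNonvanishing_reverse {x : H.Vert} :
    H.reverse.IsNonvanishing good x ↔ H.IsNonvanishing good x := or_comm

/-- No intermediate vertex of the path is non-vanishing. -/
def InnerVanishing (H : MultiDigraph.{u}) (good : H.Edge → Prop) (p : List H.Edge) : Prop :=
  ∀ a f g b, p = a ++ f :: g :: b → ¬ H.IsNonvanishing good (H.tgt f)

theorem innerVanishing_singleton (e : H.Edge) : H.InnerVanishing good [e] := by
  rintro (_ | ⟨_, _ | ⟨_, _⟩⟩) f g b h <;> simp at h

theorem InnerVanishing.cons {e : H.Edge} {p : List H.Edge} (hp : H.InnerVanishing good p)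
    (he : ¬ H.IsNonvanishing good (H.tgt e)) : H.InnerVanishing good (e :: p) := by
  rintro (_ | ⟨a, as⟩) f g b h
  · simp only [List.nil_append, List.cons.injEq] at h
    rwa [← h.1]
  · simp only [List.cons_append, List.cons.injEq] at h
    exact hp as f g b h.2

theorem InnerVanishing.of_mem_tail {e : H.Edge} {p : List H.Edge}
    (hp : H.InnerVanishing good (e :: p)) (hl : H.Linked (e :: p)) {f : H.Edge} (hf : f ∈ p) :
    ¬ H.IsNonvanishing good (H.src f) := by
  obtain ⟨a, b, rfl⟩ := List.append_of_mem hf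
  rcases List.eq_nil_or_concat' (e :: a) with h | ⟨c, g, h⟩
  · simp at h
  · have h1 : e :: (a ++ f :: b) = c ++ g :: f :: b := by
      rw [← List.cons_append, h]
      simp
    rw [h1] at hl
    rw [← hl.tgt_eq_src]
    exact hp c g f b h1

/-- A path with a non-vanishing end starts with a path without non-vanishing intermediate vertices
that has a non-vanishing end. -/
theorem exists_prefix_innerVanishing {e : H.Edge} {r : List H.Edge}
    (h : ∃ f ∈ (e :: r).getLast?, H.IsNonvanishing good (H.tgt f)) :
    ∃ p q, e :: r = p ++ q ∧ H.InnerVanishing good p ∧ p.head? = some e ∧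
      ∃ f ∈ p.getLast?, H.IsNonvanishing good (H.tgt f) := by
  induction r generalizing e with
  | nil => exact ⟨[e], [], rfl, innerVanishing_singleton e, rfl, h⟩
  | cons g r ih =>
    by_cases he : H.IsNonvanishing good (H.tgt e)
    · exact ⟨[e], g :: r, rfl, innerVanishing_singleton e, rfl, e, rfl, he⟩
    · obtain ⟨p, q, hpq, hp, hh, hl⟩ := ih (e := g) (by simpa using h)
      refine ⟨e :: p, q, by rw [hpq, List.cons_append], hp.cons he, rfl, ?_⟩
      cases p with
      | nil => simp at hh
      | cons x p => simpa using hl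

/-- `K` is the contraction of `H` along good edges: `vert` identifies the vertices of `K` with the
non-vanishing vertices of `H`, and `chain` identifies its edges with the good paths between them
without non-vanishing intermediate vertices. -/
structure IsContraction (H : MultiDigraph.{u}) (good : H.Edge → Prop) (K : MultiDigraph.{u})
    (vert : K.Vert → H.Vert) (chain : K.Edge → List H.Edge) : Prop where
  vert_inj : Function.Injective vert
  vert_range : ∀ x, H.IsNonvanishing good x ↔ ∃ y, vert y = x
  chain_linked : ∀ e, H.Linked (chain e)
  chain_good : ∀ e, ∀ f ∈ chain e, good f
  chain_head : ∀ e, ∃ f ∈ (chain e).head?, H.src f = vert (K.src e)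
  chain_last : ∀ e, ∃ f ∈ (chain e).getLast?, H.tgt f = vert (K.tgt e)
  chain_inner : ∀ e, H.InnerVanishing good (chain e)
  chain_inj : Function.Injective chain
  chain_surj : ∀ p, H.Linked p → (∀ f ∈ p, good f) →
    (∃ f ∈ p.head?, H.IsNonvanishing good (H.src f)) →
    (∃ f ∈ p.getLast?, H.IsNonvanishing good (H.tgt f)) → H.InnerVanishing good p →
    ∃ e, chain e = p

theorem innerVanishing_reverse {p : List H.Edge} (hl : H.Linked p)
    (h : H.InnerVanishing good p) : H.reverse.InnerVanishing good p.reverse := by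
  intro a f g b hp
  have hp' : p = b.reverse ++ g :: f :: a.reverse := by
    rw [← List.reverse_reverse p, hp]
    simp
  have h1 := h _ _ _ _ hp'
  rw [hp'] at hl
  rw [hl.tgt_eq_src] at h1
  exact fun h2 => h1 (isNonvanishing_reverse.1 h2)

namespace IsContraction

variable {K : MultiDigraph.{u}} {vert : K.Vert → H.Vert} {chain : K.Edge → List H.Edge}

theorem reverse (hC : IsContraction H good K vert chain) :
    IsContraction H.reverse good K.reverse vert (fun e => (chain e).reverse) where
  vert_inj := hC.vert_inj
  vert_range x := isNonvanishing_reverse.trans (hC.vert_range x)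
  chain_linked e := linked_reverse.2 (hC.chain_linked e)
  chain_good e f hf := hC.chain_good e f (List.mem_reverse.1 hf)
  chain_head e := by
    simp only [List.head?_reverse]
    exact hC.chain_last e
  chain_last e := by
    simp only [List.getLast?_reverse]
    exact hC.chain_head e
  chain_inner e := innerVanishing_reverse (hC.chain_linked e) (hC.chain_inner e)
  chain_inj e f h := hC.chain_inj (List.reverse_injective h)
  chain_surj p hl hg hh ht hi := by
    simp only [isNonvanishing_reverse] at hh ht
    obtain ⟨e, he⟩ := hC.chain_surj p.reverse (linked_reverse.2 hl)
      (fun f hf => hg f (List.mem_reverse.1 hf)) (by simpa using ht) (by simpa using hh)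
      (innerVanishing_reverse hl hi)
    exact ⟨e, by simp [he]⟩

variable (hC : IsContraction H good K vert chain)
include hC

theorem isNonvanishing_vert (x : K.Vert) : H.IsNonvanishing good (vert x) :=
  (hC.vert_range _).2 ⟨x, rfl⟩

theorem chain_eq_cons (e : K.Edge) : ∃ f p, chain e = f :: p ∧ H.src f = vert (K.src e) := by
  obtain ⟨f, hf, h⟩ := hC.chain_head e
  obtain ⟨p, hp⟩ := List.head?_eq_some_iff.1 hf
  exact ⟨f, p, hp, h⟩

theorem chain_ne_nil (e : K.Edge) : chain e ≠ [] := by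
  obtain ⟨f, p, h, -⟩ := hC.chain_eq_cons e
  simp [h]

/-- Inside a chain the vertices are vanishing, so each next good edge is forced and two chains with
a common first edge are comparable. The longer one cannot run through the non-vanishing end of the
shorter. -/
theorem eq_of_head {e e' : K.Edge} {f : H.Edge} {p p' : List H.Edge} (he : chain e = f :: p)
    (he' : chain e' = f :: p') : e = e' := by
  have key : ∀ {e e' : K.Edge} {f : H.Edge} {p p' : List H.Edge}, chain e = f :: p →
      chain e' = f :: p' → p.length ≤ p'.length → e = e' := by
    intro e e' f p p' he he' hle
    have hl := hC.chain_linked e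
    have hi := hC.chain_inner e
    have hg := hC.chain_good e
    have hl' := hC.chain_linked e'
    have hg' := hC.chain_good e'
    rw [he] at hl hi hg
    rw [he'] at hl' hg'
    obtain ⟨c, rfl⟩ := hl.prefix_of_length_le (good := good) hl'
      (fun x hx y hy hxy => eq_of_not_isNonvanishing (hi.of_mem_tail hl hx)
        (hg x (by simp [hx])) hy hxy) (fun y hy => hg' y (by simp [hy])) hle
    cases c with
    | nil => exact hC.chain_inj (by rw [he, he', List.append_nil])
    | cons c cs =>
      exfalso
      obtain ⟨g, hg, h⟩ := hC.chain_last e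
      obtain ⟨r, hr⟩ := List.getLast?_eq_some_iff.1 hg
      refine hC.chain_inner e' r g c cs ?_ (h ▸ hC.isNonvanishing_vert _)
      rw [he', ← List.cons_append, ← he, hr]
      simp
  rcases le_total p.length p'.length with h | h
  · exact key he he' h
  · exact (key he' he h).symm

/-- The chains form a code that can be read from the left: the next edge of the expanded path
determines the whole next chain. -/
theorem flatMap_chain_injective : Function.Injective (List.flatMap chain) := by
  intro p
  induction p with
  | nil =>
    rintro (_ | ⟨e, q⟩) h
    · rfl
    · simp [hC.chain_ne_nil] at h
  | cons e p ih =>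
    rintro (_ | ⟨e', q⟩) h
    · simp [hC.chain_ne_nil] at h
    · rw [List.flatMap_cons, List.flatMap_cons] at h
      obtain ⟨f, r, hf, -⟩ := hC.chain_eq_cons e
      obtain ⟨f', r', hf', -⟩ := hC.chain_eq_cons e'
      have : f = f' := by
        rw [hf, hf', List.cons_append, List.cons_append, List.cons.injEq] at h
        exact h.1
      subst this
      obtain rfl := hC.eq_of_head hf hf'
      rw [ih (List.append_cancel_left h)]

theorem head_expand {p : List K.Edge} {e : K.Edge} (h : p.head? = some e) :
    ∃ f ∈ (p.flatMap chain).head?, H.src f = vert (K.src e) := by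
  obtain ⟨p, rfl⟩ := List.head?_eq_some_iff.1 h
  obtain ⟨f, r, hf, hs⟩ := hC.chain_eq_cons e
  exact ⟨f, by simp [hf], hs⟩

theorem last_expand {p : List K.Edge} {e : K.Edge} (h : p.getLast? = some e) :
    ∃ f ∈ (p.flatMap chain).getLast?, H.tgt f = vert (K.tgt e) := by
  obtain ⟨p, rfl⟩ := List.getLast?_eq_some_iff.1 h
  obtain ⟨f, hf, hs⟩ := hC.chain_last e
  refine ⟨f, ?_, hs⟩
  rw [List.flatMap_append, List.flatMap_singleton,
    List.getLast?_append_of_ne_nil _ (hC.chain_ne_nil e)]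
  exact hf

theorem linked_expand {p : List K.Edge} (hp : K.Linked p) : H.Linked (p.flatMap chain) := by
  induction p with
  | nil => simp [Linked]
  | cons e p ih =>
    rw [List.flatMap_cons]
    refine List.isChain_append.2 ⟨hC.chain_linked e, ih hp.tail, fun f hf g hg => ?_⟩
    cases p with
    | nil => simp at hg
    | cons e' p =>
      obtain ⟨f', hf', h1⟩ := hC.chain_last e
      obtain ⟨g', hg', h2⟩ := hC.head_expand (p := e' :: p) rfl
      obtain rfl := Option.mem_unique hf hf'
      obtain rfl := Option.mem_unique hg hg'
      rw [h1, h2, (List.isChain_cons_cons.1 hp).1]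

theorem good_expand {p : List K.Edge} : ∀ f ∈ p.flatMap chain, good f := by
  intro f hf
  obtain ⟨e, -, he⟩ := List.mem_flatMap.1 hf
  exact hC.chain_good e f he

/-- A good path between non-vanishing vertices comes from a path of the contraction. -/
theorem exists_expand_eq {q : List H.Edge} {x y : K.Vert} (hl : H.Linked q)
    (hg : ∀ f ∈ q, good f) (hh : ∃ f ∈ q.head?, H.src f = vert x)
    (ht : ∃ f ∈ q.getLast?, H.tgt f = vert y) :
    ∃ p, K.Linked p ∧ p.flatMap chain = q ∧ (∃ e ∈ p.head?, K.src e = x) ∧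
      ∃ e ∈ p.getLast?, K.tgt e = y := by
  induction hn : q.length using Nat.strong_induction_on generalizing q x with
  | _ n ih =>
    obtain ⟨f, hf, hfx⟩ := hh
    obtain ⟨r, rfl⟩ := List.head?_eq_some_iff.1 hf
    obtain ⟨g, hgm, hgy⟩ := ht
    -- The path is cut at the first non-vanishing vertex after its start; the initial piece is a
    -- chain, and the shorter remainder is handled by induction.
    obtain ⟨p, q, hpq, hpi, hph, g', hg', hgn⟩ := exists_prefix_innerVanishing (good := good)
      (e := f) (r := r) ⟨g, hgm, hgy ▸ hC.isNonvanishing_vert y⟩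
    rw [hpq] at hl hg
    obtain ⟨e, rfl⟩ := hC.chain_surj p hl.left (fun h hh => hg h (by simp [hh]))
      ⟨f, hph, hfx ▸ hC.isNonvanishing_vert x⟩ ⟨g', hg', hgn⟩ hpi
    have hex : K.src e = x := by
      obtain ⟨f', hf', h1⟩ := hC.chain_head e
      obtain rfl := Option.mem_unique hph hf'
      exact hC.vert_inj (h1.symm.trans hfx)
    obtain ⟨g'', hg'', h2⟩ := hC.chain_last e
    obtain rfl := Option.mem_unique hg' hg''
    by_cases hq : q = []
    · subst hq
      rw [hpq, List.append_nil] at hgm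
      obtain rfl := Option.mem_unique hg' hgm
      refine ⟨[e], by simp [Linked], by simp [hpq], ⟨e, rfl, hex⟩, e, rfl, ?_⟩
      exact hC.vert_inj (h2.symm.trans hgy)
    · obtain ⟨p', hp', hpq', ⟨e', he', hs⟩, ht⟩ := ih q.length (by
          rw [← hn, hpq, List.length_append]
          have := List.length_pos_iff.2 (hC.chain_ne_nil e)
          omega) (q := q) (x := K.tgt e) hl.right (fun h hh => hg h (by simp [hh]))
        (by
          obtain ⟨c, cs, rfl⟩ := List.exists_cons_of_ne_nil hq
          refine ⟨c, rfl, ?_⟩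
          rw [← h2]
          exact ((List.isChain_append.1 hl).2.2 _ hg' c rfl).symm)
        ⟨g, by rwa [hpq, List.getLast?_append_of_ne_nil _ hq] at hgm, hgy⟩ rfl
      obtain ⟨p', rfl⟩ := List.head?_eq_some_iff.1 he'
      refine ⟨e :: e' :: p', List.isChain_cons_cons.2 ⟨hs.symm, hp'⟩, ?_, ⟨e, rfl, hex⟩, ?_⟩
      · rw [List.flatMap_cons, hpq', hpq]
      · simpa using ht

/-- A chain corresponds to its first edge. Every good edge leaving a non-vanishing vertex is such a
first edge, because by `hsucc` it can be continued along good edges to a non-vanishing vertex. -/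
theorem encard_src (hsucc : ∀ e, good e → ∃ p, H.Linked (e :: p) ∧ (∀ f ∈ p, good f) ∧
      ∃ f ∈ (e :: p).getLast?, H.IsNonvanishing good (H.tgt f)) (x : K.Vert) :
    {e | K.src e = x}.encard = {f | good f ∧ H.src f = vert x}.encard := by
  let hd : K.Edge → H.Edge := fun e => (chain e).head (hC.chain_ne_nil e)
  have hhd : ∀ e, ∃ p, chain e = hd e :: p := fun e => ⟨(chain e).tail, by simp [hd]⟩
  have hinj : Set.InjOn hd {e | K.src e = x} := by
    intro e _ e' _ h
    obtain ⟨p, hp⟩ := hhd e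
    obtain ⟨p', hp'⟩ := hhd e'
    rw [← h] at hp'
    exact hC.eq_of_head hp hp'
  rw [← hinj.encard_image]
  congr 1
  ext f
  constructor
  · rintro ⟨e, rfl, rfl⟩
    obtain ⟨p, hp⟩ := hhd e
    obtain ⟨f, p', hp', hs⟩ := hC.chain_eq_cons e
    obtain ⟨rfl, -⟩ := List.cons.inj (hp.symm.trans hp')
    exact ⟨hC.chain_good e _ (by rw [hp]; simp), hs⟩
  · rintro ⟨hf, hs⟩
    obtain ⟨r, hl, hg, g, hgm, hgn⟩ := hsucc f hf
    obtain ⟨y, hy⟩ := (hC.vert_range _).1 hgn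
    obtain ⟨p, hp, hpe, ⟨e, he, hex⟩, -⟩ := hC.exists_expand_eq (x := x) hl
      (by simpa using ⟨hf, hg⟩) ⟨f, rfl, hs⟩ ⟨g, hgm, hy.symm⟩
    refine ⟨e, hex, ?_⟩
    obtain ⟨p, rfl⟩ := List.head?_eq_some_iff.1 he
    obtain ⟨q, hq⟩ := hhd e
    rw [List.flatMap_cons, hq, List.cons_append, List.cons.injEq] at hpe
    exact hpe.1

end IsContraction

/-! ### Natural extensions. -/

section RightExtension

variable {K : MultiDigraph.{u}}

theorem isRightExtension_singleton {e : K.Edge} (he : K.IsDistributing (K.tgt e)) :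
    K.IsRightExtension [e] [e] := by
  refine ⟨⟨⟨by simp, by simp⟩, List.prefix_rfl, by simpa using he⟩, fun q hq _ _ => ?_⟩
  simpa [Nat.one_le_iff_ne_zero] using hq.1

theorem IsRightExtension.eq_singleton {e : K.Edge} {p : List K.Edge}
    (h : K.IsRightExtension [e] p) (he : K.IsDistributing (K.tgt e)) : p = [e] := by
  obtain ⟨⟨⟨hne, hl⟩, ⟨r, rfl⟩, hend⟩, hmin⟩ := h
  have := hmin [e] ⟨by simp, by simp⟩ List.prefix_rfl (by simpa using he)
  cases r with
  | nil => rfl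
  | cons f r => simp at this

theorem IsRightExtension.exists_cons {e : K.Edge} {p : List K.Edge}
    (h : K.IsRightExtension [e] p) (he : ¬ K.IsDistributing (K.tgt e)) :
    ∃ f r, K.tgt e = K.src f ∧ p = e :: r ∧ K.IsRightExtension [f] r := by
  obtain ⟨⟨⟨hne, hl⟩, ⟨r, rfl⟩, hend⟩, hmin⟩ := h
  cases r with
  | nil => exact absurd (by simpa using hend) he
  | cons f r =>
    obtain ⟨hef, hl⟩ := List.isChain_cons_cons.1 hl
    refine ⟨f, f :: r, hef, rfl, ⟨⟨by simp, hl⟩, ⟨r, rfl⟩, by simpa using hend⟩, ?_⟩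
    rintro q ⟨-, hq⟩ ⟨s, rfl⟩ hqe
    have := hmin (e :: f :: s) ⟨by simp, List.isChain_cons_cons.2 ⟨hef, hq⟩⟩ ⟨f :: s, rfl⟩
      (by simpa using hqe)
    simpa using this

theorem IsRightExtension.cons (htype : ∀ x, K.IsDistributing x ∨ K.IsCollecting x)
    {e f : K.Edge} {p : List K.Edge} (h : K.IsRightExtension [f] p)
    (he : ¬ K.IsDistributing (K.tgt e)) (hef : K.tgt e = K.src f) :
    K.IsRightExtension [e] (e :: p) := by
  obtain ⟨⟨⟨hne, hl⟩, ⟨r, rfl⟩, hend⟩, hmin⟩ := h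
  refine ⟨⟨⟨by simp, List.isChain_cons_cons.2 ⟨hef, hl⟩⟩, ⟨f :: r, rfl⟩, by simpa using hend⟩, ?_⟩
  rintro q ⟨-, hq⟩ ⟨s, rfl⟩ hqe
  cases s with
  | nil => exact absurd (by simpa using hqe) he
  | cons g s =>
    obtain ⟨heg, hl'⟩ := List.isChain_cons_cons.1 hq
    obtain rfl : g = f := ((hef ▸ (htype (K.tgt e)).resolve_left he :
      K.IsCollecting (K.src f))).eq_of_src (heg.symm.trans hef)
    have := hmin (g :: s) ⟨by simp, hl'⟩ ⟨s, rfl⟩ (by simpa using hqe)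
    simpa using this

/-- Up to the first distributing vertex every vertex on the way is collecting and has only one exit,
so the extension has no choice. -/
theorem IsRightExtension.unique (htype : ∀ x, K.IsDistributing x ∨ K.IsCollecting x)
    {e : K.Edge} {p q : List K.Edge} (hp : K.IsRightExtension [e] p)
    (hq : K.IsRightExtension [e] q) : p = q := by
  induction p generalizing e q with
  | nil => exact absurd rfl hp.1.1.1
  | cons x p ih =>
    by_cases he : K.IsDistributing (K.tgt e)
    · rw [hp.eq_singleton he, hq.eq_singleton he]
    · obtain ⟨f, r, hf, h1, hr⟩ := hp.exists_cons he
      obtain ⟨g, s, hg, h2, hs⟩ := hq.exists_cons he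
      obtain rfl : g = f := ((hf ▸ (htype (K.tgt e)).resolve_left he :
        K.IsCollecting (K.src f))).eq_of_src (hg.symm.trans hf)
      obtain ⟨rfl, rfl⟩ := List.cons.inj h1
      rw [h2, ih hr hs]

theorem exists_isRightExtension (htype : ∀ x, K.IsDistributing x ∨ K.IsCollecting x)
    {e : K.Edge} {r : List K.Edge} (hl : K.Linked (e :: r)) (hend : K.EndsDistributing (e :: r)) :
    ∃ p, K.IsRightExtension [e] p := by
  induction r generalizing e with
  | nil => exact ⟨[e], isRightExtension_singleton (by simpa using hend)⟩
  | cons f r ih =>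
    by_cases he : K.IsDistributing (K.tgt e)
    · exact ⟨[e], isRightExtension_singleton he⟩
    · obtain ⟨hef, hl⟩ := List.isChain_cons_cons.1 hl
      obtain ⟨p, hp⟩ := ih hl (by simpa using hend)
      exact ⟨e :: p, hp.cons htype he hef⟩

end RightExtension

end MultiDigraph

end RauzyEvolution

/-! ### Contraction of a pruned graph: existence of both vertex types and natural extensions. -/

namespace RauzyEvolution

namespace WordGraph

open MultiDigraph

variable {α : Type w}

/-- The properties of the graph `S'` and its good edges that are used in the contraction. The words
of `L` play the role of the subwords of the infinite word. -/
structure IsPruned (H : WordGraph.{u, w} α) (good : H.Edge → Prop) (L : Set (List α)) : Prop where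
  finite_vert : Finite H.Vert
  finite_edge : Finite H.Edge
  vert_type : ∀ x, H.IsDistributing x ∨ H.IsCollecting x
  incident : ∀ x, ∃ e, good e ∧ (H.src e = x ∨ H.tgt e = x)
  reach : ∀ e f, good e → good f → ∃ a m b, H.IsSymmetricPath (a ++ e :: m ++ f :: b) ∧
    (∀ g ∈ a ++ e :: m ++ f :: b, good g) ∧ H.frontWord (a ++ e :: m ++ f :: b) ∈ L
  front_eq_back : ∀ p, H.IsSymmetricPath p → H.frontWord p = H.backWord p
  front_ne_nil : ∀ e, H.IsDistributing (H.src e) → H.front e ≠ []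
  front_head_inj : ∀ e f, H.IsDistributing (H.src e) → H.src e = H.src f →
    (H.front e).head? = (H.front f).head? → e = f
  back_ne_nil : ∀ e, H.IsCollecting (H.tgt e) → H.back e ≠ []
  back_last_inj : ∀ e f, H.IsCollecting (H.tgt e) → H.tgt e = H.tgt f →
    (H.back e).getLast? = (H.back f).getLast? → e = f
  exists_nonvanishing : ∃ x, H.IsNonvanishing good x
  infix_mem : ∀ u t, u <:+: t → t ∈ L → u ∈ L

namespace IsPruned

variable {H : WordGraph.{u, w} α} {good : H.Edge → Prop} {L : Set (List α)}

/-- The hypotheses are self-dual, so each statement about distributing vertices has its mirror image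
for free. Reversed subwords of `W` need not be subwords of `W`, which is why `L` is only required to
be closed under factors. -/
theorem reverse (hP : IsPruned H good L) :
    IsPruned H.reverse good {u | u.reverse ∈ L} where
  finite_vert := hP.finite_vert
  finite_edge := hP.finite_edge
  vert_type x := by
    rw [isDistributing_reverse, isCollecting_reverse]
    exact (hP.vert_type x).symm
  incident x := by
    obtain ⟨e, he, h⟩ := hP.incident x
    exact ⟨e, he, h.symm⟩
  reach e f he hf := by
    obtain ⟨a, m, b, hs, hg, hw⟩ := hP.reach f e hf he
    have heq : b.reverse ++ e :: m.reverse ++ f :: a.reverse =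
      (a ++ f :: m ++ e :: b).reverse := by simp
    refine ⟨b.reverse, m.reverse, a.reverse, ?_⟩
    rw [heq]
    refine ⟨isSymmetricPath_reverse.2 hs, fun g h => hg g (List.mem_reverse.1 h), ?_⟩
    change (H.reverse.frontWord _).reverse ∈ L
    rw [frontWord_reverse, List.reverse_reverse, ← hP.front_eq_back _ hs]
    exact hw
  front_eq_back p hp := by
    obtain ⟨p, rfl⟩ : ∃ q : List H.Edge, p = q.reverse := ⟨p.reverse, by simp⟩
    rw [frontWord_reverse, backWord_reverse, hP.front_eq_back _ (isSymmetricPath_reverse.1 hp)]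
  front_ne_nil e he := by
    simpa using hP.back_ne_nil e (isDistributing_reverse.1 he)
  front_head_inj e f he hef h := by
    rw [List.head?_reverse, List.head?_reverse] at h
    exact hP.back_last_inj e f (isDistributing_reverse.1 he) hef h
  back_ne_nil e he := by
    simpa using hP.front_ne_nil e (isCollecting_reverse.1 he)
  back_last_inj e f he hef h := by
    rw [List.getLast?_reverse, List.getLast?_reverse] at h
    exact hP.front_head_inj e f (isCollecting_reverse.1 he) hef h
  exists_nonvanishing := by
    obtain ⟨x, hx⟩ := hP.exists_nonvanishing
    exact ⟨x, isNonvanishing_reverse.2 hx⟩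
  infix_mem u t hu ht := hP.infix_mem _ _ (List.reverse_infix.2 hu) ht

theorem exists_good_src (hP : IsPruned H good L) (x : H.Vert) : ∃ e, good e ∧ H.src e = x := by
  obtain ⟨e, he, rfl | rfl⟩ := hP.incident x
  · exact ⟨e, he, rfl⟩
  · obtain ⟨a, m, b, hs, hg, -⟩ := hP.reach e e he he
    have hl := hs.linked
    obtain ⟨f, r, hr⟩ := List.exists_cons_of_ne_nil (l := m ++ e :: b) (by simp)
    have heq : a ++ e :: m ++ e :: b = a ++ e :: f :: r := by
      rw [← hr]
      simp
    rw [heq] at hl hg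
    exact ⟨f, hg f (by simp), hl.tgt_eq_src.symm⟩

theorem exists_good_tgt (hP : IsPruned H good L) (x : H.Vert) : ∃ e, good e ∧ H.tgt e = x :=
  hP.reverse.exists_good_src x

theorem eq_of_not_isNonvanishing_and_isDistributing (hP : IsPruned H good L) {e f : H.Edge} (he : good e)
    (hf : good f) (h : ¬ (H.IsNonvanishing good (H.src e) ∧ H.IsDistributing (H.src e)))
    (hef : H.src f = H.src e) : f = e := by
  by_cases hd : H.IsDistributing (H.src e)
  · exact eq_of_not_isNonvanishing (fun hn => h ⟨hn, hd⟩) he hf hef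
  · exact ((hP.vert_type _).resolve_left hd).eq_of_src hef

/-- Otherwise every vertex has exactly one outgoing good edge, so there are as many good edges as
vertices. Every vertex also has an incoming good edge, and a surjection between finite sets of equal
size is injective. So no vertex has two good edges on either side, and none is non-vanishing. -/
theorem exists_distributing (hP : IsPruned H good L) :
    ∃ x, H.IsNonvanishing good x ∧ H.IsDistributing x := by
  by_contra hcon
  have := hP.finite_vert
  have := hP.finite_edge
  let s : {e // good e} → H.Vert := fun e => H.src e.1
  let t : {e // good e} → H.Vert := fun e => H.tgt e.1
  have hs : Function.Bijective s := by
    refine ⟨fun e f hef => Subtype.ext ?_, fun x => ?_⟩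
    · exact hP.eq_of_not_isNonvanishing_and_isDistributing f.2 e.2 (fun h => hcon ⟨_, h⟩) hef
    · obtain ⟨e, he, rfl⟩ := hP.exists_good_src x
      exact ⟨⟨e, he⟩, rfl⟩
  have ht : Function.Surjective t := by
    intro x
    obtain ⟨e, he, rfl⟩ := hP.exists_good_tgt x
    exact ⟨⟨e, he⟩, rfl⟩
  have ht' : Function.Injective t :=
    (ht.bijective_of_nat_card_le (Nat.card_eq_of_bijective s hs).le).1
  obtain ⟨x, hx⟩ := hP.exists_nonvanishing
  rcases hx with hx | hx
  · obtain ⟨e, f, he, hf, hne⟩ := Set.one_lt_encard_iff.1 hx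
    exact hne (congrArg Subtype.val (@hs.1 ⟨e, he.1⟩ ⟨f, hf.1⟩ (he.2.trans hf.2.symm)))
  · obtain ⟨e, f, he, hf, hne⟩ := Set.one_lt_encard_iff.1 hx
    exact hne (congrArg Subtype.val (@ht' ⟨e, he.1⟩ ⟨f, hf.1⟩ (he.2.trans hf.2.symm)))

theorem exists_collecting (hP : IsPruned H good L) :
    ∃ x, H.IsNonvanishing good x ∧ H.IsCollecting x := by
  obtain ⟨x, hx, hd⟩ := hP.reverse.exists_distributing
  exact ⟨x, isNonvanishing_reverse.1 hx, isDistributing_reverse.1 hd⟩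

theorem exists_linked (hP : IsPruned H good L) {e f : H.Edge} (he : good e) (hf : good f) :
    ∃ m, H.Linked (e :: m ++ [f]) ∧ ∀ g ∈ e :: m ++ [f], good g := by
  obtain ⟨a, m, b, hs, hg, -⟩ := hP.reach e f he hf
  have hl := hs.linked
  have heq : a ++ e :: m ++ f :: b = a ++ (e :: m ++ [f]) ++ b := by simp
  rw [heq] at hl hg
  exact ⟨m, hl.left.right, fun g h => hg g (List.mem_append_left _ (List.mem_append_right _ h))⟩

section Contraction

variable {K : MultiDigraph.{u}} {vert : K.Vert → H.Vert} {chain : K.Edge → List H.Edge}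

theorem encard_src (hP : IsPruned H good L)
    (hC : IsContraction H.toMultiDigraph good K vert chain) (x : K.Vert) :
    {e | K.src e = x}.encard = {f | good f ∧ H.src f = vert x}.encard := by
  refine hC.encard_src (fun e he => ?_) x
  obtain ⟨y, hy, -⟩ := hP.exists_distributing
  obtain ⟨f, hf, rfl⟩ := hP.exists_good_tgt y
  obtain ⟨m, hl, hg⟩ := hP.exists_linked he hf
  exact ⟨m ++ [f], hl, fun g h => hg g (List.mem_cons_of_mem _ h), f,
    by rw [← List.cons_append]; exact List.getLast?_concat, hy⟩

theorem encard_tgt (hP : IsPruned H good L)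
    (hC : IsContraction H.toMultiDigraph good K vert chain) (x : K.Vert) :
    {e | K.tgt e = x}.encard = {f | good f ∧ H.tgt f = vert x}.encard :=
  hP.reverse.encard_src hC.reverse x

/-- Good degrees of the original graph are the degrees of the contraction. The in-degree stays one,
and then a non-vanishing vertex must have more than one good exit. -/
theorem isDistributing_of (hP : IsPruned H good L)
    (hC : IsContraction H.toMultiDigraph good K vert chain) {x : K.Vert}
    (h : H.IsDistributing (vert x)) : K.IsDistributing x := by
  have hle : {f | good f ∧ H.tgt f = vert x}.encard ≤ 1 := by
    rw [← h.1]
    exact Set.encard_le_encard fun f hf => hf.2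
  rw [IsDistributing, hP.encard_src hC, hP.encard_tgt hC]
  refine ⟨le_antisymm hle ?_, ?_⟩
  · obtain ⟨e, he⟩ := hP.exists_good_tgt (vert x)
    exact Set.one_le_encard_iff_nonempty.2 ⟨e, he⟩
  · exact (hC.isNonvanishing_vert x).resolve_right (not_lt_of_ge hle)

theorem isCollecting_of (hP : IsPruned H good L)
    (hC : IsContraction H.toMultiDigraph good K vert chain) {x : K.Vert}
    (h : H.IsCollecting (vert x)) : K.IsCollecting x :=
  isDistributing_reverse.1
    (hP.reverse.isDistributing_of hC.reverse (x := x) (isDistributing_reverse.2 h))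

theorem isDistributing_iff (hP : IsPruned H good L)
    (hC : IsContraction H.toMultiDigraph good K vert chain) {x : K.Vert} :
    K.IsDistributing x ↔ H.IsDistributing (vert x) := by
  refine ⟨fun h => ?_, hP.isDistributing_of hC⟩
  by_contra hn
  exact h.not_isCollecting (hP.isCollecting_of hC ((hP.vert_type _).resolve_left hn))

theorem isCollecting_iff (hP : IsPruned H good L)
    (hC : IsContraction H.toMultiDigraph good K vert chain) {x : K.Vert} :
    K.IsCollecting x ↔ H.IsCollecting (vert x) := by
  refine ⟨fun h => ?_, hP.isCollecting_of hC⟩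
  by_contra hn
  exact h.not_isDistributing (hP.isDistributing_of hC ((hP.vert_type _).resolve_right hn))

theorem contraction_vert_type (hP : IsPruned H good L)
    (hC : IsContraction H.toMultiDigraph good K vert chain) (x : K.Vert) :
    K.IsDistributing x ∨ K.IsCollecting x :=
  (hP.vert_type (vert x)).imp (hP.isDistributing_of hC) (hP.isCollecting_of hC)

theorem endsDistributing_expand (hP : IsPruned H good L)
    (hC : IsContraction H.toMultiDigraph good K vert chain) {p : List K.Edge} :
    H.EndsDistributing (p.flatMap chain) ↔ K.EndsDistributing p := by
  rcases List.eq_nil_or_concat' p with rfl | ⟨p, e, rfl⟩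
  · simp
  · obtain ⟨f, hf, h⟩ := hC.last_expand (p := p ++ [e]) (e := e) (by simp)
    rw [endsDistributing_concat, hP.isDistributing_iff hC, ← h]
    refine ⟨?_, fun h' => ⟨f, hf, h'⟩⟩
    rintro ⟨f', hf', h'⟩
    rwa [Option.mem_unique hf hf']

theorem startsCollecting_expand (hP : IsPruned H good L)
    (hC : IsContraction H.toMultiDigraph good K vert chain) {p : List K.Edge} :
    H.StartsCollecting (p.flatMap chain) ↔ K.StartsCollecting p := by
  rcases p with _ | ⟨e, p⟩
  · simp
  · obtain ⟨f, hf, h⟩ := hC.head_expand (p := e :: p) (e := e) rfl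
    rw [startsCollecting_cons, hP.isCollecting_iff hC, ← h]
    refine ⟨?_, fun h' => ⟨f, hf, h'⟩⟩
    rintro ⟨f', hf', h'⟩
    rwa [Option.mem_unique hf hf']

theorem isSymmetricPath_expand (hP : IsPruned H good L)
    (hC : IsContraction H.toMultiDigraph good K vert chain) {p : List K.Edge}
    (hp : K.IsSymmetricPath p) : H.IsSymmetricPath (p.flatMap chain) :=
  isSymmetricPath_iff.2 ⟨hC.linked_expand hp.linked, (hP.startsCollecting_expand hC).2 hp.2.1,
    (hP.endsDistributing_expand hC).2 hp.2.2⟩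

/-- The chain of the edge can be continued along good edges to a non-vanishing distributing vertex,
and the resulting path comes from the contraction. It starts with the given edge because the first
edge determines the chain. -/
theorem exists_rightExtension (hP : IsPruned H good L)
    (hC : IsContraction H.toMultiDigraph good K vert chain) (e : K.Edge) :
    ∃ p, K.IsRightExtension [e] p := by
  obtain ⟨y, hy, hyd⟩ := hP.exists_distributing
  obtain ⟨f, hf, rfl⟩ := hP.exists_good_tgt y
  obtain ⟨y, hy⟩ := (hC.vert_range _).1 hy
  obtain ⟨h, r, hh, hs⟩ := hC.chain_eq_cons e
  obtain ⟨m, hl, hg⟩ := hP.exists_linked (hC.chain_good e h (by simp [hh])) hf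
  obtain ⟨p, hp, hpe, ⟨e', he', -⟩, g, hgm, hgy⟩ := hC.exists_expand_eq hl hg ⟨h, rfl, hs⟩
    ⟨f, List.getLast?_concat, hy.symm⟩
  obtain ⟨p, rfl⟩ := List.head?_eq_some_iff.1 he'
  obtain ⟨h', r', hh', -⟩ := hC.chain_eq_cons e'
  obtain rfl : e = e' := by
    rw [List.flatMap_cons, hh', List.cons_append, List.cons_append, List.cons.injEq] at hpe
    obtain ⟨rfl, -⟩ := hpe
    exact hC.eq_of_head hh hh'
  refine exists_isRightExtension (hP.contraction_vert_type hC) hp ⟨g, hgm, ?_⟩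
  rw [hgy, hP.isDistributing_iff hC, hy]
  exact hyd

theorem existsUnique_rightExtension (hP : IsPruned H good L)
    (hC : IsContraction H.toMultiDigraph good K vert chain) (e : K.Edge) :
    ∃! p, K.IsRightExtension [e] p := by
  obtain ⟨p, hp⟩ := hP.exists_rightExtension hC e
  exact ⟨p, hp, fun q hq => hq.unique (hP.contraction_vert_type hC) hp⟩

theorem existsUnique_leftExtension (hP : IsPruned H good L)
    (hC : IsContraction H.toMultiDigraph good K vert chain) (e : K.Edge) :
    ∃! p, K.IsLeftExtension [e] p := by
  obtain ⟨p, hp, hu⟩ := hP.reverse.existsUnique_rightExtension hC.reverse e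
  refine ⟨p.reverse, ?_, fun q hq => ?_⟩
  · change K.IsLeftExtension [e] p.reverse
    rw [← isRightExtension_reverse, List.reverse_reverse]
    exact hp
  · replace hq := isRightExtension_reverse.2 hq
    rw [← hu _ hq, List.reverse_reverse]

/-- Past its first edge, the expansion of a natural extension to the right is determined. -/
theorem not_isNonvanishing_of_rightExtension (hP : IsPruned H good L)
    (hC : IsContraction H.toMultiDigraph good K vert chain) {e : K.Edge} {p : List K.Edge}
    (hp : K.IsRightExtension [e] p) {h : H.Edge} {r : List H.Edge}
    (hr : p.flatMap chain = h :: r) : ∀ f ∈ r,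
      ¬ (H.IsNonvanishing good (H.src f) ∧ H.IsDistributing (H.src f)) := by
  induction p generalizing e h r with
  | nil => exact absurd rfl hp.1.1.1
  | cons x p ih =>
    have hchain : ∀ (e : K.Edge) (f g : H.Edge) s, chain e = g :: s → f ∈ s →
        ¬ (H.IsNonvanishing good (H.src f) ∧ H.IsDistributing (H.src f)) := by
      intro e f g s hs hf hn
      have hi := hC.chain_inner e
      have hl := hC.chain_linked e
      rw [hs] at hi hl
      exact hi.of_mem_tail hl hf hn.1
    intro f hf
    obtain ⟨g, s, hs, -⟩ := hC.chain_eq_cons e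
    by_cases he : K.IsDistributing (K.tgt e)
    · rw [hp.eq_singleton he, List.flatMap_singleton, hs] at hr
      obtain ⟨rfl, rfl⟩ := List.cons.inj hr
      exact hchain e f _ _ hs hf
    · obtain ⟨e', q, hee', h1, hq⟩ := hp.exists_cons he
      obtain ⟨rfl, rfl⟩ := List.cons.inj h1
      rw [List.flatMap_cons, hs, List.cons_append, List.cons.injEq] at hr
      obtain ⟨rfl, rfl⟩ := hr
      rcases List.mem_append.1 hf with hf | hf
      · exact hchain _ f _ _ hs hf
      · obtain ⟨-, ⟨t, ht⟩, -⟩ := hq.1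
        subst ht
        obtain ⟨g', s', hs', hsrc⟩ := hC.chain_eq_cons e'
        have hexp : ([e'] ++ t).flatMap chain = g' :: (s' ++ t.flatMap chain) := by
          simp [hs']
        rw [hexp] at hf
        rcases List.mem_cons.1 hf with rfl | hf
        · rintro ⟨-, hd⟩
          rw [hsrc, ← hP.isDistributing_iff hC, ← hee'] at hd
          exact he hd
        · exact ih hq hexp f hf

end Contraction

end IsPruned

/-! ### Words in the contraction and the Rauzy properties. -/

/-- `K` is the contraction of `H` along good edges, as a graph with words. -/
structure IsWordContraction (H : WordGraph.{u, w} α) (good : H.Edge → Prop)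
    (K : WordGraph.{u, w} α) (vert : K.Vert → H.Vert) (chain : K.Edge → List H.Edge) : Prop extends
    IsContraction H.toMultiDigraph good K.toMultiDigraph vert chain where
  front_eq : ∀ e p, K.IsRightExtension [e] p → K.front e = H.frontWord (p.flatMap chain)
  back_eq : ∀ e p, K.IsLeftExtension [e] p → K.back e = H.backWord (p.flatMap chain)

namespace IsWordContraction

variable {H : WordGraph.{u, w} α} {good : H.Edge → Prop} {L : Set (List α)}
  {K : WordGraph.{u, w} α} {vert : K.Vert → H.Vert} {chain : K.Edge → List H.Edge}

theorem flatMap_reverse_reverse {β γ : Type*} (f : β → List γ) (p : List β) :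
    p.reverse.flatMap (fun e => (f e).reverse) = (p.flatMap f).reverse := by
  induction p with
  | nil => rfl
  | cons e p ih => simp [ih]

theorem reverse (hC : IsWordContraction H good K vert chain) :
    IsWordContraction H.reverse good K.reverse vert (fun e => (chain e).reverse) where
  toIsContraction := hC.toIsContraction.reverse
  front_eq e p hp := by
    obtain ⟨p, rfl⟩ : ∃ q : List K.Edge, p = q.reverse := ⟨p.reverse, by simp⟩
    have hp' : K.IsLeftExtension [e] p := isRightExtension_reverse.1 hp
    rw [flatMap_reverse_reverse, frontWord_reverse, ← hC.back_eq e p hp']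
  back_eq e p hp := by
    obtain ⟨p, rfl⟩ : ∃ q : List K.Edge, p = q.reverse := ⟨p.reverse, by simp⟩
    have hp' : K.IsRightExtension [e] p := by
      have := isRightExtension_reverse.2 hp
      rwa [List.reverse_reverse] at this
    rw [flatMap_reverse_reverse, backWord_reverse, ← hC.front_eq e p hp']

/-- The front word of an edge of `K` reads on to the next distributing vertex, and the next edge
counted in the front word of a path is the one leaving that vertex. So the counted words tile the
expansion without gap or overlap. -/
theorem frontWord_eq_aux (hC : IsWordContraction H good K vert chain) (hP : IsPruned H good L)
    {e : K.Edge} {r : List K.Edge} (hl : K.Linked (e :: r)) (hend : K.EndsDistributing (e :: r)) :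
    K.frontWord (e :: r) = H.frontWord ((e :: r).flatMap chain) := by
  have hC' := hC.toIsContraction
  induction r generalizing e with
  | nil =>
    rw [frontWord_cons, hC.front_eq e [e] (isRightExtension_singleton (by simpa using hend))]
    simp
  | cons f r ih =>
    obtain ⟨hef, hl⟩ := List.isChain_cons_cons.1 hl
    have hend : K.EndsDistributing (f :: r) := by simpa using hend
    have ih := ih hl hend
    obtain ⟨h, s, hs, hsrc⟩ := hC'.chain_eq_cons f
    have hexp : (f :: r).flatMap chain = h :: (s ++ r.flatMap chain) := by simp [hs]
    rw [List.flatMap_cons, frontWord_append (hC'.chain_ne_nil e), frontWord_cons]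
    by_cases he : K.IsDistributing (K.tgt e)
    · have h1 : K.IsDistributing (K.src f) := hef ▸ he
      have h2 : H.IsDistributing (H.src h) := by
        rw [hsrc]
        exact (hP.isDistributing_iff hC').1 h1
      rw [hC.front_eq e [e] (isRightExtension_singleton he), List.flatMap_singleton,
        ← frontWord_eq_innerFront h1, ih, hexp, frontWord_eq_innerFront h2]
    · have h1 : ¬ K.IsDistributing (K.src f) := hef ▸ he
      obtain ⟨p, hp⟩ := hP.exists_rightExtension hC' f
      rw [hC.front_eq e (e :: p) (hp.cons (hP.contraction_vert_type hC') he hef)]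
      rw [frontWord_cons, hC.front_eq f p hp] at ih
      obtain ⟨t, rfl⟩ := hp.1.2.1
      have hexp' : ([f] ++ t).flatMap chain = h :: (s ++ t.flatMap chain) := by simp [hs]
      rw [List.flatMap_cons, frontWord_append (hC'.chain_ne_nil e), innerFront_cons_of_not h1,
        List.append_assoc, hexp, hexp']
      rw [hexp, hexp', frontWord_cons, frontWord_cons, List.append_assoc] at ih
      -- The edge `h` is read differently at the start and inside a path. Cancelling its front word
      -- leaves an identity for what follows, to which the inner contribution of `h` can be added
      -- back.
      have ih := List.append_cancel_left ih
      rw [← List.singleton_append, innerFront_append, List.append_assoc, ih, ← innerFront_append]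
      simp

/-- The front word of a path of the contraction that ends in a distributing vertex. -/
theorem frontWord_eq (hC : IsWordContraction H good K vert chain) (hP : IsPruned H good L)
    {p : List K.Edge} (hl : K.Linked p) (hend : K.EndsDistributing p) :
    K.frontWord p = H.frontWord (p.flatMap chain) := by
  obtain ⟨e, r, rfl⟩ := List.exists_cons_of_ne_nil hend.ne_nil
  exact hC.frontWord_eq_aux hP hl hend

/-- The back word of a path of the contraction that starts in a collecting vertex. -/
theorem backWord_eq (hC : IsWordContraction H good K vert chain) (hP : IsPruned H good L)
    {p : List K.Edge} (hl : K.Linked p) (hstart : K.StartsCollecting p) :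
    K.backWord p = H.backWord (p.flatMap chain) := by
  have := hC.reverse.frontWord_eq hP.reverse (p := p.reverse) (linked_reverse.2 hl)
    (endsDistributing_reverse.2 hstart)
  rw [flatMap_reverse_reverse, frontWord_reverse, frontWord_reverse] at this
  exact List.reverse_injective this

theorem exists_front_eq (hC : IsWordContraction H good K vert chain) (hP : IsPruned H good L)
    (e : K.Edge) : ∃ h s t, chain e = h :: s ∧ H.src h = vert (K.src e) ∧
      K.front e = H.front h ++ t := by
  obtain ⟨p, hp⟩ := hP.exists_rightExtension hC.toIsContraction e
  obtain ⟨h, s, hs, hsrc⟩ := hC.chain_eq_cons e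
  refine ⟨h, s, ?_⟩
  rw [hC.front_eq e p hp]
  obtain ⟨t, rfl⟩ := hp.1.2.1
  refine ⟨H.innerFront (s ++ t.flatMap chain), hs, hsrc, ?_⟩
  rw [← frontWord_cons]
  simp [hs]

theorem front_ne_nil (hC : IsWordContraction H good K vert chain) (hP : IsPruned H good L)
    (e : K.Edge) (he : K.IsDistributing (K.src e)) : K.front e ≠ [] := by
  obtain ⟨h, s, t, -, hsrc, hf⟩ := hC.exists_front_eq hP e
  rw [hP.isDistributing_iff hC.toIsContraction, ← hsrc] at he
  simp [hf, hP.front_ne_nil h he]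

theorem front_head_inj (hC : IsWordContraction H good K vert chain) (hP : IsPruned H good L)
    (e f : K.Edge) (he : K.IsDistributing (K.src e)) (hef : K.src e = K.src f)
    (hh : (K.front e).head? = (K.front f).head?) : e = f := by
  obtain ⟨h, s, t, hs, hsrc, hf⟩ := hC.exists_front_eq hP e
  obtain ⟨h', s', t', hs', hsrc', hf'⟩ := hC.exists_front_eq hP f
  have hef' : H.src h = H.src h' := by rw [hsrc, hsrc', hef]
  rw [hP.isDistributing_iff hC.toIsContraction, ← hsrc] at he
  rw [hf, hf', List.head?_append_of_ne_nil _ (hP.front_ne_nil h he),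
    List.head?_append_of_ne_nil _ (hP.front_ne_nil h' (hef' ▸ he))] at hh
  obtain rfl := hP.front_head_inj h h' he hef' hh
  exact hC.eq_of_head hs hs'

theorem back_ne_nil (hC : IsWordContraction H good K vert chain) (hP : IsPruned H good L)
    (e : K.Edge) (he : K.IsCollecting (K.tgt e)) : K.back e ≠ [] := by
  simpa using hC.reverse.front_ne_nil hP.reverse e (isDistributing_reverse.2 he)

theorem back_last_inj (hC : IsWordContraction H good K vert chain) (hP : IsPruned H good L)
    (e f : K.Edge) (he : K.IsCollecting (K.tgt e)) (hef : K.tgt e = K.tgt f)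
    (hh : (K.back e).getLast? = (K.back f).getLast?) : e = f :=
  hC.reverse.front_head_inj hP.reverse e f (isDistributing_reverse.2 he) hef
    (by rw [List.head?_reverse, List.head?_reverse, hh])

/-- After its first edge x the expanded extension meets no non-vanishing distributing vertex before
its end, so every good path from x must follow it. A good path from x to a non-vanishing
distributing vertex, with word in `L`, thus contains the whole extension. -/
theorem front_mem (hC : IsWordContraction H good K vert chain) (hP : IsPruned H good L)
    (e : K.Edge) : K.front e ∈ L := by
  have hC' := hC.toIsContraction
  obtain ⟨p, hp⟩ := hP.exists_rightExtension hC' e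
  rw [hC.front_eq e p hp]
  obtain ⟨x, r, hexp⟩ := List.exists_cons_of_ne_nil
    ((hP.endsDistributing_expand hC').2 hp.1.2.2).ne_nil
  have hlink := hC'.linked_expand hp.1.1.2
  have hgood := hC'.good_expand (p := p)
  have hend := (hP.endsDistributing_expand hC').2 hp.1.2.2
  have hdet := hP.not_isNonvanishing_of_rightExtension hC' hp hexp
  rw [hexp] at hlink hgood hend ⊢
  obtain ⟨y, hy, hyd⟩ := hP.exists_distributing
  obtain ⟨f, hf, rfl⟩ := hP.exists_good_tgt y
  obtain ⟨a, m, b, hs, hg, hw⟩ := hP.reach x f (hgood x (by simp)) hf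
  have heq : a ++ x :: m ++ f :: b = a ++ x :: (m ++ [f]) ++ b := by simp
  rw [heq] at hs hg hw
  have hlq : H.Linked (x :: (m ++ [f])) := hs.linked.left.right
  have hgq : ∀ g ∈ x :: (m ++ [f]), good g :=
    fun g h => hg g (List.mem_append_left _ (List.mem_append_right _ h))
  have hpre : ∀ r' q' : List H.Edge, H.Linked (x :: r') → H.Linked (x :: q') → (∀ g ∈ r', g ∈ r) →
      (∀ g ∈ q', good g) → r'.length ≤ q'.length → r' <+: q' := by
    intro r' q' h1 h2 h3 h4 hle
    exact h1.prefix_of_length_le h2 (fun g hg g' hg' hgg' => hP.eq_of_not_isNonvanishing_and_isDistributing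
      (hgood g (by simp [h3 g hg])) hg' (hdet g (h3 g hg)) hgg') h4 hle
  -- If `r` were longer than `m ++ [f]`, it would pass on through the non-vanishing distributing
  -- vertex at the end of `f`.
  have hrq : r <+: m ++ [f] := by
    rcases le_or_gt r.length (m ++ [f]).length with hle | hlt
    · exact hpre r _ hlink hlq (fun g h => h) (fun g h => hgq g (by simp [h])) hle
    · exfalso
      have hsplit := List.take_append_drop (m ++ [f]).length r
      set r₁ := r.take (m ++ [f]).length
      set r₂ := r.drop (m ++ [f]).length with hr₂
      have hlen : r₁.length = (m ++ [f]).length := by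
        simp only [r₁, List.length_take]
        omega
      have hlink' := hlink
      rw [← hsplit, ← List.cons_append] at hlink'
      have h1 := (hpre r₁ (m ++ [f]) hlink'.left hlq
        (fun g h => by rw [← hsplit]; simp [h]) (fun g h => hgq g (by simp [h]))
        hlen.le).eq_of_length hlen
      obtain ⟨g, r₂', hr⟩ := List.exists_cons_of_ne_nil (l := r₂) (by
        rw [hr₂, Ne, List.drop_eq_nil_iff]
        omega)
      have h2 : r = m ++ f :: g :: r₂' := by
        rw [← hsplit, h1, hr]
        simp
      have h3 : H.tgt f = H.src g := by
        rw [h2, ← List.cons_append] at hlink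
        exact hlink.tgt_eq_src
      exact hdet g (by rw [h2]; simp) ⟨h3 ▸ hy, h3 ▸ hyd⟩
  obtain ⟨c, hc⟩ := hrq
  rw [← hc] at hs hw
  have heq' : a ++ x :: (r ++ c) ++ b = a ++ (x :: r) ++ (c ++ b) := by simp
  rw [heq'] at hs hw
  refine hP.infix_mem _ _ ?_ hw
  -- If x leaves a distributing vertex, its front word is read also inside a path. If x leaves a
  -- collecting vertex, `x :: r` is symmetric and its word is a factor by property 3.
  rcases hP.vert_type (H.src x) with hx | hx
  · cases a with
    | nil =>
      rw [List.nil_append, frontWord_append (by simp)]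
      exact List.infix_append' [] _ _
    | cons a₀ a =>
      rw [List.append_assoc, frontWord_append (by simp), innerFront_append,
        ← frontWord_eq_innerFront hx, ← List.append_assoc]
      exact List.infix_append _ _ _
  · have hsym : H.IsSymmetricPath (x :: r) :=
      isSymmetricPath_iff.2 ⟨hlink, by simpa using hx, hend⟩
    rw [frontWord_append_append hP.front_eq_back hs hsym]
    exact List.infix_append _ _ _

theorem back_mem (hC : IsWordContraction H good K vert chain) (hP : IsPruned H good L)
    (e : K.Edge) : K.back e ∈ L := by
  have : ((K.back e).reverse).reverse ∈ L := hC.reverse.front_mem hP.reverse e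
  rwa [List.reverse_reverse] at this

/-- The parts of the expanded `q` before and after the expanded `p` run between non-vanishing
vertices, so they are themselves expansions. Unique decomposition into chains then gives the
factorization of `q` in `K`. -/
theorem isSynchronized (hC : IsWordContraction H good K vert chain) (hP : IsPruned H good L)
    (hsync : H.IsSynchronized) : K.IsSynchronized := by
  intro p q hp hq s t hst
  have hC' := hC.toIsContraction
  have hp' := hP.isSymmetricPath_expand hC' hp
  have hq' := hP.isSymmetricPath_expand hC' hq
  rw [hC.frontWord_eq hP hp.linked hp.2.2, hC.frontWord_eq hP hq.linked hq.2.2] at hst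
  obtain ⟨a, b, hab, ha⟩ := hsync _ _ hp' hq' s t hst
  have hlq := hq'.linked
  have hgq := hC'.good_expand (p := q)
  obtain ⟨e₀, he₀⟩ := Option.ne_none_iff_exists'.1 (mt List.head?_eq_none_iff.1 hq.ne_nil)
  obtain ⟨e₁, he₁⟩ := Option.ne_none_iff_exists'.1 (mt List.getLast?_eq_none_iff.1 hq.ne_nil)
  obtain ⟨f₀, hf₀⟩ := Option.ne_none_iff_exists'.1 (mt List.head?_eq_none_iff.1 hp.ne_nil)
  obtain ⟨f₁, hf₁⟩ := Option.ne_none_iff_exists'.1 (mt List.getLast?_eq_none_iff.1 hp.ne_nil)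
  obtain ⟨g₀, hg₀, hs₀⟩ := hC'.head_expand he₀
  obtain ⟨g₁, hg₁, hs₁⟩ := hC'.last_expand he₁
  obtain ⟨k₀, hk₀, ht₀⟩ := hC'.head_expand hf₀
  obtain ⟨k₁, hk₁, ht₁⟩ := hC'.last_expand hf₁
  rw [hab] at hlq hgq hg₀ hg₁
  have hlq' := hlq
  rw [List.append_assoc] at hlq'
  obtain ⟨a', hla', rfl⟩ : ∃ a', K.Linked a' ∧ a'.flatMap chain = a := by
    rcases List.eq_nil_or_concat' a with rfl | ⟨a, z, rfl⟩
    · exact ⟨[], by simp [Linked], rfl⟩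
    · obtain ⟨a', h1, h2, -⟩ := hC'.exists_expand_eq hlq.left.left
        (fun f hf => hgq f (List.mem_append_left _ (List.mem_append_left _ hf)))
        ⟨g₀, by
          rwa [List.append_assoc (a ++ [z]), List.head?_append_of_ne_nil _ (by simp)] at hg₀, hs₀⟩
        ⟨z, by simp, ((List.isChain_append.1 hlq.left).2.2 z (by simp) k₀ hk₀).trans ht₀⟩
      exact ⟨a', h1, h2⟩
  obtain ⟨b', hlb', rfl⟩ : ∃ b', K.Linked b' ∧ b'.flatMap chain = b := by
    rcases b with _ | ⟨z, b⟩
    · exact ⟨[], by simp [Linked], rfl⟩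
    · obtain ⟨b', h1, h2, -⟩ := hC'.exists_expand_eq hlq.right
        (fun f hf => hgq f (List.mem_append_right _ hf))
        ⟨z, rfl, ((List.isChain_append.1 hlq'.right).2.2 k₁ hk₁ z rfl).symm.trans ht₁⟩
        ⟨g₁, by rwa [List.getLast?_append_of_ne_nil _ (by simp)] at hg₁, hs₁⟩
      exact ⟨b', h1, h2⟩
  rw [← List.flatMap_append, ← List.flatMap_append] at hab
  have hqe := hC'.flatMap_chain_injective hab
  refine ⟨a', b', hqe, ?_⟩
  rw [← ha]
  -- The left part ends in the collecting vertex where `p` starts, so in both graphs its inner back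
  -- word is its full back word, and these agree.
  rcases List.eq_nil_or_concat' a' with rfl | ⟨a₀, z, rfl⟩
  · rfl
  · have hstart : K.StartsCollecting (a₀ ++ [z]) := by
      have := hq.2.1
      rwa [hqe, List.append_assoc (a₀ ++ [z]), startsCollecting_append (by simp)] at this
    have hz : K.IsCollecting (K.tgt z) := by
      have h1 := hq.linked
      rw [hqe] at h1
      rw [(List.isChain_append.1 h1.left).2.2 z (by simp) f₀ hf₀]
      obtain ⟨f, hf, h2⟩ := hp.2.1
      rwa [Option.mem_unique hf hf₀] at h2
    have key := hC.backWord_eq hP hla' hstart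
    rw [backWord_eq_innerBack hz] at key
    rw [key]
    obtain ⟨g, hg, h3⟩ := hC'.last_expand (p := a₀ ++ [z]) (e := z) (by simp)
    obtain ⟨w, hw⟩ := List.getLast?_eq_some_iff.1 hg
    rw [hw, backWord_eq_innerBack]
    rw [h3]
    exact (hP.isCollecting_iff hC').1 hz

/-- The contraction is a Rauzy scheme. -/
theorem isRauzyScheme (hC : IsWordContraction H good K vert chain) {W : ℕ → α}
    (hP : IsPruned H good {u | IsSubword u W}) (hsync : H.IsSynchronized)
    (hthrough : ∀ e f u, good e → good f → IsSubword u W → ∃ a m p n b,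
      H.IsSymmetricPath (a ++ e :: m ++ p ++ n ++ f :: b) ∧
      (∀ g ∈ a ++ e :: m ++ p ++ n ++ f :: b, good g) ∧ H.IsSymmetricPath p ∧
      u <:+: H.frontWord p)
    (hforced : ∀ e, good e → ∃ u, IsSubword u W ∧ ∀ p, H.IsSymmetricPath p →
      u <:+: H.frontWord p → e ∈ p) :
    K.IsRauzyScheme W := by
  have hC' := hC.toIsContraction
  have := hP.finite_vert
  have := hP.finite_edge
  have hstrong : K.IsStronglyConnected := by
    intro x y
    obtain ⟨e, he, hex⟩ := hP.exists_good_src (vert x)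
    obtain ⟨f, hf, hfy⟩ := hP.exists_good_tgt (vert y)
    obtain ⟨m, hl, hg⟩ := hP.exists_linked he hf
    obtain ⟨p, hp, -, ⟨e', he', rfl⟩, f', hf', rfl⟩ := hC'.exists_expand_eq hl hg ⟨e, rfl, hex⟩
      ⟨f, List.getLast?_concat, hfy⟩
    clear hex hfy
    induction p generalizing e' with
    | nil => simp at he'
    | cons z p ih =>
      obtain rfl : z = e' := by simpa using he'
      cases p with
      | nil =>
        obtain rfl : z = f' := by simpa using hf'
        exact .single ⟨z, rfl, rfl⟩
      | cons z' p =>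
        obtain ⟨h1, h2⟩ := List.isChain_cons_cons.1 hp
        have := ih h2 z' rfl (by simpa using hf')
        rw [← h1] at this
        exact .head ⟨z, rfl, rfl⟩ this
  obtain ⟨x₀, hx₀⟩ := hP.exists_nonvanishing
  obtain ⟨y₀, rfl⟩ := (hC'.vert_range _).1 hx₀
  exact
  { finite_vert := Finite.of_injective vert hC'.vert_inj
    finite_edge := by
      refine Finite.of_injective (fun e => (chain e).head (hC'.chain_ne_nil e)) fun e f hef => ?_
      obtain ⟨h, s, hs, -⟩ := hC'.chain_eq_cons e
      obtain ⟨h', s', hs', -⟩ := hC'.chain_eq_cons f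
      simp only [hs, hs', List.head_cons] at hef
      subst hef
      exact hC'.eq_of_head hs hs'
    connected := ⟨⟨y₀⟩, fun x y => by
      induction hstrong x y with
      | refl => exact .refl _
      | tail _ h ih => exact .trans _ _ _ ih (.rel _ _ h)⟩
    vert_type := hP.contraction_vert_type hC'
    strongly_connected := hstrong
    more_than_one_edge := by
      rcases hP.contraction_vert_type hC' y₀ with h | h
      · obtain ⟨e, f, -, -, hne⟩ := Set.one_lt_encard_iff.1 h.2
        exact ⟨e, f, hne⟩
      · obtain ⟨e, f, -, -, hne⟩ := Set.one_lt_encard_iff.1 h.1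
        exact ⟨e, f, hne⟩
    front_ne_nil := hC.front_ne_nil hP
    front_head_inj := hC.front_head_inj hP
    back_ne_nil := hC.back_ne_nil hP
    back_last_inj := hC.back_last_inj hP
    front_eq_back := fun p hp => by
      rw [hC.frontWord_eq hP hp.linked hp.2.2, hC.backWord_eq hP hp.linked hp.2.1]
      exact hP.front_eq_back _ (hP.isSymmetricPath_expand hC' hp)
    path_occurs := fun p q hp hq k h => (hC.isSynchronized hP hsync).path_occurs hp hq k h
    front_subword := hC.front_mem hP
    back_subword := hC.back_mem hP
    subword_covered := fun u hu => by
      -- Starting at a non-vanishing collecting vertex and ending at a non-vanishing distributing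
      -- one makes the good path around u the expansion of a symmetric path.
      obtain ⟨c, hc, hcc⟩ := hP.exists_collecting
      obtain ⟨d, hd, hdd⟩ := hP.exists_distributing
      obtain ⟨e, he, rfl⟩ := hP.exists_good_src c
      obtain ⟨f, hf, rfl⟩ := hP.exists_good_tgt d
      obtain ⟨x, hx⟩ := (hC'.vert_range _).1 hc
      obtain ⟨y, hy⟩ := (hC'.vert_range _).1 hd
      obtain ⟨a, m, p, n, b, hs, hg, hp, hup⟩ := hthrough e f u he hf hu
      have heq : a ++ e :: m ++ p ++ n ++ f :: b = a ++ ((e :: m) ++ p ++ (n ++ [f])) ++ b := by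
        simp
      rw [heq] at hs hg
      have hl := hs.linked.left.right
      obtain ⟨q, hq, hqe, -⟩ := hC'.exists_expand_eq hl
        (fun g h => hg g (List.mem_append_left _ (List.mem_append_right _ h)))
        ⟨e, rfl, hx.symm⟩ ⟨f, by rw [← List.append_assoc]; exact List.getLast?_concat, hy.symm⟩
      have hsym : H.IsSymmetricPath ((e :: m) ++ p ++ (n ++ [f])) :=
        isSymmetricPath_of_append hl (by simpa using hcc) (by simpa using hdd)
      have hend : K.EndsDistributing q := by
        rw [← hP.endsDistributing_expand hC', hqe]
        exact hsym.2.2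
      refine ⟨q, isSymmetricPath_iff.2 ⟨hq, ?_, hend⟩, ?_⟩
      · rw [← hP.startsCollecting_expand hC', hqe]
        exact hsym.2.1
      · rw [hC.frontWord_eq hP hq hend, hqe, frontWord_append_append hP.front_eq_back hsym hp]
        exact hup.trans (List.infix_append _ _ _)
    edge_forced := fun e => by
      obtain ⟨h, s, hs, hsrc⟩ := hC'.chain_eq_cons e
      obtain ⟨u, hu, hforce⟩ := hforced h (hC'.chain_good e h (by simp [hs]))
      refine ⟨u, hu, fun p hp hup => ?_⟩
      rw [hC.frontWord_eq hP hp.linked hp.2.2] at hup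
      have hmem := hforce _ (hP.isSymmetricPath_expand hC' hp) hup
      obtain ⟨e', he', hh⟩ := List.mem_flatMap.1 hmem
      obtain ⟨h', s', hs', -⟩ := hC'.chain_eq_cons e'
      rw [hs'] at hh
      rcases List.mem_cons.1 hh with rfl | hh
      · rwa [hC'.eq_of_head hs hs']
      -- The first edge `h` of a chain leaves a non-vanishing vertex, so it cannot occur in the
      -- interior of any chain.
      · exfalso
        have hi := hC'.chain_inner e'
        have hl := hC'.chain_linked e'
        rw [hs'] at hi hl
        exact hi.of_mem_tail hl hh (hsrc ▸ hC'.isNonvanishing_vert _) }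

end IsWordContraction

end WordGraph

end RauzyEvolution

/-! ### The elementary evolution is a Rauzy scheme. -/

namespace RauzyEvolution

namespace WordGraph

open MultiDigraph

variable {α : Type w} {S : WordGraph.{u, w} α} {v : S.Edge} {hv : S.IsSupportEdge v} {W : ℕ → α}

theorem IsRauzyScheme.isSynchronized (hS : S.IsRauzyScheme W) : S.IsSynchronized :=
  isSynchronized_of_path_occurs hS.back_ne_nil hS.front_eq_back hS.path_occurs

namespace split

theorem exists_path_through_good (hrec : IsRecurrent W) (hS : S.IsRauzyScheme W)
    {e f : (S.split v hv).Edge} (he : S.IsGood W v hv e) (hf : S.IsGood W v hv f) {u : List α}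
    (hu : IsSubword u W) :
    ∃ a m p n b, (S.split v hv).IsSymmetricPath (a ++ e :: m ++ p ++ n ++ f :: b) ∧
      (∀ g ∈ a ++ e :: m ++ p ++ n ++ f :: b, S.IsGood W v hv g) ∧
      IsSubword ((S.split v hv).frontWord (a ++ e :: m ++ p ++ n ++ f :: b)) W ∧
      (S.split v hv).IsSymmetricPath p ∧ u <:+: (S.split v hv).frontWord p := by
  obtain ⟨a, m, p, n, b, hs, hw, hp, hup⟩ := exists_path_through hrec
    (isSynchronized (hv := hv) hS.isSynchronized) (frontWord_eq_backWord hS.front_eq_back)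
    (fun u hu => exists_path_of_isSubword hrec hS hS.isSynchronized hu)
    (edge_forced hS hS.isSynchronized he) (edge_forced hS hS.isSynchronized hf) hu
  exact ⟨a, m, p, n, b, hs, isGood_of_isSubword hS hs hw, hw, hp, hup⟩

theorem isPruned (hrec : IsRecurrent W) (hper : ¬ IsPeriodic W) (hS : S.IsRauzyScheme W) :
    IsPruned (S.split v hv) (S.IsGood W v hv) {u | IsSubword u W} where
  finite_vert := by
    have := hS.finite_vert
    have := hS.finite_edge
    exact inferInstanceAs
      (Finite ({x : S.Vert // x ≠ S.src v ∧ x ≠ S.tgt v} ⊕ (S.InEdge v ⊕ S.OutEdge v)))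
  finite_edge := by
    have := hS.finite_edge
    exact inferInstanceAs (Finite ({e : S.Edge // e ≠ v} ⊕ (S.InEdge v × S.OutEdge v)))
  vert_type := vert_type hS.vert_type
  incident x := by
    induction x using vert_cases with
    | h_old x hx =>
      have h : ∃ e, S.src e = x := by
        rcases hS.vert_type x with h | h
        · obtain ⟨e, -, he, -⟩ := Set.one_lt_encard_iff.1 h.2
          exact ⟨e, he⟩
        · obtain ⟨e, he⟩ := Set.encard_eq_one.1 h.2
          exact ⟨e, by simpa using he.symm.subset (Set.mem_singleton e)⟩
      obtain ⟨e, rfl⟩ := h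
      have he : e ≠ v := by
        rintro rfl
        exact hx.1 rfl
      exact ⟨old hv e he, isGood_old, .inl (src_old_of_ne hx.2)⟩
    | h_in x => exact ⟨old hv x.1 (inEdge_ne hv x), isGood_old, .inr (tgt_old_of_eq x.2)⟩
    | h_out y => exact ⟨old hv y.1 (outEdge_ne hv y), isGood_old, .inl (src_old_of_eq y.2)⟩
  reach e f he hf := by
    obtain ⟨a, m, p, n, b, hs, hg, hw, -⟩ := exists_path_through_good hrec hS he hf
      (u := []) ⟨0, fun j h => by simp at h⟩
    refine ⟨a, m ++ p ++ n, b, ?_⟩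
    simp only [List.append_assoc, List.cons_append] at hs hg hw ⊢
    exact ⟨hs, hg, hw⟩
  front_eq_back := frontWord_eq_backWord hS.front_eq_back
  front_ne_nil := front_ne_nil hS.front_ne_nil
  front_head_inj := front_head_inj hS.front_head_inj
  back_ne_nil := back_ne_nil hS.back_ne_nil
  back_last_inj := back_last_inj hS.back_last_inj
  -- The non-periodicity of `W` enters here.
  exists_nonvanishing := by
    by_contra hcon
    refine hper (isPeriodic_of_unique_good hrec (isSynchronized (hv := hv) hS.isSynchronized)
      (frontWord_eq_backWord hS.front_eq_back)
      (fun u hu => exists_path_of_isSubword hrec hS hS.isSynchronized hu)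
      (good := S.IsGood W v hv) (fun p hp hw => isGood_of_isSubword hS hp hw) ?_)
    intro e f he hf hef
    exact eq_of_not_isNonvanishing (fun h => hcon ⟨_, h⟩) hf he hef
  infix_mem u t hu ht := IsSubword.of_infix ht hu

end split

theorem isContraction_evolutionGraph (W : ℕ → α) (v : S.Edge) (hv : S.IsSupportEdge v) :
    IsContraction (S.split v hv).toMultiDigraph (S.IsGood W v hv) (S.evolutionGraph W v hv)
      Subtype.val GoodChain.path where
  vert_inj := Subtype.val_injective
  vert_range x := ⟨fun h => ⟨⟨x, h⟩, rfl⟩, by rintro ⟨y, rfl⟩; exact y.2⟩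
  chain_linked e := e.isPath.2
  chain_good e := e.good_of_mem
  chain_head e := ⟨_, List.head?_eq_some_head e.isPath.1, rfl⟩
  chain_last e := ⟨_, List.getLast?_eq_some_getLast e.isPath.1, rfl⟩
  chain_inner e := by
    intro a f g b h
    refine e.inner_vanishing f ?_
    rw [h]
    simp
  chain_inj := by
    rintro ⟨p, _, _, _, _, _⟩ ⟨q, _, _, _, _, _⟩ h
    cases h
    rfl
  chain_surj p hl hg hh ht hi := by
    obtain ⟨f, hf, hfn⟩ := hh
    obtain ⟨g, hg', hgn⟩ := ht
    have hne : p ≠ [] := by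
      rintro rfl
      simp at hf
    refine ⟨⟨p, ⟨hne, hl⟩, hg, ?_, ?_, ?_⟩, rfl⟩
    · rwa [List.head_of_mem_head? hf]
    · rwa [List.getLast_of_mem_getLast? hg']
    · intro e he
      obtain ⟨q, z, rfl⟩ := (List.eq_nil_or_concat' p).resolve_left hne
      rw [List.dropLast_concat] at he
      obtain ⟨a, b, rfl⟩ := List.append_of_mem he
      obtain ⟨c, d, hcd⟩ := List.exists_cons_of_ne_nil (l := b ++ [z]) (by simp)
      exact hi a e c d (by rw [← hcd]; simp)

/-- Natural extensions in the elementary evolution are unique, and it is a Rauzy scheme. -/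
theorem IsRauzyScheme.evolution (hrec : IsRecurrent W) (hper : ¬ IsPeriodic W)
    (hS : S.IsRauzyScheme W) (hv : S.IsSupportEdge v) :
    (∀ e, ∃! p, (S.evolutionGraph W v hv).IsRightExtension [e] p) ∧
    (∀ e, ∃! p, (S.evolutionGraph W v hv).IsLeftExtension [e] p) ∧
    (S.evolution W v hv).IsRauzyScheme W := by
  have hP := split.isPruned (v := v) (hv := hv) hrec hper hS
  have hC := isContraction_evolutionGraph (S := S) W v hv
  have hR := hP.existsUnique_rightExtension hC
  have hL := hP.existsUnique_leftExtension hC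
  have hK : IsWordContraction (S.split v hv) (S.IsGood W v hv) (S.evolution W v hv)
      Subtype.val GoodChain.path :=
    { toIsContraction := hC
      front_eq := fun e p hp => by
        have h : ∃ p, (S.evolutionGraph W v hv).IsRightExtension [e] p := ⟨p, hp⟩
        -- The extension chosen in the definition of the front word is `p` by uniqueness, and the
        -- dummy value does not occur.
        have heq : (S.evolutionGraph W v hv).rightExtension e = p :=
          (dif_pos h).trans ((hR e).unique h.choose_spec hp)
        change (S.split v hv).frontWord
          (S.expand ((S.evolutionGraph W v hv).rightExtension e)) = _
        rw [heq]
        rfl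
      back_eq := fun e p hp => by
        have h : ∃ p, (S.evolutionGraph W v hv).IsLeftExtension [e] p := ⟨p, hp⟩
        have heq : (S.evolutionGraph W v hv).leftExtension e = p :=
          (dif_pos h).trans ((hL e).unique h.choose_spec hp)
        change (S.split v hv).backWord
          (S.expand ((S.evolutionGraph W v hv).leftExtension e)) = _
        rw [heq]
        rfl }
  refine ⟨hR, hL, hK.isRauzyScheme hP (split.isSynchronized hS.isSynchronized) ?_ ?_⟩
  · intro e f u he hf hu
    obtain ⟨a, m, p, n, b, hs, hg, -, hp, hup⟩ :=
      split.exists_path_through_good hrec hS he hf hu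
    exact ⟨a, m, p, n, b, hs, hg, hp, hup⟩
  · intro e he
    exact split.edge_forced hS hS.isSynchronized he

end WordGraph

end RauzyEvolution

theorem mainTheorem3 {α : Type*} [Finite α] (W : ℕ → α)
    (hrec : RauzyEvolution.IsRecurrent W) (hper : ¬ RauzyEvolution.IsPeriodic W)
    (S : RauzyEvolution.WordGraph α) (hS : S.IsRauzyScheme W)
    (v : S.Edge) (hv : S.IsSupportEdge v) :
    (∀ e, ∃! p, (S.evolutionGraph W v hv).IsRightExtension [e] p) ∧
    (∀ e, ∃! p, (S.evolutionGraph W v hv).IsLeftExtension [e] p) ∧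
    (S.evolution W v hv).IsRauzyScheme W :=
  hS.evolution hrec hper hv
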